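/- Let $\mathsf G$ be a simply connected Lie group. An exact Courant algebroid over $\mathsf G$ is a smooth vector bundle $E\to\mathsf G$ with a non-degenerate symmetric bilinear form $\langle\cdot,\cdot\rangle$ (of signature $(n,n)$, $n=\dim\mathsf G$), an anchor $\pi:E\to T\mathsf G$ and a bilinear bracket $[\cdot,\cdot]$ on smooth sections such that, for sections $a,b,c$ and smooth functions $f$: $[a,[b,c]]=[[a,b],c]+[b,[a,c]]$; $\pi[a,b]=[\pi a,\pi b]$; $[a,fb]=f[a,b]+(\pi(a)f)\,b$; $\pi(a)\langle b,c\rangle=\langle[a,b],c\rangle+\langle b,[a,c]\rangle$; $[a,b]+[b,a]=\pi^*d\langle a,b\rangle$; and $0\to T^*\mathsf G\xrightarrow{\pi^*}E\xrightarrow{\pi}T\mathsf G\to0$ is exact, where $\langle\pi^*\xi,e\rangle=\xi(\pi e)$. A generalized metric on $E$ is a smooth orthogonal endomorphism $\mathcal G$ of $(E,\langle\cdot,\cdot\rangle)$ such that $\langle\mathcal G\cdot,\cdot\rangle$ is symmetric and positive definite. The anchor restricts to an isomorphism from the $+1$-eigenbundle of $\mathcal G$ onto $T\mathsf G$; let $\sigma_+$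 be its inverse. Then $\mathcal G$ determines the Riemannian metric $g(X,Y)=\langle\sigma_+X,\sigma_+Y\rangle$, the preferred isotropic splitting $\sigma=\sigma_+-\tfrac12\pi^*g$ and the closed $3$-form $H(X,Y,Z)=2\langle[\sigma X,\sigma Y],\sigma Z\rangle$. Put $H^2(X,Y)=g(\iota_XH,\iota_YH)=\sum_{i,j}H(X,e_i,e_j)H(Y,e_i,e_j)$, $|H|^2=\sum_{i,j,k}H(e_i,e_j,e_k)^2$ (for a $g$-orthonormal basis $(e_i)$), $\mathrm{Ric}^B=\mathrm{Ric}_g-\tfrac14H^2$, and let $d_g^*$ be the codifferential of $g$, $d_g^*H=-\sum_i\iota_{e_i}\nabla_{e_i}H$. The generalized Ricci curvature of $\mathcal G$ is the endomorphism of $E$ which, under the isomorphism $T\mathsf G\oplus T^*\mathsf G\to E$, $X+\xi\mapsto\sigma X+\tfrac12\pi^*\xi$, is $$\mathcal Rc(\mathcal G)=\begin{pmatrix} g^{-1}\mathrm{Ric}^B & \tfrac12\,g^{-1}(d^*_gH)\,g^{-1}\\ -\tfrac12\,d^*_gH & -\mathrm{Ric}^B g^{-1}\end{pmatrix}$$ (covariant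 $2$-tensors $\beta$ are viewed as maps $X\mapsto\beta(X,\cdot)$), and its generalized scalar curvature is $\mathcal S=\mathrm{scal}_g-\tfrac1{12}|H|^2$. Suppose that the action of $\mathsf G$ on itself by left translations is lifted to a smooth action on $E$ by bundle maps that preserve $\langle\cdot,\cdot\rangle$ and $[\cdot,\cdot]$; a generalized metric is called left-invariant if it commutes with this lifted action. Let $(\mathcal G_t)_{t\in(\varepsilon_-,\varepsilon_+)}$, $-\infty\le\varepsilon_-<\varepsilon_+\le\infty$, be a family of left-invariant generalized metrics on $E$ that solves the generalized Ricci flow $$\mathcal G_t^{-1}\,\frac{\partial}{\partial t}\mathcal G_t=-2\,\mathcal Rc(\mathcal G_t),$$ and suppose that $(\varepsilon_-,\varepsilon_+)$ is its maximal time interval, i.e. the family does not extend to a left-invariant solution on a strictly larger open interval. Let $\mathcal S_t$ be the generalized scalar curvature of $\mathcal G_t$ (a constant function on $\mathsf G$). Then: 1. if $\varepsilon_+<\infty$, then $\mathcal S_t\to+\infty$ as $t\to\varepsilon_+$; 2. if $\varepsilon_->-\infty$, then $\mathcal S_t\to-\infty$ as $t\to\varepsilon_-$. -/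

import Mathlib

open Bundle Set Filter
open scoped Manifold ContDiff Topology

noncomputable section

namespace GenRicci

/-! ### Riemannian geometry on a Lie group

`G` is a Lie group modelled on the finite-dimensional real vector space `V`. A field of bilinear
forms (e.g. a Riemannian metric) is given by its values `g p x y` on tangent vectors `x, y` at `p`,
a `3`-form by its values `H p x y z`. Tensors are evaluated with the help of left-invariant
extensions of tangent vectors and of a left-invariant frame; by tensoriality nothing depends on the
choice of extension or frame, and the metrics and forms need not be left-invariant. -/

section Riemannian

variable (V : Type*) [NormedAddCommGroup V] [NormedSpace ℝ V]
  (G : Type*) [TopologicalSpace G] [ChartedSpace V G]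

/-- (Not necessarily smooth) vector fields on `G`. -/
abbrev VField : Type _ := (p : G) → TangentSpace 𝓘(ℝ, V) p

/-- Fields of functions of two tangent vectors on `G`; used for covariant `2`-tensors. -/
abbrev Field2 : Type _ := (p : G) → TangentSpace 𝓘(ℝ, V) p → TangentSpace 𝓘(ℝ, V) p → ℝ

/-- Fields of functions of three tangent vectors on `G`; used for covariant `3`-tensors. -/
abbrev Field3 : Type _ := (p : G) → TangentSpace 𝓘(ℝ, V) p → TangentSpace 𝓘(ℝ, V) p →
  TangentSpace 𝓘(ℝ, V) p → ℝ

variable {V G}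

/-- The directional derivative `X f` of a function `f` along a vector field `X`. -/
def dirDeriv (X : VField V G) (f : G → ℝ) (p : G) : ℝ :=
  mfderiv 𝓘(ℝ, V) 𝓘(ℝ, ℝ) f p (X p)

variable [Group G]

/-- The left-invariant vector field on `G` whose value at `p` is `x`. -/
def leftExt (p : G) (x : TangentSpace 𝓘(ℝ, V) p) : VField V G :=
  mulInvariantVectorField (I := 𝓘(ℝ, V)) (G := G)
    (mfderiv 𝓘(ℝ, V) 𝓘(ℝ, V) (fun q : G => p⁻¹ * q) p x : V)

variable [FiniteDimensional ℝ V]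

/-- A left-invariant frame `e₁, …, eₙ` of `TG`. -/
def frame (i : Fin (Module.finrank ℝ V)) : VField V G :=
  mulInvariantVectorField (I := 𝓘(ℝ, V)) (G := G) (Module.finBasis ℝ V i : V)

/-- The inverse matrix `g^{ij}` of the matrix `g_{ij} = g(eᵢ, eⱼ)` at `p`. -/
def ginv (g : Field2 V G) (p : G) :
    Matrix (Fin (Module.finrank ℝ V)) (Fin (Module.finrank ℝ V)) ℝ :=
  (Matrix.of fun i j => g p (frame i p) (frame j p))⁻¹

/-- The vector `g⁻¹ ξ` dual to the covector `ξ` at `p`. -/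
def sharp (g : Field2 V G) (p : G) (ξ : TangentSpace 𝓘(ℝ, V) p → ℝ) : TangentSpace 𝓘(ℝ, V) p :=
  ∑ i, ∑ j, (ginv g p i j * ξ (frame i p)) • (frame j p : TangentSpace 𝓘(ℝ, V) p)

/-- The right-hand side of the Koszul formula for `2 g(∇_X Y, Z)`. -/
def koszul (g : Field2 V G) (X Y Z : VField V G) (p : G) : ℝ :=
  dirDeriv X (fun q => g q (Y q) (Z q)) p + dirDeriv Y (fun q => g q (X q) (Z q)) p
    - dirDeriv Z (fun q => g q (X q) (Y q)) p
    + g p (VectorField.mlieBracket 𝓘(ℝ, V) X Y p) (Z p)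
    - g p (VectorField.mlieBracket 𝓘(ℝ, V) X Z p) (Y p)
    - g p (VectorField.mlieBracket 𝓘(ℝ, V) Y Z p) (X p)

/-- The Levi-Civita connection `∇_X Y` of the metric `g`. -/
def nabla (g : Field2 V G) (X Y : VField V G) : VField V G := fun p =>
  ∑ i, ∑ j, (ginv g p i j * (koszul g X Y (frame i) p / 2)) •
    (frame j p : TangentSpace 𝓘(ℝ, V) p)

/-- The curvature `R(X, Y) Z = ∇_X ∇_Y Z - ∇_Y ∇_X Z - ∇_[X, Y] Z`. -/
def curvature (g : Field2 V G) (X Y Z : VField V G) : VField V G :=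
  nabla g X (nabla g Y Z) - nabla g Y (nabla g X Z)
    - nabla g (VectorField.mlieBracket 𝓘(ℝ, V) X Y) Z

/-- The Ricci tensor `Ric(y, z) = tr (x ↦ R(x, y) z)`. -/
def ricci (g : Field2 V G) : Field2 V G := fun p y z =>
  ∑ i, ∑ j, ginv g p i j * g p (curvature g (frame i) (leftExt p y) (leftExt p z) p) (frame j p)

/-- The scalar curvature of `g`. -/
def scal (g : Field2 V G) (p : G) : ℝ :=
  ∑ i, ∑ j, ginv g p i j * ricci g p (frame i p) (frame j p)

/-- `|H|²`, the sum of `H(fᵢ, fⱼ, fₖ)²` over all `i, j, k` for an orthonormal basis `f`. -/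
def normSq3 (g : Field2 V G) (H : Field3 V G) (p : G) : ℝ :=
  ∑ i, ∑ j, ∑ k, ∑ i', ∑ j', ∑ k', ginv g p i i' * ginv g p j j' * ginv g p k k' *
    H p (frame i p) (frame j p) (frame k p) * H p (frame i' p) (frame j' p) (frame k' p)

/-- `H²(x, y) = g(ι_x H, ι_y H)`, the sum of `H(x, fᵢ, fⱼ) H(y, fᵢ, fⱼ)` over all `i, j` for an
orthonormal basis `f`. -/
def square3 (g : Field2 V G) (H : Field3 V G) : Field2 V G := fun p x y =>
  ∑ i, ∑ j, ∑ i', ∑ j', ginv g p i i' * ginv g p j j' *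
    H p x (frame i p) (frame j p) * H p y (frame i' p) (frame j' p)

/-- The covariant derivative `(∇_X H)(Y, Z, W)`. -/
def nabla3 (g : Field2 V G) (H : Field3 V G) (X Y Z W : VField V G) (p : G) : ℝ :=
  dirDeriv X (fun q => H q (Y q) (Z q) (W q)) p - H p (nabla g X Y p) (Z p) (W p)
    - H p (Y p) (nabla g X Z p) (W p) - H p (Y p) (Z p) (nabla g X W p)

/-- The codifferential `(d^*_g H)(y, z) = - ∑ᵢ (∇_{fᵢ} H)(fᵢ, y, z)` (`f` orthonormal) of a
`3`-form `H`, i.e. the formal adjoint of the exterior derivative. -/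
def codiff (g : Field2 V G) (H : Field3 V G) : Field2 V G := fun p y z =>
  - ∑ i, ∑ j, ginv g p i j * nabla3 g H (frame i) (frame j) (leftExt p y) (leftExt p z) p

/-- `Ric^B = Ric - H² / 4`, the symmetric part of the Ricci tensor of the Bismut connections. -/
def ricciB (g : Field2 V G) (H : Field3 V G) : Field2 V G := fun p x y =>
  ricci g p x y - square3 g H p x y / 4

/-- The generalized scalar curvature `scal_g - |H|² / 12` of the pair `(g, H)`. -/
def genScalar (g : Field2 V G) (H : Field3 V G) (p : G) : ℝ :=
  scal g p - normSq3 g H p / 12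

end Riemannian

/-! ### Exact Courant algebroids and generalized metrics over a Lie group -/

section Courant

variable (V : Type*) [NormedAddCommGroup V] [NormedSpace ℝ V]
  (G : Type*) [TopologicalSpace G] [ChartedSpace V G] [IsManifold 𝓘(ℝ, V) ∞ G]
  (F : Type*) [NormedAddCommGroup F] [NormedSpace ℝ F]
  (E : G → Type*) [TopologicalSpace (TotalSpace F E)] [∀ p, AddCommGroup (E p)]
  [∀ p, Module ℝ (E p)] [∀ p, TopologicalSpace (E p)] [FiberBundle F E] [VectorBundle ℝ F E]

/-- The structure of an exact Courant algebroid on the smooth vector bundle `E` over `G`: a neutral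
inner product, an anchor map and a Dorfman bracket on the space of smooth sections. (Exactness
forces the rank of `E` to be `2n` and the inner product to have signature `(n, n)`, `n = dim G`,
as `ker π` is then an `n`-dimensional subspace equal to its own orthogonal complement.) -/
structure ExactCourantAlgebroid where
  /-- the neutral inner product `⟨·, ·⟩` -/
  pairing : ∀ p, E p →ₗ[ℝ] E p →ₗ[ℝ] ℝ
  pairing_symm : ∀ p e f, pairing p e f = pairing p f e
  pairing_nondegenerate : ∀ p e, (∀ f, pairing p e f = 0) → e = 0
  pairing_smooth : ∀ a b : ContMDiffSection 𝓘(ℝ, V) F ∞ E,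
    ContMDiff 𝓘(ℝ, V) 𝓘(ℝ, ℝ) ∞ fun p => pairing p (a p) (b p)
  /-- the anchor map `π : E → TG` -/
  anchor : ∀ p, E p →ₗ[ℝ] TangentSpace 𝓘(ℝ, V) p
  anchor_smooth : ∀ a : ContMDiffSection 𝓘(ℝ, V) F ∞ E,
    ContMDiff 𝓘(ℝ, V) 𝓘(ℝ, V).tangent ∞ fun p => (⟨p, anchor p (a p)⟩ : TangentBundle 𝓘(ℝ, V) G)
  /-- the Dorfman bracket `[·, ·]` -/
  bracket : ContMDiffSection 𝓘(ℝ, V) F ∞ E →ₗ[ℝ]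
    ContMDiffSection 𝓘(ℝ, V) F ∞ E →ₗ[ℝ] ContMDiffSection 𝓘(ℝ, V) F ∞ E
  /-- `[a, [b, c]] = [[a, b], c] + [b, [a, c]]` -/
  jacobi : ∀ a b c, bracket a (bracket b c) = bracket (bracket a b) c + bracket b (bracket a c)
  /-- `π [a, b] = [π a, π b]` -/
  anchor_bracket : ∀ a b p, anchor p (bracket a b p) =
    VectorField.mlieBracket 𝓘(ℝ, V) (fun q => anchor q (a q)) (fun q => anchor q (b q)) p
  /-- `[a, f b] = f [a, b] + (π(a) f) b`; here `c` is the section `f b` -/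
  leibniz : ∀ (a b c : ContMDiffSection 𝓘(ℝ, V) F ∞ E) (f : G → ℝ),
    ContMDiff 𝓘(ℝ, V) 𝓘(ℝ, ℝ) ∞ f → (∀ p, c p = f p • b p) →
    ∀ p, bracket a c p = f p • bracket a b p + dirDeriv (fun q => anchor q (a q)) f p • b p
  /-- `π(a) ⟨b, c⟩ = ⟨[a, b], c⟩ + ⟨b, [a, c]⟩` -/
  invariance : ∀ (a b c : ContMDiffSection 𝓘(ℝ, V) F ∞ E) (p : G),
    dirDeriv (fun q => anchor q (a q)) (fun q => pairing q (b q) (c q)) p =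
      pairing p (bracket a b p) (c p) + pairing p (b p) (bracket a c p)
  /-- `[a, b] + [b, a] = π^* d ⟨a, b⟩`, where `⟨π^* ξ, e⟩ = ξ (π e)` -/
  symmetric_part : ∀ (a b : ContMDiffSection 𝓘(ℝ, V) F ∞ E) (p : G) (e : E p),
    pairing p (bracket a b p + bracket b a p) e =
      mfderiv 𝓘(ℝ, V) 𝓘(ℝ, ℝ) (fun q => pairing q (a q) (b q)) p (anchor p e)
  /-- exactness of `0 → T^*G → E → TG → 0` at `TG` (equivalently, at `T^*G`) -/
  anchor_surjective : ∀ p, Function.Surjective (anchor p)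
  /-- exactness at `E`: the kernel of `π` is the image of `π^*` -/
  exact : ∀ p (e : E p), anchor p e = 0 ↔
    ∃ ξ : TangentSpace 𝓘(ℝ, V) p →ₗ[ℝ] ℝ, ∀ f, pairing p e f = ξ (anchor p f)

variable {V G F E}

namespace ExactCourantAlgebroid

variable (A : ExactCourantAlgebroid V G F E)

/-- The element `π^* ξ` of `E p`, characterised by `⟨π^* ξ, f⟩ = ξ (π f)`, for a covector `ξ`
at `p`. -/
def coanchor (p : G) (ξ : TangentSpace 𝓘(ℝ, V) p → ℝ) : E p :=
  Classical.epsilon fun e => ∀ f, A.pairing p e f = ξ (A.anchor p f)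

open Classical in
/-- The Dorfman bracket of two sections given as functions (zero if one of them is not smooth). -/
def bracketFun (a b : ∀ p, E p) (p : G) : E p :=
  if h : ContMDiff 𝓘(ℝ, V) (𝓘(ℝ, V).prod 𝓘(ℝ, F)) ∞ (fun q => TotalSpace.mk' F q (a q)) ∧
      ContMDiff 𝓘(ℝ, V) (𝓘(ℝ, V).prod 𝓘(ℝ, F)) ∞ (fun q => TotalSpace.mk' F q (b q))
  then A.bracket ⟨a, h.1⟩ ⟨b, h.2⟩ p else 0

end ExactCourantAlgebroid

/-- A generalized metric on the exact Courant algebroid `A`: a smooth orthogonal endomorphism `𝒢`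
of `E` for which `⟨𝒢 ·, ·⟩` is symmetric and positive definite. -/
structure GeneralizedMetric (A : ExactCourantAlgebroid V G F E) where
  toEnd : ∀ p, E p →ₗ[ℝ] E p
  smooth : ∀ a : ContMDiffSection 𝓘(ℝ, V) F ∞ E, ContMDiff 𝓘(ℝ, V) (𝓘(ℝ, V).prod 𝓘(ℝ, F)) ∞
    fun p => TotalSpace.mk' F p (toEnd p (a p))
  orthogonal : ∀ p e f, A.pairing p (toEnd p e) (toEnd p f) = A.pairing p e f
  symmetric : ∀ p e f, A.pairing p (toEnd p e) f = A.pairing p (toEnd p f) e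
  pos : ∀ p e, e ≠ 0 → 0 < A.pairing p (toEnd p e) e

namespace GeneralizedMetric

variable {A : ExactCourantAlgebroid V G F E} (𝒢 : GeneralizedMetric A)

/-- `σ₊ : TG → E₊`, the inverse of the isomorphism `π : E₊ → TG`, where `E₊` is the eigenbundle
of `𝒢` for the eigenvalue `1`. -/
def sigmaPlus (p : G) (x : TangentSpace 𝓘(ℝ, V) p) : E p :=
  Classical.epsilon fun e => 𝒢.toEnd p e = e ∧ A.anchor p e = x

/-- The Riemannian metric `g(x, y) = ⟨σ₊ x, σ₊ y⟩` determined by `𝒢`. -/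
def metric : Field2 V G := fun p x y => A.pairing p (𝒢.sigmaPlus p x) (𝒢.sigmaPlus p y)

/-- The preferred isotropic splitting `σ = σ₊ - π^* g / 2` determined by `𝒢`. -/
def splitting (p : G) (x : TangentSpace 𝓘(ℝ, V) p) : E p :=
  𝒢.sigmaPlus p x - (1 / 2 : ℝ) • A.coanchor p (𝒢.metric p x)

/-- The covector part of `e`: the covector `ξ` with `e = σ x + π^* ξ / 2`, `x = π e`, so that
`e ↦ x + ξ` is the isomorphism of `E` with `TG ⊕ T^*G` induced by the preferred splitting. -/
def covectorPart (p : G) (e : E p) (y : TangentSpace 𝓘(ℝ, V) p) : ℝ :=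
  2 * A.pairing p e (𝒢.splitting p y)

variable [Group G]

/-- The closed `3`-form `H(X, Y, Z) = 2 ⟨[σ X, σ Y], σ Z⟩` of the preferred splitting. -/
def torsion : Field3 V G := fun p x y z =>
  2 * A.pairing p (A.bracketFun (fun q => 𝒢.splitting q (leftExt p x q))
    (fun q => 𝒢.splitting q (leftExt p y q)) p) (𝒢.splitting p z)

variable [FiniteDimensional ℝ V]

/-- The generalized Ricci curvature, an endomorphism of `E`. Under the isomorphism of `E` with
`TG ⊕ T^*G` induced by the preferred splitting of `𝒢`, with `g` and `H` the metric and the `3`-form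
determined by `𝒢`, it is the endomorphism with matrix
`(g⁻¹ Ric^B, g⁻¹ (d^* H) g⁻¹ / 2; - d^* H / 2, - Ric^B g⁻¹)`. -/
def genRicci (p : G) (e : E p) : E p :=
  let g := 𝒢.metric
  let H := 𝒢.torsion
  let x := A.anchor p e
  let u := sharp g p (𝒢.covectorPart p e)
  𝒢.splitting p (sharp g p (ricciB g H p x) + (1 / 2 : ℝ) • sharp g p (codiff g H p u)) +
    (1 / 2 : ℝ) • A.coanchor p fun y => -(codiff g H p x y) / 2 - ricciB g H p u y

/-- The generalized scalar curvature of `𝒢`, a function on `G`. -/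
def genScalarCurvature (p : G) : ℝ := genScalar 𝒢.metric 𝒢.torsion p

end GeneralizedMetric

/-! ### Left-invariant generalized Ricci flow -/

variable [Group G]

/-- A lift of the action of `G` on itself by left translations to a (smooth) action on the exact
Courant algebroid `A` by isomorphisms of exact Courant algebroids. -/
structure LiftedAction (A : ExactCourantAlgebroid V G F E) where
  lift : ∀ a p : G, E p →ₗ[ℝ] E (a * p)
  lift_one : ∀ p (e : E p), TotalSpace.mk' F (1 * p) (lift 1 p e) = TotalSpace.mk' F p e
  lift_mul : ∀ a b p (e : E p), TotalSpace.mk' F (a * b * p) (lift (a * b) p e) =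
    TotalSpace.mk' F (a * (b * p)) (lift a (b * p) (lift b p e))
  smooth : ContMDiff (𝓘(ℝ, V).prod (𝓘(ℝ, V).prod 𝓘(ℝ, F))) (𝓘(ℝ, V).prod 𝓘(ℝ, F)) ∞
    fun x : G × TotalSpace F E => TotalSpace.mk' F (x.1 * x.2.proj) (lift x.1 x.2.proj x.2.snd)
  lift_pairing : ∀ a p e f, A.pairing (a * p) (lift a p e) (lift a p f) = A.pairing p e f
  /-- The bracket is preserved; here `tᵢ` is the image of the section `sᵢ` under the bundle map
  over the left translation by `a`. -/
  lift_bracket : ∀ (a : G) (s₁ s₂ t₁ t₂ : ContMDiffSection 𝓘(ℝ, V) F ∞ E),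
    (∀ p, t₁ (a * p) = lift a p (s₁ p)) → (∀ p, t₂ (a * p) = lift a p (s₂ p)) →
    ∀ p, A.bracket t₁ t₂ (a * p) = lift a p (A.bracket s₁ s₂ p)

/-- The generalized metric `𝒢` is left-invariant: the lifted action is by isometries. -/
def IsLeftInvariant {A : ExactCourantAlgebroid V G F E} (L : LiftedAction A)
    (𝒢 : GeneralizedMetric A) : Prop :=
  ∀ a p (e : E p), L.lift a p (𝒢.toEnd p e) = 𝒢.toEnd (a * p) (L.lift a p e)

/-- The open interval `(a, b)` of the real line, with possibly infinite ends. -/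
def timeInterval (a b : EReal) : Set ℝ := {t | a < (t : EReal) ∧ (t : EReal) < b}

variable [FiniteDimensional ℝ V]

/-- `𝒢` is a left-invariant solution of the generalized Ricci flow `𝒢⁻¹ ∂𝒢/∂t = -2 Rc(𝒢)`, i.e.
`∂𝒢/∂t = -2 𝒢 Rc(𝒢)`, on the open set `J` of times. The derivative of the curve `t ↦ 𝒢ₜ e` in the
finite-dimensional space `E p` is expressed by means of linear functionals on `E p`. -/
def IsLeftInvariantSolution {A : ExactCourantAlgebroid V G F E} (L : LiftedAction A)
    (𝒢 : ℝ → GeneralizedMetric A) (J : Set ℝ) : Prop :=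
  ∀ t ∈ J, IsLeftInvariant L (𝒢 t) ∧ ∀ p (e : E p) (ℓ : E p →ₗ[ℝ] ℝ),
    HasDerivAt (fun s => ℓ ((𝒢 s).toEnd p e))
      (ℓ ((-2 : ℝ) • (𝒢 t).toEnd p ((𝒢 t).genRicci p e))) t

/-- `𝒢` is a left-invariant solution of the generalized Ricci flow and `(a, b)` is its maximal time
interval: the solution does not extend to a left-invariant solution on a larger open interval. -/
def IsMaximalLeftInvariantSolution {A : ExactCourantAlgebroid V G F E} (L : LiftedAction A)
    (𝒢 : ℝ → GeneralizedMetric A) (a b : EReal) : Prop :=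
  a < b ∧ IsLeftInvariantSolution L 𝒢 (timeInterval a b) ∧
    ∀ (a' b' : EReal) (𝒢' : ℝ → GeneralizedMetric A), a' ≤ a → b ≤ b' →
      IsLeftInvariantSolution L 𝒢' (timeInterval a' b') →
      (∀ t ∈ timeInterval a b, 𝒢' t = 𝒢 t) → a' = a ∧ b' = b

end Courant

end GenRicci

end

/-! The lifted action identifies every fibre of `E` with `E 1`. On left-invariant sections the
Dorfman bracket becomes a Lie bracket for which the pairing is invariant, and the anchor becomes a
homomorphism to the Lie algebra of `G` (`isFiberBracket`, resting on `anchor_trans`). Fix an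
isotropic splitting of `E 1` and let `H₀` be its 3-form. A left-invariant generalized metric is then
the same thing as a bilinear form `m = g + b` with positive definite symmetric part `g`: its
`+1`-eigenspace is the graph of all `sec x + ½ π^*(m x)` (`exists_represents`,
`exists_generalizedMetric`). Its metric is `g`, its torsion is `H = H₀ + db`, and the flow becomes
the autonomous ODE `g' = -2 Ric^B`, `b' = -d^*H` on a finite-dimensional space (`flowX`,
`hasDerivAt_form_of_solution`, `hasDerivAt_toEnd_of_form`).

The heart is the identity `S' = 2 |Ric^B|² + ½ |d^*H|²`, the norms being sums over all components in
an orthonormal basis. If the group is not unimodular, the first variation of `scal` in the direction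
`h` is `-⟨h, Ric⟩ + Φ(h)` with `Φ(h) = h(Z, Z) - tr (ad Z ∘ h)`, where `Z` is dual to `x ↦ tr (ad
x)`. Here `Φ(Ric) = 0` (`divDiv_ric`), because `ad Z` is a derivation and the Killing form is
invariant, and `Φ(H²) = ⟨ι_Z H, d^*H⟩` (`divDiv_square`), because `H` is closed. The latter cancels
exactly the term by which `d^*` fails to be the algebraic adjoint of `d`
(`IsClosedArray.evolution`).

Hence `S` is monotone, and at a finite right end it tends to `+∞` or stays bounded. In the bounded
case `t + S` is bounded, and its derivative dominates the rate of change of `m` relative to `g`. A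
Grönwall argument shows that `m` converges to a form whose symmetric part is still positive definite
(`exists_tendsto_flow`). The vector field is smooth there, so the ODE continues past the end
(`exists_flow_extension`), contradicting maximality (`eq_of_isMaximal`). The left end is the same
argument for the reversed ODE and `-S`; a sign `σ = ±1` treats both at once. -/

noncomputable section

namespace GenRicci

/-! ### Riemannian geometry of an inner product on a Lie algebra -/

section LieModel

variable {ι : Type*} [Fintype ι] [DecidableEq ι] {V : Type*} [AddCommGroup V] [Module ℝ V]

/-- A symmetric, positive definite bilinear form. -/
structure IsInner (g : V →ₗ[ℝ] V →ₗ[ℝ] ℝ) : Prop where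
  symm : ∀ x y, g x y = g y x
  pos : ∀ x, x ≠ 0 → 0 < g x x

/-- The basis `f` is orthonormal for `g`. -/
def OrthoBasis (g : V →ₗ[ℝ] V →ₗ[ℝ] ℝ) (f : Module.Basis ι ℝ V) : Prop :=
  ∀ i j, g (f i) (f j) = if i = j then 1 else 0

/-- The inverse Gram matrix of `g` in the basis `e`. -/
def gramInv (e : Module.Basis ι ℝ V) (g : V →ₗ[ℝ] V →ₗ[ℝ] ℝ) : Matrix ι ι ℝ :=
  (Matrix.of fun i j => g (e i) (e j))⁻¹

/-- The trace of `T` with respect to `g`, computed in the basis `e`. -/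
def contr (e : Module.Basis ι ℝ V) (g : V →ₗ[ℝ] V →ₗ[ℝ] ℝ) (T : V → V → ℝ) : ℝ :=
  ∑ i, ∑ j, gramInv e g i j * T (e i) (e j)

/-- The vector dual to the covector `ξ`. -/
def raise (e : Module.Basis ι ℝ V) (g : V →ₗ[ℝ] V →ₗ[ℝ] ℝ) (ξ : V → ℝ) : V :=
  ∑ i, ∑ j, (gramInv e g i j * ξ (e i)) • e j

/-- The Koszul expression for left-invariant vector fields. -/
def lieKoszul (br : V →ₗ[ℝ] V →ₗ[ℝ] V) (g : V →ₗ[ℝ] V →ₗ[ℝ] ℝ) (x y z : V) : ℝ :=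
  g (br x y) z - g (br x z) y - g (br y z) x

/-- The Levi-Civita connection on left-invariant vector fields. -/
def lieNabla (e : Module.Basis ι ℝ V) (br : V →ₗ[ℝ] V →ₗ[ℝ] V) (g : V →ₗ[ℝ] V →ₗ[ℝ] ℝ)
    (x y : V) : V :=
  raise e g fun z => lieKoszul br g x y z / 2

/-- The curvature tensor on left-invariant vector fields. -/
def lieCurv (e : Module.Basis ι ℝ V) (br : V →ₗ[ℝ] V →ₗ[ℝ] V) (g : V →ₗ[ℝ] V →ₗ[ℝ] ℝ)
    (x y z : V) : V :=
  lieNabla e br g x (lieNabla e br g y z) - lieNabla e br g y (lieNabla e br g x z)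
    - lieNabla e br g (br x y) z

/-- The Ricci tensor on left-invariant vector fields. -/
def lieRic (e : Module.Basis ι ℝ V) (br : V →ₗ[ℝ] V →ₗ[ℝ] V) (g : V →ₗ[ℝ] V →ₗ[ℝ] ℝ)
    (y z : V) : ℝ :=
  contr e g fun x w => g (lieCurv e br g x y z) w

/-- The scalar curvature of a left-invariant metric. -/
def lieScal (e : Module.Basis ι ℝ V) (br : V →ₗ[ℝ] V →ₗ[ℝ] V) (g : V →ₗ[ℝ] V →ₗ[ℝ] ℝ) : ℝ :=
  contr e g (lieRic e br g)

/-- `|H|²` for a trilinear form `H`. -/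
def triNormSq (e : Module.Basis ι ℝ V) (g : V →ₗ[ℝ] V →ₗ[ℝ] ℝ)
    (H : V →ₗ[ℝ] V →ₗ[ℝ] V →ₗ[ℝ] ℝ) : ℝ :=
  contr e g fun x x' => contr e g fun y y' => contr e g fun z z' => H x y z * H x' y' z'

/-- The tensor `H²` of a trilinear form `H`. -/
def triSquare (e : Module.Basis ι ℝ V) (g : V →ₗ[ℝ] V →ₗ[ℝ] ℝ)
    (H : V →ₗ[ℝ] V →ₗ[ℝ] V →ₗ[ℝ] ℝ) (x x' : V) : ℝ :=
  contr e g fun y y' => contr e g fun z z' => H x y z * H x' y' z'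

/-- The covariant derivative of a left-invariant trilinear form. -/
def lieNabla3 (e : Module.Basis ι ℝ V) (br : V →ₗ[ℝ] V →ₗ[ℝ] V) (g : V →ₗ[ℝ] V →ₗ[ℝ] ℝ)
    (H : V →ₗ[ℝ] V →ₗ[ℝ] V →ₗ[ℝ] ℝ) (x y z w : V) : ℝ :=
  - H (lieNabla e br g x y) z w - H y (lieNabla e br g x z) w - H y z (lieNabla e br g x w)

/-- The codifferential of a left-invariant trilinear form. -/
def lieCodiff (e : Module.Basis ι ℝ V) (br : V →ₗ[ℝ] V →ₗ[ℝ] V) (g : V →ₗ[ℝ] V →ₗ[ℝ] ℝ)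
    (H : V →ₗ[ℝ] V →ₗ[ℝ] V →ₗ[ℝ] ℝ) (y z : V) : ℝ :=
  - contr e g fun x x' => lieNabla3 e br g H x x' y z

/-- The symmetric part of the Bismut Ricci tensor. -/
def lieRicB (e : Module.Basis ι ℝ V) (br : V →ₗ[ℝ] V →ₗ[ℝ] V) (g : V →ₗ[ℝ] V →ₗ[ℝ] ℝ)
    (H : V →ₗ[ℝ] V →ₗ[ℝ] V →ₗ[ℝ] ℝ) (y z : V) : ℝ :=
  lieRic e br g y z - triSquare e g H y z / 4

/-- The generalized scalar curvature of left-invariant data. -/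
def lieGenScalar (e : Module.Basis ι ℝ V) (br : V →ₗ[ℝ] V →ₗ[ℝ] V) (g : V →ₗ[ℝ] V →ₗ[ℝ] ℝ)
    (H : V →ₗ[ℝ] V →ₗ[ℝ] V →ₗ[ℝ] ℝ) : ℝ :=
  lieScal e br g - triNormSq e g H / 12

variable {g : V →ₗ[ℝ] V →ₗ[ℝ] ℝ} {e f : Module.Basis ι ℝ V}

theorem IsInner.eq_of_forall (hg : IsInner g) {v w : V} (h : ∀ z, g v z = g w z) : v = w := by
  by_contra hne
  have := hg.pos (v - w) (sub_ne_zero.2 hne)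
  simp [h] at this

/-- A kernel vector of the Gram matrix holds the coordinates of a vector orthogonal to the whole
basis, which definiteness forces to vanish. -/
theorem IsInner.det_ne_zero (hg : IsInner g) (e : Module.Basis ι ℝ V) :
    (Matrix.of fun i j => g (e i) (e j)).det ≠ 0 := by
  intro h
  obtain ⟨v, hv, h0⟩ := Matrix.exists_mulVec_eq_zero_iff.2 h
  apply hv
  have hz : ∑ j, v j • e j = 0 := by
    refine hg.eq_of_forall fun z => ?_
    have key : ∀ i, g (e i) (∑ j, v j • e j) = 0 := by
      intro i
      have := congrFun h0 i
      simpa [Matrix.mulVec, dotProduct, mul_comm] using this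
    rw [hg.symm, hg.symm 0, ← e.sum_repr z]
    rw [map_sum g, LinearMap.sum_apply]
    simp only [map_smul, LinearMap.smul_apply, key]
    simp
  have := Fintype.linearIndependent_iff.1 e.linearIndependent v hz
  exact funext this

theorem IsInner.sum_gramInv_mul (hg : IsInner g) (e : Module.Basis ι ℝ V) (i k : ι) :
    ∑ j, gramInv e g i j * g (e j) (e k) = if i = k then 1 else 0 := by
  have h := Matrix.nonsing_inv_mul (Matrix.of fun i j => g (e i) (e j))
    (isUnit_iff_ne_zero.2 (hg.det_ne_zero e))
  have := congrFun (congrFun h i) k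
  simpa [Matrix.mul_apply, gramInv, Matrix.one_apply] using this

theorem OrthoBasis.gramInv_eq (hf : OrthoBasis g f) : gramInv f g = 1 := by
  have : (Matrix.of fun i j => g (f i) (f j)) = 1 := by
    ext i j; simp [hf i j, Matrix.one_apply]
  rw [gramInv, this, inv_one]

theorem OrthoBasis.contr_eq (hf : OrthoBasis g f) (T : V → V → ℝ) :
    contr f g T = ∑ i, T (f i) (f i) := by
  simp [contr, hf.gramInv_eq, Matrix.one_apply]

theorem OrthoBasis.repr_apply (hf : OrthoBasis g f) (v : V) (i : ι) : f.repr v i = g v (f i) := by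
  conv_rhs => rw [← f.sum_repr v]
  simp only [map_sum, LinearMap.sum_apply, map_smul, LinearMap.smul_apply, hf _ i]
  simp

theorem OrthoBasis.sum_smul (hf : OrthoBasis g f) (v : V) : ∑ i, g v (f i) • f i = v := by
  conv_rhs => rw [← f.sum_repr v]
  simp [hf.repr_apply]

theorem OrthoBasis.apply_eq (hf : OrthoBasis g f) (v w : V) :
    g v w = ∑ i, g v (f i) * g w (f i) := by
  conv_lhs => rw [← hf.sum_smul w]
  simp [mul_comm]

theorem OrthoBasis.map_eq (hf : OrthoBasis g f) {W : Type*} [AddCommGroup W] [Module ℝ W]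
    (T : V →ₗ[ℝ] W) (v : V) : T v = ∑ i, g v (f i) • T (f i) := by
  conv_lhs => rw [← hf.sum_smul v]
  simp

theorem OrthoBasis.trace_eq (hf : OrthoBasis g f) (A : V →ₗ[ℝ] V) :
    LinearMap.trace ℝ V A = ∑ i, g (A (f i)) (f i) := by
  rw [LinearMap.trace_eq_matrix_trace ℝ f, Matrix.trace]
  simp [LinearMap.toMatrix_apply, hf.repr_apply]

theorem IsInner.raise_apply (hg : IsInner g) (e : Module.Basis ι ℝ V) (ξ : V →ₗ[ℝ] ℝ) (z : V) :
    g (raise e g ξ) z = ξ z := by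
  rw [← e.sum_repr z]
  simp only [raise, map_sum, LinearMap.sum_apply, map_smul, LinearMap.smul_apply, smul_eq_mul]
  refine Finset.sum_congr rfl fun k _ => ?_
  congr 1
  have : ∀ i, ∑ j, gramInv e g i j * ξ (e i) * g (e j) (e k)
      = (if i = k then 1 else 0) * ξ (e i) := by
    intro i
    rw [← hg.sum_gramInv_mul e i k, Finset.sum_mul]
    exact Finset.sum_congr rfl fun j _ => by ring
  simp [this]

/-- The trace with respect to `g` in terms of an orthonormal basis. -/
theorem IsInner.contr_eq_sum (hg : IsInner g) (e : Module.Basis ι ℝ V) (hf : OrthoBasis g f)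
    (T : V →ₗ[ℝ] V →ₗ[ℝ] ℝ) : contr e g (fun x y => T x y) = ∑ a, T (f a) (f a) := by
  -- Raising the index of `g (f a)` in the basis `e` returns `f a`; this is what makes the
  -- contraction independent of the basis.
  have h1 : ∀ a, ∑ i, g (e i) (f a) • ∑ j, gramInv e g i j • e j = f a := by
    intro a
    refine hg.eq_of_forall fun z => ?_
    rw [← hg.raise_apply e (g (f a)) z]
    congr 2
    simp only [raise, Finset.smul_sum, smul_smul, hg.symm (f a)]
    exact Finset.sum_congr rfl fun i _ => Finset.sum_congr rfl fun j _ => by rw [mul_comm]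
  have h2 : ∀ i, ∑ j, gramInv e g i j * T (e i) (e j)
      = ∑ a, g (e i) (f a) * T (f a) (∑ j, gramInv e g i j • e j) := by
    intro i
    have : ∑ j, gramInv e g i j * T (e i) (e j) = T (e i) (∑ j, gramInv e g i j • e j) := by simp
    rw [this, hf.map_eq T (e i), LinearMap.sum_apply]
    simp only [LinearMap.smul_apply, smul_eq_mul]
  simp only [contr, h2]
  rw [Finset.sum_comm]
  refine Finset.sum_congr rfl fun a _ => ?_
  calc _ = T (f a) (∑ i, g (e i) (f a) • ∑ j, gramInv e g i j • e j) := by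
        rw [map_sum]; simp only [map_smul, smul_eq_mul]
    _ = _ := by rw [h1 a]

/-- An orthogonal basis is rescaled by inverse square roots, then reindexed from `Fin (finrank ℝ V)`
to `ι`. -/
theorem IsInner.exists_orthoBasis (hg : IsInner g) (e : Module.Basis ι ℝ V) :
    ∃ f : Module.Basis ι ℝ V, OrthoBasis g f := by
  have : FiniteDimensional ℝ V := Module.Basis.finiteDimensional_of_finite e
  have hs : LinearMap.IsSymm g := ⟨fun x y => by simpa using hg.symm x y⟩
  obtain ⟨v, hv⟩ := LinearMap.BilinForm.exists_orthogonal_basis hs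
  have hpos : ∀ i, 0 < g (v i) (v i) := fun i => hg.pos _ (v.ne_zero i)
  have hne : ∀ i, IsUnit (Real.sqrt (g (v i) (v i)))⁻¹ := fun i =>
    isUnit_iff_ne_zero.2 (inv_ne_zero (Real.sqrt_ne_zero'.2 (hpos i)))
  have hc : Fintype.card (Fin (Module.finrank ℝ V)) = Fintype.card ι := by
    rw [Fintype.card_fin, Module.finrank_eq_card_basis e]
  refine ⟨(v.isUnitSMul hne).reindex (Fintype.equivOfCardEq hc), fun i j => ?_⟩
  simp only [Module.Basis.reindex_apply, Module.Basis.isUnitSMul_apply, map_smul,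
    LinearMap.smul_apply, smul_eq_mul]
  split_ifs with h
  · subst h
    have := Real.mul_self_sqrt (hpos ((Fintype.equivOfCardEq hc).symm i)).le
    have h0 := Real.sqrt_ne_zero'.2 (hpos ((Fintype.equivOfCardEq hc).symm i))
    field_simp
    nlinarith
  · have h' : (Fintype.equivOfCardEq hc).symm i ≠ (Fintype.equivOfCardEq hc).symm j := by simpa
    have := hv h'
    simp only [Function.onFun] at this
    rw [this]; simp

end LieModel

/-! ### Identities for structure constants in an orthonormal basis -/

section Arrays

variable {ι : Type*} [Fintype ι]

/-- A double sum over one index set sees only the symmetrization of its summand. Component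
identities that hold only after relabelling the summation indices thereby reduce to pointwise `ring`
checks. -/
theorem sum_sum_eq_of_symmetrization {F K : ι → ι → ℝ}
    (h : ∀ i l, F i l + F l i = K i l + K l i) : ∑ i, ∑ l, F i l = ∑ i, ∑ l, K i l := by
  have h1 : ∑ i, ∑ l, F i l + ∑ i, ∑ l, F l i = ∑ i, ∑ l, K i l + ∑ i, ∑ l, K l i := by
    simp only [← Finset.sum_add_distrib, h]
  have h2 : ∑ i, ∑ l, F l i = ∑ i, ∑ l, F i l := Finset.sum_comm
  have h3 : ∑ i, ∑ l, K l i = ∑ i, ∑ l, K i l := Finset.sum_comm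
  linarith

theorem sum_comm_four (F : ι → ι → ι → ι → ℝ) :
    ∑ a, ∑ b, ∑ i, ∑ l, F a b i l = ∑ i, ∑ l, ∑ a, ∑ b, F a b i l := by
  calc _ = ∑ a, ∑ i, ∑ b, ∑ l, F a b i l := Finset.sum_congr rfl fun a _ => Finset.sum_comm
    _ = ∑ i, ∑ a, ∑ l, ∑ b, F a b i l := by
      rw [Finset.sum_comm]
      exact Finset.sum_congr rfl fun i _ => Finset.sum_congr rfl fun a _ => Finset.sum_comm
    _ = _ := Finset.sum_congr rfl fun i _ => Finset.sum_comm

theorem sum_sum_mul_sum (F : ι → ι → ι → ι → ℝ) (x y : ι → ℝ) :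
    ∑ a, ∑ b, (∑ i, ∑ l, F a b i l) * (x a * y b)
      = ∑ i, ∑ l, ∑ a, ∑ b, F a b i l * (x a * y b) := by
  simp only [Finset.sum_mul]
  exact sum_comm_four _

/-- Structure constants of a Lie algebra in an orthonormal basis. -/
structure IsLieArray (c : ι → ι → ι → ℝ) : Prop where
  skew : ∀ i j k, c i j k = -c j i k
  jacobi : ∀ x y i l, ∑ p, c x y p * c p i l = ∑ p, c y i p * c x p l - ∑ p, c x i p * c y p l

/-- The components of the trace form `x ↦ tr (ad x)`. -/
def arrTr (c : ι → ι → ι → ℝ) (l : ι) : ℝ := ∑ i, c l i i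

/-- The matrix of `ad Z`, where `Z` is dual to the trace form. -/
def arrAd (c : ι → ι → ι → ℝ) : Matrix ι ι ℝ := Matrix.of fun a b => ∑ l, arrTr c l * c l a b

/-- The components of the Levi-Civita connection. -/
def arrGamma (c : ι → ι → ι → ℝ) (i j k : ι) : ℝ := (c i j k - c i k j - c j k i) / 2

/-- The components of the Ricci tensor. -/
def arrRic (c : ι → ι → ι → ℝ) (j k : ι) : ℝ :=
  ∑ i, ∑ l, (-(c j i l * c k i l) / 2 + c i l j * c i l k / 4 - c j i l * c k l i / 2)
    - (arrAd c j k + arrAd c k j) / 2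

variable {c : ι → ι → ι → ℝ}

/-- By the Jacobi identity `ad [x, y]` is a commutator, so its trace vanishes. -/
theorem IsLieArray.sum_tr (hc : IsLieArray c) (x y : ι) : ∑ p, c x y p * arrTr c p = 0 := by
  simp only [arrTr, Finset.mul_sum]
  rw [Finset.sum_comm]
  simp only [hc.jacobi x y, Finset.sum_sub_distrib]
  rw [sub_eq_zero, Finset.sum_comm]
  exact Finset.sum_congr rfl fun i _ => Finset.sum_congr rfl fun p _ => mul_comm _ _

theorem IsLieArray.diag (hc : IsLieArray c) (i k : ι) : c i i k = 0 := by
  have := hc.skew i i k; linarith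

/-- The left side is the trace of the curvature written with Christoffel symbols. Jacobi enters only
through the vanishing of `tr ad` on brackets, in the term with the contracted symbol; the remaining
quadratic terms agree after symmetrization in `i, l`. -/
theorem IsLieArray.ricci_eq (hc : IsLieArray c) (j k : ι) :
    ∑ i, ∑ l, (arrGamma c j k l * arrGamma c i l i - arrGamma c i k l * arrGamma c j l i
      - c i j l * arrGamma c l k i) = arrRic c j k := by
  have h1 : ∀ l, ∑ i, arrGamma c i l i = - arrTr c l := by
    intro l
    rw [arrTr, ← Finset.sum_neg_distrib]
    refine Finset.sum_congr rfl fun i _ => ?_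
    rw [arrGamma, hc.diag, hc.skew i l]; ring
  have h2 : ∑ i, ∑ l, arrGamma c j k l * arrGamma c i l i = - (arrAd c j k + arrAd c k j) / 2 := by
    rw [Finset.sum_comm]
    simp only [← Finset.mul_sum, h1]
    have h3 := hc.sum_tr j k
    have : ∀ l, arrGamma c j k l * -arrTr c l = -(c j k l * arrTr c l) / 2
        + -(arrTr c l * c l j k) / 2 + - (arrTr c l * c l k j) / 2 := by
      intro l
      rw [arrGamma, hc.skew j l, hc.skew k l]; ring
    simp only [this, Finset.sum_add_distrib, ← Finset.sum_div, Finset.sum_neg_distrib, h3, arrAd,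
      Matrix.of_apply]
    ring
  have h4 : ∑ i, ∑ l, (arrGamma c i k l * arrGamma c j l i + c i j l * arrGamma c l k i)
      = - ∑ i, ∑ l, (-(c j i l * c k i l) / 2 + c i l j * c i l k / 4 - c j i l * c k l i / 2) := by
    rw [← Finset.sum_neg_distrib]
    simp only [← Finset.sum_neg_distrib]
    refine sum_sum_eq_of_symmetrization fun i l => ?_
    simp only [arrGamma]
    rw [hc.skew i k, hc.skew l k, hc.skew i j, hc.skew l j, hc.skew l i]
    linear_combination (c j l i + c j i l) / 4 * hc.skew i l k
  have h5 : ∑ i, ∑ l, (arrGamma c j k l * arrGamma c i l i - arrGamma c i k l * arrGamma c j l i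
      - c i j l * arrGamma c l k i) = ∑ i, ∑ l, arrGamma c j k l * arrGamma c i l i
      - ∑ i, ∑ l, (arrGamma c i k l * arrGamma c j l i + c i j l * arrGamma c l k i) := by
    simp only [← Finset.sum_sub_distrib]
    exact Finset.sum_congr rfl fun i _ => Finset.sum_congr rfl fun p _ => by ring
  rw [h5, h2, h4, arrRic]
  ring

theorem arrRic_symm (c : ι → ι → ι → ℝ) (j k : ι) : arrRic c j k = arrRic c k j := by
  simp only [arrRic]
  congr 1
  · refine sum_sum_eq_of_symmetrization fun i l => ?_
    ring
  · ring

theorem trace_arrRic (c : ι → ι → ι → ℝ) :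
    ∑ j, arrRic c j j = -(∑ i, ∑ j, ∑ k, c i j k * c i j k) / 4
      - (∑ i, ∑ j, ∑ k, c i j k * c i k j) / 2 - ∑ l, arrTr c l * arrTr c l := by
  have h1 : ∑ j, ∑ i, ∑ l, c i l j * c i l j = ∑ i, ∑ j, ∑ k, c i j k * c i j k := by
    rw [Finset.sum_comm]
    exact Finset.sum_congr rfl fun i _ => Finset.sum_comm
  have h2 : ∑ j, arrAd c j j = ∑ l, arrTr c l * arrTr c l := by
    simp only [arrAd, Matrix.of_apply]
    rw [Finset.sum_comm]
    simp only [← Finset.mul_sum]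
    rfl
  simp only [arrRic, Finset.sum_add_distrib, Finset.sum_sub_distrib, ← Finset.sum_div,
    Finset.sum_neg_distrib, h1, h2]
  ring

/-- `ad [Z, x] = [ad Z, ad x]`. -/
theorem IsLieArray.sum_arrAd_mul (hc : IsLieArray c) (x i l : ι) :
    ∑ q, arrAd c x q * c q i l = ∑ p, c x i p * arrAd c p l - ∑ p, arrAd c i p * c x p l := by
  simp only [arrAd, Matrix.of_apply, Finset.sum_mul, Finset.mul_sum]
  rw [Finset.sum_comm]
  have : ∀ m, ∑ p, arrTr c m * c m x p * c p i l = arrTr c m *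
      (∑ p, c x i p * c m p l - ∑ p, c m i p * c x p l) := by
    intro m
    rw [← hc.jacobi m x i l, Finset.mul_sum]
    exact Finset.sum_congr rfl fun p _ => by ring
  simp only [this, mul_sub, Finset.sum_sub_distrib, Finset.mul_sum]
  congr 1
  · rw [Finset.sum_comm]
    exact Finset.sum_congr rfl fun i _ => Finset.sum_congr rfl fun p _ => by ring
  · rw [Finset.sum_comm]
    exact Finset.sum_congr rfl fun i _ => Finset.sum_congr rfl fun p _ => by ring

/-- Invariance of the Killing form: the trace of `ad a` against `[ad Z, ad a]` is zero by cyclicity.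
-/
theorem IsLieArray.sum_arrAd_killing (hc : IsLieArray c) :
    ∑ a, ∑ b, arrAd c a b * ∑ i, ∑ l, c a i l * c b l i = 0 := by
  have h : ∀ a, ∑ b, arrAd c a b * ∑ i, ∑ l, c a i l * c b l i = 0 := by
    intro a
    have : ∑ b, arrAd c a b * ∑ i, ∑ l, c a i l * c b l i
        = ∑ i, ∑ l, c a i l * ∑ b, arrAd c a b * c b l i := by
      simp only [Finset.mul_sum]
      rw [Finset.sum_comm]
      refine Finset.sum_congr rfl fun i _ => ?_
      rw [Finset.sum_comm]
      exact Finset.sum_congr rfl fun i _ => Finset.sum_congr rfl fun p _ => by ring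
    rw [this]
    simp only [hc.sum_arrAd_mul, mul_sub, Finset.sum_sub_distrib]
    set M : Matrix ι ι ℝ := Matrix.of fun i l => c a i l
    have e1 : ∑ i, ∑ l, c a i l * ∑ p, c a l p * arrAd c p i = (M * (M * arrAd c)).trace := by
      simp [Matrix.trace, Matrix.mul_apply, M]
    have e2 : ∑ i, ∑ l, c a i l * ∑ p, arrAd c l p * c a p i = (M * (arrAd c * M)).trace := by
      simp [Matrix.trace, Matrix.mul_apply, M]
    rw [e1, e2, ← Matrix.mul_assoc M (arrAd c), Matrix.trace_mul_comm (M * arrAd c) M, sub_self]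
  simp [h]

/-- The derivation `ad Z` annihilates the bracket under the infinitesimal action of endomorphisms.
Pairing this with the bracket itself gives two equal terms from the arguments and one from the
value. -/
theorem IsLieArray.sum_arrAd_moment (hc : IsLieArray c) :
    2 * ∑ a, ∑ b, arrAd c a b * ∑ i, ∑ l, c a i l * c b i l
      = ∑ a, ∑ b, arrAd c a b * ∑ i, ∑ l, c i l a * c i l b := by
  have h1 : ∑ a, ∑ b, arrAd c a b * ∑ i, ∑ l, c a i l * c b i l
      = ∑ a, ∑ i, ∑ l, c a i l * ∑ b, arrAd c a b * c b i l := by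
    refine Finset.sum_congr rfl fun a _ => ?_
    simp only [Finset.mul_sum]
    rw [Finset.sum_comm]
    refine Finset.sum_congr rfl fun i _ => ?_
    rw [Finset.sum_comm]
    exact Finset.sum_congr rfl fun i _ => Finset.sum_congr rfl fun p _ => by ring
  have h2 : ∑ a, ∑ i, ∑ l, c a i l * ∑ p, c a i p * arrAd c p l
      = ∑ a, ∑ b, arrAd c a b * ∑ i, ∑ l, c i l a * c i l b := by
    simp only [Finset.mul_sum]
    calc _ = ∑ i, ∑ l, ∑ a, ∑ b, arrAd c a b * (c i l a * c i l b) := by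
          refine Finset.sum_congr rfl fun a _ => Finset.sum_congr rfl fun i _ => ?_
          rw [Finset.sum_comm]
          exact Finset.sum_congr rfl fun i _ => Finset.sum_congr rfl fun p _ => by ring
      _ = ∑ i, ∑ a, ∑ l, ∑ b, arrAd c a b * (c i l a * c i l b) :=
          Finset.sum_congr rfl fun i _ => Finset.sum_comm
      _ = ∑ a, ∑ i, ∑ b, ∑ l, arrAd c a b * (c i l a * c i l b) := by
          rw [Finset.sum_comm]
          exact Finset.sum_congr rfl fun i _ => Finset.sum_congr rfl fun _ _ => Finset.sum_comm
      _ = _ := Finset.sum_congr rfl fun i _ => Finset.sum_comm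
  have h3 : ∑ a, ∑ i, ∑ l, c a i l * ∑ p, arrAd c i p * c a p l
      = ∑ a, ∑ b, arrAd c a b * ∑ i, ∑ l, c a i l * c b i l := by
    simp only [Finset.mul_sum]
    calc _ = ∑ i, ∑ a, ∑ l, ∑ p, arrAd c i p * (c i a l * c p a l) := by
          rw [Finset.sum_comm]
          refine Finset.sum_congr rfl fun i _ => Finset.sum_congr rfl fun a _ =>
            Finset.sum_congr rfl fun l _ => Finset.sum_congr rfl fun p _ => ?_
          rw [hc.skew a i, hc.skew a p]; ring
      _ = ∑ i, ∑ a, ∑ p, ∑ l, arrAd c i p * (c i a l * c p a l) :=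
          Finset.sum_congr rfl fun i _ => Finset.sum_congr rfl fun _ _ => Finset.sum_comm
      _ = _ := Finset.sum_congr rfl fun i _ => Finset.sum_comm
  have h4 : ∑ a, ∑ i, ∑ l, c a i l * ∑ b, arrAd c a b * c b i l
      = ∑ a, ∑ b, arrAd c a b * ∑ i, ∑ l, c i l a * c i l b
        - ∑ a, ∑ b, arrAd c a b * ∑ i, ∑ l, c a i l * c b i l := by
    simp only [hc.sum_arrAd_mul, mul_sub, Finset.sum_sub_distrib]
    rw [h2, h3]
  linarith

/-- The double divergence `Φ(h) = h(Z, Z) - tr (ad Z ∘ h)` of a symmetric tensor. -/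
def arrDivDiv (c : ι → ι → ι → ℝ) (h : ι → ι → ℝ) : ℝ :=
  ∑ a, ∑ b, h a b * (arrTr c a * arrTr c b) - ∑ a, ∑ b, h a b * arrAd c a b

theorem IsLieArray.tr_mul_arrAd_right (hc : IsLieArray c) (a : ι) :
    ∑ b, arrAd c a b * arrTr c b = 0 := by
  simp only [arrAd, Matrix.of_apply, Finset.sum_mul]
  rw [Finset.sum_comm]
  simp only [mul_assoc, ← Finset.mul_sum, hc.sum_tr, mul_zero, Finset.sum_const_zero]

/-- Both halves of `Φ(Ric)` equal `-½ (|ad Z|² + tr (ad Z)²)`. In `Ric(Z, Z)` the other terms die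
because `tr ad` kills brackets; in `⟨Ric, ad Z⟩` they die by the moment and Killing identities. -/
theorem IsLieArray.divDiv_ric (hc : IsLieArray c) : arrDivDiv c (arrRic c) = 0 := by
  set A := arrAd c with hA
  set θ := arrTr c with hθ
  have hl : ∀ a b, A a b = ∑ l, θ l * c l a b := fun a b => rfl
  have t1 : ∑ a, ∑ b, (∑ i, ∑ l, c a i l * c b i l) * (θ a * θ b) = ∑ i, ∑ l, A i l * A i l := by
    rw [sum_sum_mul_sum fun a b i l => c a i l * c b i l]
    refine Finset.sum_congr rfl fun i _ => Finset.sum_congr rfl fun l _ => ?_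
    rw [hl, Finset.sum_mul_sum]
    exact Finset.sum_congr rfl fun i _ => Finset.sum_congr rfl fun l _ => by ring
  have t2 : ∑ a, ∑ b, (∑ i, ∑ l, c i l a * c i l b) * (θ a * θ b) = 0 := by
    rw [sum_sum_mul_sum fun a b i l => c i l a * c i l b]
    refine Finset.sum_eq_zero fun i _ => Finset.sum_eq_zero fun l _ => ?_
    have := hc.sum_tr i l
    rw [← hθ] at this
    calc _ = (∑ p, c i l p * θ p) * ∑ p, c i l p * θ p := by
          rw [Finset.sum_mul_sum]
          exact Finset.sum_congr rfl fun i _ => Finset.sum_congr rfl fun l _ => by ring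
      _ = 0 := by rw [this, zero_mul]
  have t3 : ∑ a, ∑ b, (∑ i, ∑ l, c a i l * c b l i) * (θ a * θ b) = ∑ i, ∑ l, A i l * A l i := by
    rw [sum_sum_mul_sum fun a b i l => c a i l * c b l i]
    refine Finset.sum_congr rfl fun i _ => Finset.sum_congr rfl fun l _ => ?_
    rw [hl, hl, Finset.sum_mul_sum]
    exact Finset.sum_congr rfl fun i _ => Finset.sum_congr rfl fun l _ => by ring
  have t4 : ∑ a, ∑ b, (A a b + A b a) * (θ a * θ b) = 0 := by
    have h1 : ∑ a, ∑ b, A a b * (θ a * θ b) = 0 := by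
      refine Finset.sum_eq_zero fun a _ => ?_
      have := hc.tr_mul_arrAd_right a
      calc _ = θ a * ∑ b, A a b * θ b := by
            rw [Finset.mul_sum]; exact Finset.sum_congr rfl fun l _ => by ring
        _ = 0 := by rw [this, mul_zero]
    calc _ = ∑ a, ∑ b, A a b * (θ a * θ b) + ∑ a, ∑ b, A b a * (θ b * θ a) := by
          simp only [← Finset.sum_add_distrib]
          exact Finset.sum_congr rfl fun i _ => Finset.sum_congr rfl fun l _ => by ring
      _ = _ := by rw [Finset.sum_comm (f := fun a b => A b a * (θ b * θ a)), h1, add_zero]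
  have s1 := hc.sum_arrAd_moment
  have s2 := hc.sum_arrAd_killing
  rw [← hA] at s1 s2
  have hr : ∀ a b, arrRic c a b = -(∑ i, ∑ l, c a i l * c b i l) / 2
      + (∑ i, ∑ l, c i l a * c i l b) / 4 - (∑ i, ∑ l, c a i l * c b l i) / 2
      - (A a b + A b a) / 2 := by
    intro a b
    simp only [arrRic, Finset.sum_add_distrib, Finset.sum_sub_distrib, ← Finset.sum_div,
      Finset.sum_neg_distrib, hA]
  have u1 : ∑ a, ∑ b, arrRic c a b * (θ a * θ b) = -(∑ i, ∑ l, A i l * A i l) / 2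
      - (∑ i, ∑ l, A i l * A l i) / 2 := by
    have : ∀ a b, arrRic c a b * (θ a * θ b)
      = -((∑ i, ∑ l, c a i l * c b i l) * (θ a * θ b)) / 2
      + ((∑ i, ∑ l, c i l a * c i l b) * (θ a * θ b)) / 4
      - ((∑ i, ∑ l, c a i l * c b l i) * (θ a * θ b)) / 2
      - ((A a b + A b a) * (θ a * θ b)) / 2 := by
      intro a b; rw [hr]; ring
    simp only [this, Finset.sum_add_distrib, Finset.sum_sub_distrib, ← Finset.sum_div,
      Finset.sum_neg_distrib] at t1 t2 t3 t4 ⊢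
    rw [t1, t2, t3, t4]; ring
  have u2 : ∑ a, ∑ b, arrRic c a b * A a b = -(∑ i, ∑ l, A i l * A i l) / 2
      - (∑ i, ∑ l, A i l * A l i) / 2 := by
    have : ∀ a b, arrRic c a b * A a b
      = -(A a b * (∑ i, ∑ l, c a i l * c b i l)) / 2
      + (A a b * (∑ i, ∑ l, c i l a * c i l b)) / 4
      - (A a b * (∑ i, ∑ l, c a i l * c b l i)) / 2
      - (A a b * A a b) / 2 - (A a b * A b a) / 2 := by
      intro a b; rw [hr]; ring
    simp only [this, Finset.sum_add_distrib, Finset.sum_sub_distrib, ← Finset.sum_div,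
      Finset.sum_neg_distrib]
    linarith
  rw [arrDivDiv, u1, u2, sub_self]

/-- A skew-symmetric, closed array of components of a `3`-form. -/
structure IsClosedArray (c H : ι → ι → ι → ℝ) : Prop where
  skew_left : ∀ i j k, H i j k = -H j i k
  skew_right : ∀ i j k, H i j k = -H i k j
  closed : ∀ x i j b, ∑ p, c i j p * H x p b - ∑ p, c x b p * H i j p - ∑ p, c x i p * H p j b
    - ∑ p, c j b p * H x i p - ∑ p, c x j p * H i p b + ∑ p, c i b p * H x j p = 0

/-- The components of `ι_Z H`. -/
def arrInt (c H : ι → ι → ι → ℝ) (a b : ι) : ℝ := ∑ l, arrTr c l * H l a b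

/-- The components of the codifferential of `H`. -/
def arrCodiff (c H : ι → ι → ι → ℝ) (y z : ι) : ℝ :=
  arrInt c H y z - (∑ i, ∑ j, (c i j y * H i j z - c i j z * H i j y)) / 2

/-- The components of `H²`. -/
def arrSquare (H : ι → ι → ι → ℝ) (x y : ι) : ℝ := ∑ i, ∑ j, H x i j * H y i j

/-- The components of the exterior derivative of a left-invariant `2`-form. -/
def arrExt (c : ι → ι → ι → ℝ) (β : ι → ι → ℝ) (i j k : ι) : ℝ :=
  ∑ l, (β i l * c j k l - β j l * c i k l + β k l * c i j l)

variable {H : ι → ι → ι → ℝ}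

theorem IsClosedArray.skew_int (hH : IsClosedArray c H) (a b : ι) :
    arrInt c H a b = - arrInt c H b a := by
  simp only [arrInt, ← Finset.sum_neg_distrib]
  exact Finset.sum_congr rfl fun i _ => by rw [hH.skew_right]; ring

theorem IsClosedArray.skew_codiff (hH : IsClosedArray c H) (a b : ι) :
    arrCodiff c H a b = - arrCodiff c H b a := by
  have : ∑ i, ∑ j, (c i j a * H i j b - c i j b * H i j a)
      = - ∑ i, ∑ j, (c i j b * H i j a - c i j a * H i j b) := by
    simp only [← Finset.sum_neg_distrib]
    exact Finset.sum_congr rfl fun i _ => Finset.sum_congr rfl fun l _ => by ring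
  rw [arrCodiff, arrCodiff, hH.skew_int a b, this]; ring

/-- The formula for `-∑ᵢ (∇ᵢ H)(eᵢ, y, z)` in terms of the connection. -/
theorem IsClosedArray.codiff_eq (hc : IsLieArray c) (hH : IsClosedArray c H) (y z : ι) :
    ∑ i, ∑ l, (arrGamma c i i l * H l y z + arrGamma c i y l * H i l z + arrGamma c i z l * H i y l)
      = arrCodiff c H y z := by
  have h1 : ∑ i, ∑ l, arrGamma c i i l * H l y z = arrInt c H y z := by
    rw [Finset.sum_comm, arrInt]
    refine Finset.sum_congr rfl fun l _ => ?_
    rw [← Finset.sum_mul, arrTr]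
    congr 1
    refine Finset.sum_congr rfl fun i _ => ?_
    rw [arrGamma, hc.diag, hc.skew l i]; ring
  have h2 : ∑ i, ∑ l, (arrGamma c i y l * H i l z + arrGamma c i z l * H i y l)
      = ∑ i, ∑ j, (-(c i j y * H i j z - c i j z * H i j y) / 2) := by
    refine sum_sum_eq_of_symmetrization fun i l => ?_
    simp only [arrGamma]
    rw [hH.skew_left l i z, hH.skew_right i y l, hH.skew_right l y i, hH.skew_left l i y,
      hc.skew i y, hc.skew l y, hc.skew i z, hc.skew l z, hc.skew l i y]
    ring
  have h3 : ∑ i, ∑ l, (arrGamma c i i l * H l y z + arrGamma c i y l * H i l z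
        + arrGamma c i z l * H i y l) = ∑ i, ∑ l, arrGamma c i i l * H l y z
        + ∑ i, ∑ l, (arrGamma c i y l * H i l z + arrGamma c i z l * H i y l) := by
    simp only [← Finset.sum_add_distrib]
    exact Finset.sum_congr rfl fun i _ => Finset.sum_congr rfl fun l _ => by ring
  rw [h3, h1, h2, arrCodiff]
  simp only [← Finset.sum_div, Finset.sum_neg_distrib]
  ring

/-- Total skew-symmetry of `H` makes the three terms of `dβ` contribute equally. -/
theorem sum_mul_arrExt (hH : IsClosedArray c H) (β : ι → ι → ℝ) :
    ∑ i, ∑ j, ∑ k, H i j k * arrExt c β i j k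
      = 3 * ∑ k, ∑ l, β k l * ∑ i, ∑ j, c i j l * H i j k := by
  have e1 : ∑ i, ∑ j, ∑ k, ∑ l, H i j k * (β k l * c i j l)
      = ∑ k, ∑ l, β k l * ∑ i, ∑ j, c i j l * H i j k := by
    rw [sum_comm_four]
    simp only [Finset.mul_sum]
    exact Finset.sum_congr rfl fun i _ => Finset.sum_congr rfl fun l _ =>
      Finset.sum_congr rfl fun i _ => Finset.sum_congr rfl fun l _ => by ring
  have e2 : ∑ i, ∑ j, ∑ k, ∑ l, H i j k * (β i l * c j k l)
      = ∑ i, ∑ j, ∑ k, ∑ l, H i j k * (β k l * c i j l) := by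
    calc _ = ∑ j, ∑ i, ∑ k, ∑ l, H i j k * (β i l * c j k l) := Finset.sum_comm
      _ = ∑ j, ∑ k, ∑ i, ∑ l, H i j k * (β i l * c j k l) :=
          Finset.sum_congr rfl fun i _ => Finset.sum_comm
      _ = _ := by
          refine Finset.sum_congr rfl fun j _ => Finset.sum_congr rfl fun k _ =>
            Finset.sum_congr rfl fun i _ => Finset.sum_congr rfl fun l _ => ?_
          rw [hH.skew_left i j k, hH.skew_right j i k]; ring
  have e3 : ∑ i, ∑ j, ∑ k, ∑ l, H i j k * (β j l * c i k l)
      = -∑ i, ∑ j, ∑ k, ∑ l, H i j k * (β k l * c i j l) := by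
    simp only [← Finset.sum_neg_distrib]
    refine Finset.sum_congr rfl fun i _ => ?_
    rw [Finset.sum_comm]
    refine Finset.sum_congr rfl fun j _ => Finset.sum_congr rfl fun k _ =>
      Finset.sum_congr rfl fun i _ => ?_
    rw [hH.skew_right]; ring
  have : ∀ i j k, H i j k * arrExt c β i j k = ∑ l, H i j k * (β i l * c j k l)
      - ∑ l, H i j k * (β j l * c i k l) + ∑ l, H i j k * (β k l * c i j l) := by
    intro i j k
    rw [arrExt, Finset.mul_sum, ← Finset.sum_sub_distrib, ← Finset.sum_add_distrib]
    exact Finset.sum_congr rfl fun i _ => by ring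
  simp only [this, Finset.sum_add_distrib, Finset.sum_sub_distrib, e1, e2, e3]
  ring

/-- Compared with the pairing of `H` and `dβ`, an extra `⟨β, ι_Z H⟩` appears: on a non-unimodular
algebra `d^*` is not the algebraic adjoint of `d`. -/
theorem sum_mul_arrCodiff {β : ι → ι → ℝ} (hβ : ∀ a b, β a b = -β b a) :
    ∑ a, ∑ b, β a b * arrCodiff c H a b = ∑ a, ∑ b, β a b * arrInt c H a b
      + ∑ k, ∑ l, β k l * ∑ i, ∑ j, c i j l * H i j k := by
  have h1 : ∑ a, ∑ b, β a b * ∑ i, ∑ j, c i j a * H i j b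
      = - ∑ k, ∑ l, β k l * ∑ i, ∑ j, c i j l * H i j k := by
    rw [Finset.sum_comm]
    simp only [← Finset.sum_neg_distrib]
    exact Finset.sum_congr rfl fun i _ => Finset.sum_congr rfl fun l _ => by
      rw [hβ]; ring
  have : ∀ a b, β a b * arrCodiff c H a b = β a b * arrInt c H a b
      - (β a b * ∑ i, ∑ j, c i j a * H i j b) / 2 + (β a b * ∑ i, ∑ j, c i j b * H i j a) / 2 := by
    intro a b
    simp only [arrCodiff, Finset.sum_sub_distrib]; ring
  simp only [this, Finset.sum_add_distrib, Finset.sum_sub_distrib, ← Finset.sum_div, h1]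
  ring

/-- Cartan's formula for a closed form, `L_Z H = d ι_Z H`, paired with `H`. By skew-symmetry the
three `ad Z` terms agree, as do the three terms of `d ι_Z H`. -/
theorem IsClosedArray.sum_int (hH : IsClosedArray c H) :
    ∑ a, ∑ b, arrSquare H a b * arrAd c a b
      = - ∑ k, ∑ l, arrInt c H k l * ∑ i, ∑ j, c i j l * H i j k := by
  set K := arrInt c H with hK
  set A := arrAd c with hA
  -- Closedness with the trace form contracted into the first slot.
  have cl : ∀ i j b, ∑ p, c i j p * K p b - ∑ p, A b p * H i j p - ∑ p, A i p * H p j b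
      - ∑ p, c j b p * K i p - ∑ p, A j p * H i p b + ∑ p, c i b p * K j p = 0 := by
    intro i j b
    have h0 : ∑ x, arrTr c x * (∑ p, c i j p * H x p b - ∑ p, c x b p * H i j p
      - ∑ p, c x i p * H p j b - ∑ p, c j b p * H x i p - ∑ p, c x j p * H i p b
      + ∑ p, c i b p * H x j p) = 0 := by
      simp only [hH.closed, mul_zero, Finset.sum_const_zero]
    have k1 : ∀ (u : ι → ℝ) (v : ι → ι → ℝ), ∑ x, arrTr c x * ∑ p, u p * v x p
        = ∑ p, u p * ∑ x, arrTr c x * v x p := by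
      intro u v
      simp only [Finset.mul_sum]
      rw [Finset.sum_comm]
      exact Finset.sum_congr rfl fun i _ => Finset.sum_congr rfl fun l _ => by ring
    have k2 : ∀ (b : ι) (u : ι → ℝ), ∑ x, arrTr c x * ∑ p, c x b p * u p = ∑ p, A b p * u p := by
      intro b u
      simp only [Finset.mul_sum, hA, arrAd, Matrix.of_apply, Finset.sum_mul]
      rw [Finset.sum_comm]
      exact Finset.sum_congr rfl fun i _ => Finset.sum_congr rfl fun l _ => by ring
    simp only [mul_add, mul_sub, Finset.sum_add_distrib, Finset.sum_sub_distrib, k1, k2] at h0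
    exact h0
  have tot : ∑ i, ∑ j, ∑ b, (∑ p, c i j p * K p b - ∑ p, A b p * H i j p - ∑ p, A i p * H p j b
      - ∑ p, c j b p * K i p - ∑ p, A j p * H i p b + ∑ p, c i b p * K j p) * H i j b = 0 := by
    simp only [cl, zero_mul, Finset.sum_const_zero]
  have q1 : ∑ i, ∑ j, ∑ b, (∑ p, A b p * H i j p) * H i j b
      = ∑ a, ∑ b, arrSquare H a b * arrAd c a b := by
    calc _ = ∑ i, ∑ j, ∑ b, ∑ p, A b p * (H p i j * H b i j) := by
          refine Finset.sum_congr rfl fun i _ => Finset.sum_congr rfl fun j _ =>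
            Finset.sum_congr rfl fun b _ => ?_
          rw [Finset.sum_mul]
          refine Finset.sum_congr rfl fun p _ => ?_
          rw [hH.skew_right i j p, hH.skew_left i p j, hH.skew_right i j b, hH.skew_left i b j]; ring
      _ = _ := by
          rw [sum_comm_four]
          simp only [arrSquare, Finset.sum_mul]
          exact Finset.sum_congr rfl fun i _ => Finset.sum_congr rfl fun j _ =>
            Finset.sum_congr rfl fun b _ => Finset.sum_congr rfl fun _ _ => by rw [← hA]; ring
  have q2 : ∑ i, ∑ j, ∑ b, (∑ p, A i p * H p j b) * H i j b
      = ∑ i, ∑ j, ∑ b, (∑ p, A b p * H i j p) * H i j b := by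
    calc _ = ∑ j, ∑ b, ∑ i, (∑ p, A i p * H p j b) * H i j b := by
          rw [Finset.sum_comm]
          exact Finset.sum_congr rfl fun i _ => Finset.sum_comm
      _ = _ := by
          refine Finset.sum_congr rfl fun i _ => Finset.sum_congr rfl fun j _ =>
            Finset.sum_congr rfl fun b _ => ?_
          simp only [Finset.sum_mul]
          refine Finset.sum_congr rfl fun p _ => ?_
          rw [hH.skew_left p i j, hH.skew_right i p j, hH.skew_left b i j, hH.skew_right i b j]; ring
  have q3 : ∑ i, ∑ j, ∑ b, (∑ p, A j p * H i p b) * H i j b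
      = ∑ i, ∑ j, ∑ b, (∑ p, A b p * H i j p) * H i j b := by
    refine Finset.sum_congr rfl fun i _ => ?_
    rw [Finset.sum_comm]
    refine Finset.sum_congr rfl fun j _ => Finset.sum_congr rfl fun b _ => ?_
    simp only [Finset.sum_mul]
    refine Finset.sum_congr rfl fun p _ => ?_
    rw [hH.skew_right i p j, hH.skew_right i b j]; ring
  set Q := ∑ k, ∑ l, K k l * ∑ i, ∑ j, c i j l * H i j k with hQ
  have r1 : ∑ i, ∑ j, ∑ b, (∑ p, c i j p * K p b) * H i j b = - Q := by
    have : Q = ∑ i, ∑ j, ∑ b, ∑ p, K b p * (c i j p * H i j b) := by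
      rw [sum_comm_four]; simp only [hQ, Finset.mul_sum]
    rw [this]
    simp only [← Finset.sum_neg_distrib, Finset.sum_mul]
    refine Finset.sum_congr rfl fun i _ => Finset.sum_congr rfl fun j _ =>
        Finset.sum_congr rfl fun b _ => Finset.sum_congr rfl fun p _ => ?_
    rw [hK, hH.skew_int p b]; ring
  have r2 : ∑ i, ∑ j, ∑ b, (∑ p, c j b p * K i p) * H i j b
      = - ∑ i, ∑ j, ∑ b, (∑ p, c i j p * K p b) * H i j b := by
    calc _ = ∑ j, ∑ b, ∑ i, (∑ p, c j b p * K i p) * H i j b := by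
          rw [Finset.sum_comm]
          exact Finset.sum_congr rfl fun i _ => Finset.sum_comm
      _ = _ := by
          simp only [← Finset.sum_neg_distrib, Finset.sum_mul]
          refine Finset.sum_congr rfl fun i _ => Finset.sum_congr rfl fun j _ =>
            Finset.sum_congr rfl fun b _ => Finset.sum_congr rfl fun p _ => ?_
          rw [hK, hH.skew_int p b, hH.skew_left b i j, hH.skew_right i b j]; ring
  have r3 : ∑ i, ∑ j, ∑ b, (∑ p, c i b p * K j p) * H i j b
      = ∑ i, ∑ j, ∑ b, (∑ p, c i j p * K p b) * H i j b := by
    refine Finset.sum_congr rfl fun i _ => ?_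
    rw [Finset.sum_comm]
    refine Finset.sum_congr rfl fun j _ => Finset.sum_congr rfl fun b _ => ?_
    simp only [Finset.sum_mul]
    refine Finset.sum_congr rfl fun p _ => ?_
    rw [hK, hH.skew_int p b, hH.skew_right i b j]; ring
  simp only [add_mul, sub_mul, Finset.sum_add_distrib, Finset.sum_sub_distrib] at tot
  linarith

/-- The term `H²(Z, Z)` is `|ι_Z H|²`, and `sum_int` supplies the rest of the pairing of `ι_Z H`
with `d^*H`. -/
theorem IsClosedArray.divDiv_square (hH : IsClosedArray c H) :
    arrDivDiv c (arrSquare H) = ∑ a, ∑ b, arrInt c H a b * arrCodiff c H a b := by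
  rw [sum_mul_arrCodiff hH.skew_int, arrDivDiv, hH.sum_int]
  have : ∑ a, ∑ b, arrSquare H a b * (arrTr c a * arrTr c b)
      = ∑ a, ∑ b, arrInt c H a b * arrInt c H a b := by
    simp only [arrSquare]
    rw [sum_sum_mul_sum fun a b i l => H a i l * H b i l]
    refine Finset.sum_congr rfl fun i _ => Finset.sum_congr rfl fun l _ => ?_
    rw [arrInt, Finset.sum_mul_sum]
    exact Finset.sum_congr rfl fun i _ => Finset.sum_congr rfl fun l _ => by ring
  rw [this]; ring

end Arrays

/-! ### Differentiating the entries of an inverse matrix. -/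

section MatrixInverse

variable {ι : Type*} [Fintype ι] [DecidableEq ι]

attribute [local instance] Matrix.linftyOpNormedRing Matrix.linftyOpNormedAlgebra

theorem hasDerivAt_matrix_inv {N : ℝ → Matrix ι ι ℝ} {N' : Matrix ι ι ℝ} {t : ℝ}
    (hN : ∀ i j, HasDerivAt (fun s => N s i j) (N' i j) t) (hdet : (N t).det ≠ 0) (i j : ι) :
    HasDerivAt (fun s => (N s)⁻¹ i j) (-((N t)⁻¹ * N' * (N t)⁻¹) i j) t := by
  have h1 : HasDerivAt N N' t := by
    have : HasDerivAt (fun s => ∑ i, ∑ j, N s i j • Matrix.single i j (1 : ℝ))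
        (∑ i, ∑ j, N' i j • Matrix.single i j (1 : ℝ)) t :=
      HasDerivAt.fun_sum fun i _ => HasDerivAt.fun_sum fun j _ => (hN i j).smul_const _
    have e : ∀ M : Matrix ι ι ℝ, ∑ i, ∑ j, M i j • Matrix.single i j (1 : ℝ) = M := by
      intro M
      conv_rhs => rw [Matrix.matrix_eq_sum_single M]
      simp [Matrix.smul_single]
    simpa only [e] using this
  obtain ⟨u, hu⟩ := (Matrix.isUnit_iff_isUnit_det (N t)).2 (isUnit_iff_ne_zero.2 hdet)
  have h2 := hasFDerivAt_ringInverse (𝕜 := ℝ) u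
  rw [hu] at h2
  have h3 := h2.comp_hasDerivAt t h1
  let L : Matrix ι ι ℝ →ₗ[ℝ] ℝ := Matrix.entryLinearMap ℝ ℝ i j
  have h4 := (LinearMap.toContinuousLinearMap L).hasFDerivAt.comp_hasDerivAt t h3
  have hinv : (↑u⁻¹ : Matrix ι ι ℝ) = (N t)⁻¹ := by
    rw [← hu, Matrix.coe_units_inv]
  convert! h4 using 1
  · ext s
    simp [L, Matrix.nonsing_inv_eq_ringInverse]
  · simp [L, hinv]
    rfl

theorem contDiffAt_matrix_inv {W : Type*} [NormedAddCommGroup W] [NormedSpace ℝ W]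
    {N : W → Matrix ι ι ℝ} {w : W} {n : WithTop ℕ∞}
    (hN : ∀ i j, ContDiffAt ℝ n (fun s => N s i j) w) (hdet : (N w).det ≠ 0) (i j : ι) :
    ContDiffAt ℝ n (fun s => (N s)⁻¹ i j) w := by
  have h1 : ContDiffAt ℝ n N w := by
    have : ContDiffAt ℝ n (fun s => ∑ i, ∑ j, N s i j • Matrix.single i j (1 : ℝ)) w :=
      ContDiffAt.sum fun i _ => ContDiffAt.sum fun j _ => (hN i j).smul contDiffAt_const
    have e : ∀ M : Matrix ι ι ℝ, ∑ i, ∑ j, M i j • Matrix.single i j (1 : ℝ) = M := by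
      intro M
      conv_rhs => rw [Matrix.matrix_eq_sum_single M]
      simp [Matrix.smul_single]
    simpa only [e] using this
  obtain ⟨u, hu⟩ := (Matrix.isUnit_iff_isUnit_det (N w)).2 (isUnit_iff_ne_zero.2 hdet)
  have h2 := contDiffAt_ringInverse ℝ (n := n) u
  rw [hu] at h2
  have h3 := h2.comp w h1
  let L : Matrix ι ι ℝ →ₗ[ℝ] ℝ := Matrix.entryLinearMap ℝ ℝ i j
  have h4 := (LinearMap.toContinuousLinearMap L).contDiff.contDiffAt.comp w h3
  convert! h4 using 1
  ext s
  simp [L, Matrix.nonsing_inv_eq_ringInverse]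
  rfl

end MatrixInverse

/-! ### From invariant tensors to arrays of components. -/

section LieModel

variable {ι : Type*} [Fintype ι] [DecidableEq ι] {V : Type*} [AddCommGroup V] [Module ℝ V]

/-- The basis `u` is fixed and orthonormal only at time `t`. There the inverse Gram matrix is the
identity and its derivative is `-h`, so each contraction contributes one term with `-h`. -/
theorem hasDerivAt_contr {u : Module.Basis ι ℝ V} {g : ℝ → V →ₗ[ℝ] V →ₗ[ℝ] ℝ} {h : ι → ι → ℝ}
    {T : ℝ → V → V → ℝ} {T' : ι → ι → ℝ} {t : ℝ} (hu : OrthoBasis (g t) u)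
    (hg : ∀ i j, HasDerivAt (fun s => g s (u i) (u j)) (h i j) t)
    (hT : ∀ i j, HasDerivAt (fun s => T s (u i) (u j)) (T' i j) t) :
    HasDerivAt (fun s => contr u (g s) (T s))
      (∑ i, T' i i - ∑ i, ∑ j, h i j * T t (u i) (u j)) t := by
  have h1 : (Matrix.of fun i j => g t (u i) (u j)) = 1 := by
    ext i j; simp [hu i j, Matrix.one_apply]
  have hP : ∀ i j, HasDerivAt (fun s => gramInv u (g s) i j) (-h i j) t := by
    intro i j
    have := hasDerivAt_matrix_inv (N := fun s => Matrix.of fun i j => g s (u i) (u j))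
      (N' := Matrix.of h) (t := t) hg (by rw [h1]; simp) i j
    rw [h1] at this
    simp only [inv_one, one_mul, mul_one] at this
    exact this
  have h2 : HasDerivAt (fun s => contr u (g s) (T s))
      (∑ i, ∑ j, (-h i j * T t (u i) (u j) + gramInv u (g t) i j * T' i j)) t :=
    HasDerivAt.fun_sum fun i _ => HasDerivAt.fun_sum fun j _ => (hP i j).mul (hT i j)
  convert h2 using 1
  simp only [hu.gramInv_eq, Matrix.one_apply, Finset.sum_add_distrib, ite_mul, one_mul, zero_mul,
    Finset.sum_ite_eq, Finset.mem_univ, if_true, neg_mul, Finset.sum_neg_distrib]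
  ring

/-- The function `T` of two vectors is bilinear. -/
def IsBilin (T : V → V → ℝ) : Prop := ∃ B : V →ₗ[ℝ] V →ₗ[ℝ] ℝ, ∀ x y, T x y = B x y

variable {g : V →ₗ[ℝ] V →ₗ[ℝ] ℝ} {e f : Module.Basis ι ℝ V}

theorem IsBilin.mk {T : V → V → ℝ} (h1 : ∀ x x' y, T (x + x') y = T x y + T x' y)
    (h2 : ∀ (a : ℝ) x y, T (a • x) y = a * T x y) (h3 : ∀ x y y', T x (y + y') = T x y + T x y')
    (h4 : ∀ (a : ℝ) x y, T x (a • y) = a * T x y) : IsBilin T :=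
  ⟨LinearMap.mk₂ ℝ T h1 h2 h3 h4, fun _ _ => rfl⟩

theorem IsBilin.contr (e : Module.Basis ι ℝ V) (g : V →ₗ[ℝ] V →ₗ[ℝ] ℝ) {T : V → V → V → V → ℝ}
    (h : ∀ y y', IsBilin fun x x' => T x x' y y') : IsBilin fun x x' => contr e g (T x x') := by
  choose B hB using h
  refine ⟨∑ i, ∑ j, gramInv e g i j • B (e i) (e j), fun x y => ?_⟩
  simp [GenRicci.contr, hB]

theorem IsInner.contr_eq (hg : IsInner g) (e : Module.Basis ι ℝ V) (hf : OrthoBasis g f)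
    {T : V → V → ℝ} (hT : IsBilin T) : contr e g T = ∑ a, T (f a) (f a) := by
  obtain ⟨B, hB⟩ := hT
  have : T = fun x y => B x y := by ext x y; exact hB x y
  rw [this]
  exact hg.contr_eq_sum e hf B

theorem raise_add (e : Module.Basis ι ℝ V) (g : V →ₗ[ℝ] V →ₗ[ℝ] ℝ) (ξ η : V → ℝ) :
    raise e g (fun z => ξ z + η z) = raise e g ξ + raise e g η := by
  simp [raise, mul_add, add_smul, Finset.sum_add_distrib]

theorem raise_smul (e : Module.Basis ι ℝ V) (g : V →ₗ[ℝ] V →ₗ[ℝ] ℝ) (a : ℝ) (ξ : V → ℝ) :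
    raise e g (fun z => a * ξ z) = a • raise e g ξ := by
  simp only [raise, Finset.smul_sum, smul_smul]
  exact Finset.sum_congr rfl fun i _ => Finset.sum_congr rfl fun j _ => by congr 1; ring

/-- The Levi-Civita connection as a bilinear map. -/
def nablaL (e : Module.Basis ι ℝ V) (br : V →ₗ[ℝ] V →ₗ[ℝ] V) (g : V →ₗ[ℝ] V →ₗ[ℝ] ℝ) :
    V →ₗ[ℝ] V →ₗ[ℝ] V :=
  LinearMap.mk₂ ℝ (lieNabla e br g)
    (fun x x' y => by
      simp only [lieNabla]; rw [← raise_add]; congr 1; ext z; simp [lieKoszul]; ring)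
    (fun a x y => by
      simp only [lieNabla]; rw [← raise_smul]; congr 1; ext z; simp [lieKoszul]; ring)
    (fun x y y' => by
      simp only [lieNabla]; rw [← raise_add]; congr 1; ext z; simp [lieKoszul]; ring)
    (fun a x y => by
      simp only [lieNabla]; rw [← raise_smul]; congr 1; ext z; simp [lieKoszul]; ring)

variable {br : V →ₗ[ℝ] V →ₗ[ℝ] V} {H : V →ₗ[ℝ] V →ₗ[ℝ] V →ₗ[ℝ] ℝ}

theorem lieNabla_eq (e : Module.Basis ι ℝ V) (br : V →ₗ[ℝ] V →ₗ[ℝ] V)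
    (g : V →ₗ[ℝ] V →ₗ[ℝ] ℝ) (x y : V) : lieNabla e br g x y = nablaL e br g x y := rfl

theorem IsInner.nabla_apply (hg : IsInner g) (e : Module.Basis ι ℝ V) (br : V →ₗ[ℝ] V →ₗ[ℝ] V)
    (x y z : V) : g (nablaL e br g x y) z = lieKoszul br g x y z / 2 := by
  have := hg.raise_apply e ((1 / 2 : ℝ) • (g (br x y) - (g.flip y).comp (br x)
    - (g.flip x).comp (br y))) z
  have h : ∀ z, ((1 / 2 : ℝ) • (g (br x y) - (g.flip y).comp (br x)
    - (g.flip x).comp (br y))) z = lieKoszul br g x y z / 2 := by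
    intro z; simp [lieKoszul]; ring
  rw [h, funext h] at this
  exact this

/-- Structure constants in a basis. -/
def structConst (f : Module.Basis ι ℝ V) (br : V →ₗ[ℝ] V →ₗ[ℝ] V) (g : V →ₗ[ℝ] V →ₗ[ℝ] ℝ)
    (i j k : ι) : ℝ := g (br (f i) (f j)) (f k)

theorem IsInner.nabla_basis (hg : IsInner g) (e f : Module.Basis ι ℝ V)
    (br : V →ₗ[ℝ] V →ₗ[ℝ] V) (i j k : ι) :
    g (nablaL e br g (f i) (f j)) (f k) = arrGamma (structConst f br g) i j k := by
  rw [hg.nabla_apply]; rfl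

/-- `br` is a Lie bracket. -/
structure IsLieBracket (br : V →ₗ[ℝ] V →ₗ[ℝ] V) : Prop where
  skew : ∀ x y, br x y = - br y x
  jacobi : ∀ x y z, br (br x y) z = br x (br y z) - br y (br x z)

/-- `H` is a closed `3`-form on a Lie algebra. -/
structure IsClosed3 (br : V →ₗ[ℝ] V →ₗ[ℝ] V) (H : V →ₗ[ℝ] V →ₗ[ℝ] V →ₗ[ℝ] ℝ) : Prop where
  skew_left : ∀ x y z, H x y z = - H y x z
  skew_right : ∀ x y z, H x y z = - H x z y
  closed : ∀ x i j b, H x (br i j) b - H i j (br x b) - H (br x i) j b - H i (br x j) b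
    - H x i (br j b) + H x j (br i b) = 0

theorem IsLieBracket.isLieArray (hbr : IsLieBracket br) (hf : OrthoBasis g f) :
    IsLieArray (structConst f br g) where
  skew i j k := by simp [structConst, hbr.skew (f i)]
  jacobi x y i l := by
    have h1 : ∀ v w, g (br v (f w)) (f l) = ∑ p, g v (f p) * g (br (f p) (f w)) (f l) := by
      intro v w
      have := hf.map_eq ((g.flip (f l)).comp (br.flip (f w))) v
      simpa using this
    have h2 : ∀ v w, g (br (f w) v) (f l) = ∑ p, g v (f p) * g (br (f w) (f p)) (f l) := by
      intro v w
      have := hf.map_eq ((g.flip (f l)).comp (br (f w))) v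
      simpa using this
    simp only [structConst]
    rw [← h1, ← h2, ← h2, hbr.jacobi]
    simp

/-- The components of a trilinear form. -/
def triArr (f : Module.Basis ι ℝ V) (H : V →ₗ[ℝ] V →ₗ[ℝ] V →ₗ[ℝ] ℝ) (i j k : ι) : ℝ :=
  H (f i) (f j) (f k)

theorem OrthoBasis.tri_left (hf : OrthoBasis g f) (H : V →ₗ[ℝ] V →ₗ[ℝ] V →ₗ[ℝ] ℝ) (v y z : V) :
    H v y z = ∑ p, g v (f p) * H (f p) y z := by
  have := hf.map_eq ((H.flip y).flip z) v
  simpa using this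

theorem OrthoBasis.tri_mid (hf : OrthoBasis g f) (H : V →ₗ[ℝ] V →ₗ[ℝ] V →ₗ[ℝ] ℝ) (x v z : V) :
    H x v z = ∑ p, g v (f p) * H x (f p) z := by
  have := hf.map_eq ((H x).flip z) v
  simpa using this

theorem OrthoBasis.tri_right (hf : OrthoBasis g f) (H : V →ₗ[ℝ] V →ₗ[ℝ] V →ₗ[ℝ] ℝ) (x y v : V) :
    H x y v = ∑ p, g v (f p) * H x y (f p) := by
  have := hf.map_eq (H x y) v
  simpa using this

theorem IsClosed3.isClosedArray (hH : IsClosed3 br H) (hf : OrthoBasis g f) :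
    IsClosedArray (structConst f br g) (triArr f H) where
  skew_left i j k := hH.skew_left _ _ _
  skew_right i j k := hH.skew_right _ _ _
  closed x i j b := by
    simp only [structConst, triArr]
    have := hH.closed (f x) (f i) (f j) (f b)
    rw [hf.tri_mid H (f x), hf.tri_right H (f i), hf.tri_left H (br (f x) (f i)),
      hf.tri_mid H (f i), hf.tri_right H (f x), hf.tri_right H (f x) (f j)] at this
    linarith

theorem isBilin_curv (e : Module.Basis ι ℝ V) (br : V →ₗ[ℝ] V →ₗ[ℝ] V) (g : V →ₗ[ℝ] V →ₗ[ℝ] ℝ)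
    (y z : V) : IsBilin fun x w => g (lieCurv e br g x y z) w := by
  refine .mk ?_ ?_ ?_ ?_ <;> intros <;> simp [lieCurv, lieNabla_eq] <;> ring

theorem isBilin_ric (e : Module.Basis ι ℝ V) (br : V →ₗ[ℝ] V →ₗ[ℝ] V)
    (g : V →ₗ[ℝ] V →ₗ[ℝ] ℝ) : IsBilin (lieRic e br g) := by
  refine IsBilin.contr e g fun x w => ?_
  refine .mk ?_ ?_ ?_ ?_ <;> intros <;> simp [lieCurv, lieNabla_eq] <;> ring

theorem isBilin_square (e : Module.Basis ι ℝ V) (g : V →ₗ[ℝ] V →ₗ[ℝ] ℝ)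
    (H : V →ₗ[ℝ] V →ₗ[ℝ] V →ₗ[ℝ] ℝ) : IsBilin (triSquare e g H) := by
  refine IsBilin.contr e g fun y y' => IsBilin.contr e g fun z z' => ?_
  refine .mk ?_ ?_ ?_ ?_ <;> intros <;> simp <;> ring

theorem isBilin_codiff (e : Module.Basis ι ℝ V) (br : V →ₗ[ℝ] V →ₗ[ℝ] V)
    (g : V →ₗ[ℝ] V →ₗ[ℝ] ℝ) (H : V →ₗ[ℝ] V →ₗ[ℝ] V →ₗ[ℝ] ℝ) : IsBilin (lieCodiff e br g H) := by
  obtain ⟨B, hB⟩ : IsBilin fun y z => contr e g fun x x' => lieNabla3 e br g H x x' y z := by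
    refine IsBilin.contr e g fun y y' => ?_
    refine .mk ?_ ?_ ?_ ?_ <;> intros <;> simp [lieNabla3, lieNabla_eq] <;> ring
  exact ⟨-B, fun x y => by simp [lieCodiff, ← hB]⟩

theorem isBilin_ricB (e : Module.Basis ι ℝ V) (br : V →ₗ[ℝ] V →ₗ[ℝ] V)
    (g : V →ₗ[ℝ] V →ₗ[ℝ] ℝ) (H : V →ₗ[ℝ] V →ₗ[ℝ] V →ₗ[ℝ] ℝ) : IsBilin (lieRicB e br g H) := by
  obtain ⟨B, hB⟩ := isBilin_ric e br g
  obtain ⟨B', hB'⟩ := isBilin_square e g H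
  exact ⟨B - (1 / 4 : ℝ) • B', fun x y => by simp [lieRicB, hB, hB']; ring⟩

theorem IsInner.ric_basis (hg : IsInner g) (e : Module.Basis ι ℝ V) (hf : OrthoBasis g f)
    (hbr : IsLieBracket br) (j k : ι) :
    lieRic e br g (f j) (f k) = arrRic (structConst f br g) j k := by
  rw [← (hbr.isLieArray hf).ricci_eq, lieRic, hg.contr_eq e hf (isBilin_curv e br g _ _)]
  refine Finset.sum_congr rfl fun i _ => ?_
  have h1 : ∀ x v, g (nablaL e br g (f x) v) (f i)
      = ∑ l, g v (f l) * arrGamma (structConst f br g) x l i := by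
    intro x v
    have := hf.map_eq ((g.flip (f i)).comp (nablaL e br g (f x))) v
    simpa [hg.nabla_basis e f br] using this
  have h2 : ∀ v, g (nablaL e br g v (f k)) (f i)
      = ∑ l, g v (f l) * arrGamma (structConst f br g) l k i := by
    intro v
    have := hf.map_eq ((g.flip (f i)).comp ((nablaL e br g).flip (f k))) v
    simpa [hg.nabla_basis e f br] using this
  simp only [lieCurv, lieNabla_eq, map_sub, LinearMap.sub_apply]
  rw [h1, h1, h2]
  simp only [hg.nabla_basis e f br, ← Finset.sum_sub_distrib]
  rfl

theorem IsInner.codiff_basis (hg : IsInner g) (e : Module.Basis ι ℝ V) (hf : OrthoBasis g f)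
    (hbr : IsLieBracket br) (hH : IsClosed3 br H) (y z : ι) :
    lieCodiff e br g H (f y) (f z) = arrCodiff (structConst f br g) (triArr f H) y z := by
  rw [← (hH.isClosedArray hf).codiff_eq (hbr.isLieArray hf), lieCodiff, hg.contr_eq e hf (T := _),
    ← Finset.sum_neg_distrib]
  · refine Finset.sum_congr rfl fun i _ => ?_
    simp only [lieNabla3, lieNabla_eq]
    rw [hf.tri_left H (nablaL e br g (f i) (f i)), hf.tri_mid H (f i), hf.tri_right H (f i) (f y)]
    simp only [hg.nabla_basis e f br, Finset.sum_add_distrib]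
    simp only [triArr]
    ring
  · refine .mk ?_ ?_ ?_ ?_ <;> intros <;> simp [lieNabla3, lieNabla_eq] <;> ring

theorem IsInner.square_basis (hg : IsInner g) (e : Module.Basis ι ℝ V) (hf : OrthoBasis g f)
    (H : V →ₗ[ℝ] V →ₗ[ℝ] V →ₗ[ℝ] ℝ) (x y : V) :
    triSquare e g H x y = ∑ i, ∑ j, H x (f i) (f j) * H y (f i) (f j) := by
  rw [triSquare, hg.contr_eq e hf]
  · refine Finset.sum_congr rfl fun i _ => ?_
    rw [hg.contr_eq e hf]
    refine .mk ?_ ?_ ?_ ?_ <;> intros <;> simp <;> ring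
  · refine IsBilin.contr e g fun y y' => ?_
    refine .mk ?_ ?_ ?_ ?_ <;> intros <;> simp <;> ring

theorem IsInner.normSq_basis (hg : IsInner g) (e : Module.Basis ι ℝ V) (hf : OrthoBasis g f)
    (H : V →ₗ[ℝ] V →ₗ[ℝ] V →ₗ[ℝ] ℝ) :
    triNormSq e g H = ∑ k, ∑ i, ∑ j, H (f k) (f i) (f j) * H (f k) (f i) (f j) := by
  have := hg.contr_eq e hf (isBilin_square e g H)
  simp only [hg.square_basis e hf] at this
  exact this

/-- A formula for the scalar curvature in terms of the bracket and the metric. -/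
def scalForm (u : Module.Basis ι ℝ V) (br : V →ₗ[ℝ] V →ₗ[ℝ] V) (g : V →ₗ[ℝ] V →ₗ[ℝ] ℝ) : ℝ :=
  -(contr u g fun x x' => contr u g fun y y' => g (br x y) (br x' y')) / 4
    - (contr u g fun x y => LinearMap.trace ℝ V (br x ∘ₗ br y)) / 2
    - contr u g fun x y => LinearMap.trace ℝ V (br x) * LinearMap.trace ℝ V (br y)

theorem OrthoBasis.trace_br (hf : OrthoBasis g f) (br : V →ₗ[ℝ] V →ₗ[ℝ] V) (l : ι) :
    LinearMap.trace ℝ V (br (f l)) = arrTr (structConst f br g) l := hf.trace_eq _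

theorem OrthoBasis.trace_br_br (hf : OrthoBasis g f) (br : V →ₗ[ℝ] V →ₗ[ℝ] V) (a b : ι) :
    LinearMap.trace ℝ V (br (f a) ∘ₗ br (f b))
      = ∑ i, ∑ l, structConst f br g a i l * structConst f br g b l i := by
  rw [hf.trace_eq, Finset.sum_comm]
  refine Finset.sum_congr rfl fun i _ => ?_
  have := hf.map_eq ((g.flip (f i)).comp (br (f a))) (br (f b) (f i))
  simp only [LinearMap.comp_apply, LinearMap.flip_apply, smul_eq_mul] at this ⊢
  rw [this]
  exact Finset.sum_congr rfl fun l _ => mul_comm _ _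

/-- Unlike iterated covariant derivatives, the right side is polynomial in the metric and its
inverse Gram matrix, which makes it easy to differentiate. The bases are independent, so a moving
metric can be treated in one fixed basis. -/
theorem IsInner.scal_eq_scalForm (hg : IsInner g) (e u : Module.Basis ι ℝ V)
    (hbr : IsLieBracket br) : lieScal e br g = scalForm u br g := by
  obtain ⟨f, hf⟩ := hg.exists_orthoBasis e
  have h1 : (contr u g fun x x' => contr u g fun y y' => g (br x y) (br x' y'))
      = ∑ i, ∑ j, ∑ k, structConst f br g i j k * structConst f br g i j k := by
    rw [hg.contr_eq u hf]
    · refine Finset.sum_congr rfl fun i _ => ?_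
      rw [hg.contr_eq u hf]
      · exact Finset.sum_congr rfl fun j _ => hf.apply_eq _ _
      · refine .mk ?_ ?_ ?_ ?_ <;> intros <;> simp
    · refine IsBilin.contr u g fun y y' => ?_
      refine .mk ?_ ?_ ?_ ?_ <;> intros <;> simp
  have h2 : (contr u g fun x y => LinearMap.trace ℝ V (br x ∘ₗ br y))
      = ∑ i, ∑ j, ∑ k, structConst f br g i j k * structConst f br g i k j := by
    rw [hg.contr_eq u hf]
    · exact Finset.sum_congr rfl fun i _ => hf.trace_br_br br i i
    · refine .mk ?_ ?_ ?_ ?_ <;> intros <;>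
        simp [LinearMap.add_comp, LinearMap.comp_add, LinearMap.smul_comp, LinearMap.comp_smul]
  have h3 : (contr u g fun x y => LinearMap.trace ℝ V (br x) * LinearMap.trace ℝ V (br y))
      = ∑ l, arrTr (structConst f br g) l * arrTr (structConst f br g) l := by
    rw [hg.contr_eq u hf]
    · exact Finset.sum_congr rfl fun i _ => by rw [hf.trace_br]
    · refine .mk ?_ ?_ ?_ ?_ <;> intros <;> simp <;> ring
  rw [scalForm, h1, h2, h3, ← trace_arrRic, lieScal, hg.contr_eq e hf (isBilin_ric e br g)]
  exact Finset.sum_congr rfl fun i _ => hg.ric_basis e hf hbr i i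

theorem IsInner.normSq_eq (hg : IsInner g) (e u : Module.Basis ι ℝ V)
    (H : V →ₗ[ℝ] V →ₗ[ℝ] V →ₗ[ℝ] ℝ) : triNormSq e g H = triNormSq u g H := by
  obtain ⟨f, hf⟩ := hg.exists_orthoBasis e
  rw [hg.normSq_basis e hf, hg.normSq_basis u hf]

end LieModel

/-! ### Evolution of the generalized scalar curvature. -/

section Evolution

variable {ι : Type*} [Fintype ι]

/-- First variation of the scalar curvature: the left side is the derivative of `scalForm` in the
direction `h`. The term `Φ(h)` is left over because `Ric` contains the symmetrized `ad Z` and not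
`tr ad ⊗ tr ad`. -/
theorem sum_mul_arrRic {h : ι → ι → ℝ} (hh : ∀ a b, h a b = h b a) (c : ι → ι → ι → ℝ) :
    (∑ a, ∑ b, h a b * ∑ i, ∑ l, c a i l * c b i l) / 2
      - (∑ a, ∑ b, h a b * ∑ i, ∑ l, c i l a * c i l b) / 4
      + (∑ a, ∑ b, h a b * ∑ i, ∑ l, c a i l * c b l i) / 2
      + ∑ a, ∑ b, h a b * (arrTr c a * arrTr c b)
      = - ∑ a, ∑ b, h a b * arrRic c a b + arrDivDiv c h := by
  have hr : ∀ a b, h a b * arrRic c a b = -(h a b * ∑ i, ∑ l, c a i l * c b i l) / 2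
      + (h a b * ∑ i, ∑ l, c i l a * c i l b) / 4 - (h a b * ∑ i, ∑ l, c a i l * c b l i) / 2
      - (h a b * arrAd c a b) / 2 - (h b a * arrAd c b a) / 2 := by
    intro a b
    rw [hh b a]
    simp only [arrRic, Finset.sum_add_distrib, Finset.sum_sub_distrib, ← Finset.sum_div,
      Finset.sum_neg_distrib]
    ring
  have hs : ∑ a, ∑ b, h b a * arrAd c b a = ∑ a, ∑ b, h a b * arrAd c a b := Finset.sum_comm
  simp only [hr, arrDivDiv, Finset.sum_add_distrib, Finset.sum_sub_distrib, ← Finset.sum_div,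
      Finset.sum_neg_distrib, hs]
  ring

theorem arrDivDiv_add_smul (c : ι → ι → ι → ℝ) (x y : ℝ) (h k : ι → ι → ℝ) :
    arrDivDiv c (fun a b => x * h a b + y * k a b) = x * arrDivDiv c h + y * arrDivDiv c k := by
  simp only [arrDivDiv, add_mul, mul_assoc, Finset.sum_add_distrib, ← Finset.mul_sum]
  ring

/-- The algebraic identity behind the monotonicity of the generalized scalar curvature. -/
theorem IsClosedArray.evolution {c H : ι → ι → ι → ℝ} (hc : IsLieArray c)
    (hH : IsClosedArray c H) {h : ι → ι → ℝ}
    (hh : ∀ a b, h a b = -2 * (arrRic c a b - arrSquare H a b / 4)) :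
    (∑ a, ∑ b, h a b * ∑ i, ∑ l, c a i l * c b i l) / 2
      - (∑ a, ∑ b, h a b * ∑ i, ∑ l, c i l a * c i l b) / 4
      + (∑ a, ∑ b, h a b * ∑ i, ∑ l, c a i l * c b l i) / 2
      + ∑ a, ∑ b, h a b * (arrTr c a * arrTr c b)
      - (2 * ∑ i, ∑ j, ∑ k, H i j k * arrExt c (fun a b => -arrCodiff c H a b) i j k
        - 3 * ∑ a, ∑ b, h a b * arrSquare H a b) / 12
      = 2 * ∑ a, ∑ b, (arrRic c a b - arrSquare H a b / 4) ^ 2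
        + (∑ a, ∑ b, arrCodiff c H a b ^ 2) / 2 := by
  have hsq : ∀ a b, arrSquare H a b = arrSquare H b a := by
    intro a b; simp only [arrSquare, mul_comm]
  have hsym : ∀ a b, h a b = h b a := by
    intro a b; rw [hh, hh, arrRic_symm, hsq]
  rw [sum_mul_arrRic hsym, sum_mul_arrExt hH]
  -- Since `h = -2 Ric + ½ H²` and `Φ(Ric) = 0`, only half of `⟨ι_Z H, d^*H⟩` survives; it completes
  -- the term coming from `dH/dt` to `½ |d^*H|²`.
  have h1 : arrDivDiv c h = (∑ a, ∑ b, arrInt c H a b * arrCodiff c H a b) / 2 := by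
    have : h = fun a b => (-2) * arrRic c a b + (1 / 2) * arrSquare H a b := by
      ext a b; rw [hh]; ring
    rw [this, arrDivDiv_add_smul, hc.divDiv_ric, hH.divDiv_square]; ring
  have h2 := sum_mul_arrCodiff (c := c) (H := H) hH.skew_codiff
  have h3 : ∑ a, ∑ b, arrCodiff c H a b * arrInt c H a b
      = ∑ a, ∑ b, arrInt c H a b * arrCodiff c H a b := by simp only [mul_comm]
  have h4 : ∑ k, ∑ l, -arrCodiff c H k l * ∑ i, ∑ j, c i j l * H i j k
      = - ∑ k, ∑ l, arrCodiff c H k l * ∑ i, ∑ j, c i j l * H i j k := by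
    simp only [neg_mul, Finset.sum_neg_distrib]
  have h5 : 2 * ∑ a, ∑ b, (arrRic c a b - arrSquare H a b / 4) ^ 2
      = -∑ a, ∑ b, h a b * arrRic c a b + (∑ a, ∑ b, h a b * arrSquare H a b) / 4 := by
    simp only [Finset.mul_sum, Finset.sum_div, ← Finset.sum_neg_distrib, ← Finset.sum_add_distrib]
    exact Finset.sum_congr rfl fun a _ => Finset.sum_congr rfl fun b _ => by rw [hh]; ring
  have h6 : ∑ a, ∑ b, arrCodiff c H a b ^ 2 = ∑ a, ∑ b, arrCodiff c H a b * arrCodiff c H a b := by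
    simp only [sq]
  rw [h1, h4, h5, h6]
  linarith

variable [DecidableEq ι] {V : Type*} [AddCommGroup V] [Module ℝ V]

/-- The exterior derivative of a left-invariant `2`-form. -/
def lieExt (br : V →ₗ[ℝ] V →ₗ[ℝ] V) (β : V → V → ℝ) (x y z : V) : ℝ :=
  β x (br y z) - β y (br x z) + β z (br x y)

variable {e u f : Module.Basis ι ℝ V} {br : V →ₗ[ℝ] V →ₗ[ℝ] V}

/-- The traces `tr (ad x ∘ ad y)` and `tr (ad x)` do not involve the metric, so they vary only
through the contraction. In the norm of the bracket the two argument slots contribute equally by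
skew-symmetry, and the value slot contributes with the opposite sign. -/
theorem hasDerivAt_scalForm (hbr : IsLieBracket br) {g : ℝ → V →ₗ[ℝ] V →ₗ[ℝ] ℝ} {h : ι → ι → ℝ} {t : ℝ}
    (hu : OrthoBasis (g t) u) (hg : ∀ i j, HasDerivAt (fun s => g s (u i) (u j)) (h i j) t) :
    HasDerivAt (fun s => scalForm u br (g s))
      ((∑ a, ∑ b, h a b * ∑ i, ∑ l, structConst u br (g t) a i l * structConst u br (g t) b i l) / 2
      - (∑ a, ∑ b, h a b * ∑ i, ∑ l, structConst u br (g t) i l a * structConst u br (g t) i l b) / 4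
      + (∑ a, ∑ b, h a b * ∑ i, ∑ l, structConst u br (g t) a i l * structConst u br (g t) b l i) / 2
      + ∑ a, ∑ b, h a b * (arrTr (structConst u br (g t)) a * arrTr (structConst u br (g t)) b))
      t := by
  set c := structConst u br (g t) with hc
  have hgv : ∀ x y, HasDerivAt (fun s => g s x y)
      (∑ i, ∑ j, u.repr x i * u.repr y j * h i j) t := by
    intro x y
    have : (fun s => g s x y)
        = fun s => ∑ i, ∑ j, u.repr x i * u.repr y j * g s (u i) (u j) := by
      ext s
      conv_lhs => rw [← u.sum_repr x, ← u.sum_repr y]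
      simp only [map_sum, LinearMap.sum_apply, map_smul, LinearMap.smul_apply, smul_eq_mul,
        Finset.mul_sum]
      rw [Finset.sum_comm]
      exact Finset.sum_congr rfl fun a _ => Finset.sum_congr rfl fun b _ => by ring
    rw [this]
    exact HasDerivAt.fun_sum fun i _ => HasDerivAt.fun_sum fun j _ => (hg i j).const_mul _
  have hbrr : ∀ i j k, u.repr (br (u i) (u j)) k = c i j k := fun i j k => hu.repr_apply _ _
  have d1 := hasDerivAt_contr (h := h) (T := fun s x x' => contr u (g s) fun y y' =>
    g s (br x y) (br x' y')) hu hg (fun i i' => hasDerivAt_contr (h := h)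
      (T := fun s y y' => g s (br (u i) y) (br (u i') y')) hu hg (fun j j' => hgv _ _))
  have d2 := hasDerivAt_contr (h := h) (T := fun _ x y => LinearMap.trace ℝ V (br x ∘ₗ br y))
    hu hg (fun i j => hasDerivAt_const _ _)
  have d3 := hasDerivAt_contr (h := h)
    (T := fun _ x y => LinearMap.trace ℝ V (br x) * LinearMap.trace ℝ V (br y))
    hu hg (fun i j => hasDerivAt_const _ _)
  have d : HasDerivAt (fun s => scalForm u br (g s)) _ t :=
    ((d1.neg.div_const 4).sub (d2.div_const 2)).sub d3
  refine d.congr_deriv ?_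
  simp only [hu.contr_eq, hbrr, hu.trace_br, hu.trace_br_br, ← hc]
  have e0 : ∀ i j i' j', g t (br (u i) (u j)) (br (u i') (u j')) = ∑ l, c i j l * c i' j' l :=
    fun i j i' j' => hu.apply_eq _ _
  have e1 : ∑ i, ∑ j, ∑ k, ∑ l, c i j k * c i j l * h k l
      = ∑ a, ∑ b, h a b * ∑ i, ∑ l, c i l a * c i l b := by
    rw [sum_comm_four]
    simp only [Finset.mul_sum]
    exact Finset.sum_congr rfl fun i _ => Finset.sum_congr rfl fun l _ =>
      Finset.sum_congr rfl fun i _ => Finset.sum_congr rfl fun l _ => by ring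
  have e2 : ∑ i, ∑ a, ∑ b, h a b * ∑ l, c i a l * c i b l
      = ∑ a, ∑ b, h a b * ∑ i, ∑ l, c i a l * c i b l := by
    simp only [Finset.mul_sum]
    rw [Finset.sum_comm]
    exact Finset.sum_congr rfl fun i _ => Finset.sum_comm
  have e3 : ∀ a b, ∑ i, ∑ l, c i a l * c i b l = ∑ i, ∑ l, c a i l * c b i l := fun a b =>
    Finset.sum_congr rfl fun i _ => Finset.sum_congr rfl fun l _ => by
      have h1 : c i a l = - c a i l := by simp [hc, structConst, hbr.skew (u i)]
      have h2 : c i b l = - c b i l := by simp [hc, structConst, hbr.skew (u i)]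
      rw [h1, h2]; ring
  simp only [e0, Finset.sum_sub_distrib, e1, e2, e3, Finset.sum_const_zero]
  ring

/-- Each of the three contracted slots gives the same `-⟨h, H²⟩`, by skew-symmetry of `H`. -/
theorem hasDerivAt_triNormSq {g : ℝ → V →ₗ[ℝ] V →ₗ[ℝ] ℝ} {h : ι → ι → ℝ} {t : ℝ}
    {H : ℝ → V →ₗ[ℝ] V →ₗ[ℝ] V →ₗ[ℝ] ℝ} {H' : ι → ι → ι → ℝ}
    (hu : OrthoBasis (g t) u) (hg : ∀ i j, HasDerivAt (fun s => g s (u i) (u j)) (h i j) t)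
    (hH : ∀ i j k, HasDerivAt (fun s => H s (u i) (u j) (u k)) (H' i j k) t)
    (hl : ∀ x y z, H t x y z = - H t y x z) (hr : ∀ x y z, H t x y z = - H t x z y) :
    HasDerivAt (fun s => triNormSq u (g s) (H s))
      (2 * ∑ i, ∑ j, ∑ k, triArr u (H t) i j k * H' i j k
        - 3 * ∑ a, ∑ b, h a b * arrSquare (triArr u (H t)) a b) t := by
  have d := hasDerivAt_contr (h := h) (T := fun s x x' => contr u (g s) fun y y' =>
    contr u (g s) fun z z' => H s x y z * H s x' y' z') hu hg (fun i i' =>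
    hasDerivAt_contr (h := h) (T := fun s y y' => contr u (g s) fun z z' =>
      H s (u i) y z * H s (u i') y' z') hu hg (fun j j' =>
      hasDerivAt_contr (h := h) (T := fun s z z' => H s (u i) (u j) z * H s (u i') (u j') z')
        hu hg (fun k k' => (hH i j k).mul (hH i' j' k'))))
  refine HasDerivAt.congr_deriv (f := fun s => triNormSq u (g s) (H s)) d ?_
  simp only [hu.contr_eq]
  set K := triArr u (H t) with hK
  have hl' : ∀ i j k, K i j k = - K j i k := fun i j k => hl _ _ _
  have hr' : ∀ i j k, K i j k = - K i k j := fun i j k => hr _ _ _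
  have e1 : ∑ i, ∑ j, ∑ a, ∑ b, h a b * (K i j a * K i j b)
      = ∑ a, ∑ b, h a b * arrSquare K a b := by
    rw [sum_comm_four]
    simp only [arrSquare, Finset.mul_sum]
    refine Finset.sum_congr rfl fun i _ => Finset.sum_congr rfl fun l _ =>
      Finset.sum_congr rfl fun a _ => Finset.sum_congr rfl fun b _ => ?_
    rw [hr' a b i, hl' a i b, hr' a b l, hl' a l b]; ring
  have e2 : ∑ i, ∑ a, ∑ b, h a b * ∑ k, K i a k * K i b k
      = ∑ a, ∑ b, h a b * arrSquare K a b := by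
    simp only [arrSquare, Finset.mul_sum]
    rw [Finset.sum_comm]
    refine Finset.sum_congr rfl fun i _ => ?_
    rw [Finset.sum_comm]
    refine Finset.sum_congr rfl fun l _ => Finset.sum_congr rfl fun a _ =>
      Finset.sum_congr rfl fun b _ => ?_
    rw [hl' a i b, hl' a l b]; ring
  symm
  change _ = ∑ i, (∑ j, (∑ k, (H' i j k * K i j k + K i j k * H' i j k)
    - ∑ a, ∑ b, h a b * (K i j a * K i j b)) - ∑ a, ∑ b, h a b * ∑ k, K i a k * K i b k)
    - ∑ a, ∑ b, h a b * arrSquare K a b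
  simp only [Finset.sum_sub_distrib, Finset.sum_add_distrib, e1, e2]
  have e3 : ∑ i, ∑ j, ∑ k, H' i j k * K i j k = ∑ i, ∑ j, ∑ k, K i j k * H' i j k := by
    simp only [mul_comm]
  rw [e3]; ring

/-- Along the generalized Ricci flow the generalized scalar curvature is non-decreasing. -/
theorem hasDerivAt_lieGenScalar (hbr : IsLieBracket br) {g : ℝ → V →ₗ[ℝ] V →ₗ[ℝ] ℝ}
    {H : ℝ → V →ₗ[ℝ] V →ₗ[ℝ] V →ₗ[ℝ] ℝ} {t : ℝ} (hpos : ∀ᶠ s in 𝓝 t, IsInner (g s))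
    (hclosed : IsClosed3 br (H t))
    (hg : ∀ x y, HasDerivAt (fun s => g s x y) (-2 * lieRicB e br (g t) (H t) x y) t)
    (hH : ∀ x y z, HasDerivAt (fun s => H s x y z)
      (lieExt br (fun x y => -lieCodiff e br (g t) (H t) x y) x y z) t)
    (hu : OrthoBasis (g t) u) :
    HasDerivAt (fun s => lieGenScalar e br (g s) (H s))
      (2 * ∑ a, ∑ b, lieRicB e br (g t) (H t) (u a) (u b) ^ 2
        + (∑ a, ∑ b, lieCodiff e br (g t) (H t) (u a) (u b) ^ 2) / 2) t := by
  have hgt := hpos.self_of_nhds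
  have hca := hclosed.isClosedArray hu
  set c := structConst u br (g t) with hc
  set K := triArr u (H t) with hK
  have hR : ∀ a b, lieRicB e br (g t) (H t) (u a) (u b) = arrRic c a b - arrSquare K a b / 4 := by
    intro a b
    rw [lieRicB, hgt.ric_basis e hu hbr, hgt.square_basis e hu]; rfl
  have hD : ∀ a b, lieCodiff e br (g t) (H t) (u a) (u b) = arrCodiff c K a b := fun a b =>
    hgt.codiff_basis e hu hbr hclosed a b
  have d1 := hasDerivAt_scalForm (br := br) hbr hu (fun i j => hg (u i) (u j))
  have d2 := hasDerivAt_triNormSq hu (fun i j => hg (u i) (u j))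
    (fun i j k => hH (u i) (u j) (u k)) hclosed.skew_left hclosed.skew_right
  have hext : ∀ i j k, lieExt br (fun x y => -lieCodiff e br (g t) (H t) x y) (u i) (u j) (u k)
      = arrExt c (fun a b => -arrCodiff c K a b) i j k := by
    intro i j k
    obtain ⟨B, hB⟩ := isBilin_codiff e br (g t) (H t)
    have h1 : ∀ i v, lieCodiff e br (g t) (H t) (u i) v = ∑ l, g t v (u l) * arrCodiff c K i l := by
      intro i v
      rw [hB, hu.map_eq (B (u i)) v]
      simp only [← hB, hD, smul_eq_mul]
    simp only [lieExt, arrExt, h1, ← Finset.sum_neg_distrib, ← Finset.sum_sub_distrib,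
      ← Finset.sum_add_distrib]
    refine Finset.sum_congr rfl fun l _ => ?_
    simp only [hc, structConst]
    ring
  -- The formulas in the fixed basis `u` hold for every inner product, hence at all nearby times;
  -- orthonormality of `u` is needed only at `t`.
  have key := (d1.sub (d2.div_const 12)).congr_of_eventuallyEq
    (f₁ := fun s => lieGenScalar e br (g s) (H s)) (by
      filter_upwards [hpos] with s hs
      simp only [lieGenScalar, hs.scal_eq_scalForm e u hbr, hs.normSq_eq e u, Pi.sub_apply])
  refine key.congr_deriv ?_
  have := IsClosedArray.evolution (hbr.isLieArray hu) hca
    (h := fun a b => -2 * (arrRic c a b - arrSquare K a b / 4)) (fun a b => rfl)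
  simp only [hext, hR, hD, ← hc, ← hK] at this ⊢
  rw [← this]

end Evolution

/-! ### Limits and continuation of solutions of ODEs. -/

section Extension

/-- A solution of an autonomous ODE which converges at the end of its time interval to a point
where the vector field is `C¹` extends beyond this end. -/
theorem exists_extension_of_tendsto {W : Type*} [NormedAddCommGroup W] [NormedSpace ℝ W]
    [CompleteSpace W] {X : W → W} {w : ℝ → W} {w₀ : W} {a T : ℝ} (haT : a < T)
    (hX : ContDiffAt ℝ 1 X w₀) (hw : ∀ t ∈ Ioo a T, HasDerivAt w (X (w t)) t)
    (hlim : Tendsto w (𝓝[<] T) (𝓝 w₀)) :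
    ∃ δ > 0, ∃ v : ℝ → W, (∀ t < T, v t = w t) ∧ v T = w₀ ∧
      ∀ t ∈ Ioo a (T + δ), HasDerivAt v (X (v t)) t := by
  obtain ⟨α, hα0, δ, hδ, hα⟩ :=
    hX.exists_forall_mem_closedBall_exists_eq_forall_mem_Ioo_hasDerivAt₀ T
  refine ⟨δ, hδ, fun t => if t < T then w t else α t, fun t ht => if_pos ht, ?_, ?_⟩
  · simp [hα0]
  intro t ht
  rcases lt_trichotomy t T with h | h | h
  · have : (fun t => if t < T then w t else α t) =ᶠ[𝓝 t] w := by
      filter_upwards [Iio_mem_nhds h] with s hs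
      exact if_pos hs
    simp only [if_pos h]
    exact (hw t ⟨ht.1, h⟩).congr_of_eventuallyEq this
  · subst h
    simp only [lt_irrefl, if_false, hα0]
    -- At the junction the left derivative is the limit of the derivatives `X (w s)`, and the right
    -- derivative comes from the local solution through `w₀`; both equal `X w₀`.
    rw [← hasDerivWithinAt_univ, ← Iic_union_Ici (a := t)]
    refine HasDerivWithinAt.union ?_ ?_
    · have hev : (fun s => if s < t then w s else α s) =ᶠ[𝓝[<] t] w := by
        filter_upwards [self_mem_nhdsWithin] with s hs
        exact if_pos hs
      refine hasDerivWithinAt_Iic_of_tendsto_deriv (s := Ioo a t) ?_ ?_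
        (Ioo_mem_nhdsLT haT) ?_
      · intro s hs
        have : (fun s => if s < t then w s else α s) =ᶠ[𝓝 s] w := by
          filter_upwards [Iio_mem_nhds hs.2] with r hr
          exact if_pos hr
        exact ((hw s hs).congr_of_eventuallyEq this).differentiableAt.differentiableWithinAt
      · have h1 : Tendsto (fun s => if s < t then w s else α s) (𝓝[<] t) (𝓝 w₀) :=
          hlim.congr' hev.symm
        have h2 : ContinuousWithinAt (fun s => if s < t then w s else α s) (Iio t) t := by
          simpa [ContinuousWithinAt, hα0] using h1
        exact h2.mono Ioo_subset_Iio_self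
      · have h1 : Tendsto (fun s => X (w s)) (𝓝[<] t) (𝓝 (X w₀)) :=
          hX.continuousAt.tendsto.comp hlim
        refine h1.congr' ?_
        filter_upwards [Ioo_mem_nhdsLT haT] with s hs
        have : (fun s => if s < t then w s else α s) =ᶠ[𝓝 s] w := by
          filter_upwards [Iio_mem_nhds hs.2] with r hr
          exact if_pos hr
        exact ((hw s hs).congr_of_eventuallyEq this).deriv.symm
    · have h1 := (hα t ⟨by linarith, by linarith⟩).hasDerivWithinAt (s := Ici t)
      rw [hα0] at h1
      exact h1.congr (fun s hs => if_neg (not_lt.2 hs)) (if_neg (lt_irrefl t))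
  · have : (fun t => if t < T then w t else α t) =ᶠ[𝓝 t] α := by
      filter_upwards [Ioi_mem_nhds h] with s hs
      exact if_neg (not_lt.2 (le_of_lt hs))
    simp only [if_neg (not_lt.2 h.le)]
    exact (hα t ⟨by linarith, ht.2⟩).congr_of_eventuallyEq this

theorem monotoneOn_Ioo_of_hasDerivAt_nonneg {f f' : ℝ → ℝ} {a b : ℝ}
    (hf : ∀ t ∈ Ioo a b, HasDerivAt f (f' t) t) (h : ∀ t ∈ Ioo a b, 0 ≤ f' t) :
    MonotoneOn f (Ioo a b) := by
  refine monotoneOn_of_deriv_nonneg (convex_Ioo a b)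
    (fun t ht => (hf t ht).continuousAt.continuousWithinAt) ?_ ?_
  · rw [interior_Ioo]
    exact fun t ht => (hf t ht).differentiableAt.differentiableWithinAt
  · rw [interior_Ioo]
    exact fun t ht => by rw [(hf t ht).deriv]; exact h t ht

/-- A function whose derivative is dominated by the derivative of a function bounded above
converges at the right end of the interval. -/
theorem exists_tendsto_of_abs_deriv_le {f f' φ φ' : ℝ → ℝ} {a T M : ℝ} (haT : a < T)
    (hf : ∀ t ∈ Ioo a T, HasDerivAt f (f' t) t) (hφ : ∀ t ∈ Ioo a T, HasDerivAt φ (φ' t) t)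
    (hle : ∀ t ∈ Ioo a T, |f' t| ≤ φ' t) (hM : ∀ t ∈ Ioo a T, φ t ≤ M) :
    ∃ l, Tendsto f (𝓝[<] T) (𝓝 l) := by
  obtain ⟨t₀, ht₀⟩ := exists_between haT
  have hsub : Ioo t₀ T ⊆ Ioo a T := Ioo_subset_Ioo_left ht₀.1.le
  have h1 : MonotoneOn (fun t => φ t + f t) (Ioo a T) :=
    monotoneOn_Ioo_of_hasDerivAt_nonneg (fun t ht => (hφ t ht).add (hf t ht)) fun t ht => by
      have := abs_le.1 (hle t ht); linarith [this.1]
  have h2 : MonotoneOn (fun t => φ t - f t) (Ioo a T) :=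
    monotoneOn_Ioo_of_hasDerivAt_nonneg (fun t ht => (hφ t ht).sub (hf t ht)) fun t ht => by
      have := abs_le.1 (hle t ht); linarith [this.2]
  have h3 : MonotoneOn φ (Ioo a T) :=
    monotoneOn_Ioo_of_hasDerivAt_nonneg hφ fun t ht => (abs_nonneg _).trans (hle t ht)
  have hne : (Ioo t₀ T).Nonempty := nonempty_Ioo.2 ht₀.2
  -- The upper bound comes from `φ + f = 2φ - (φ - f)`, where `φ - f` is at least its value at `t₀`.
  -- The limit of `f` is then that of `(φ + f) - φ`.
  have l1 := (h1.mono hsub).tendsto_nhdsWithin_Ioo_left hne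
    ⟨2 * M - (φ t₀ - f t₀), by
      rintro _ ⟨t, ht, rfl⟩
      have := h2 ⟨ht₀.1, ht₀.2⟩ (hsub ht) ht.1.le
      have := hM t (hsub ht)
      simp only at *
      linarith⟩
  have l3 := (h3.mono hsub).tendsto_nhdsWithin_Ioo_left hne
    ⟨M, by rintro _ ⟨t, ht, rfl⟩; exact hM t (hsub ht)⟩
  refine ⟨_, (l1.sub l3).congr fun t => ?_⟩
  ring

end Extension

/-! ### Bilinear forms `m = g + b` and their convergence. -/

section Forms

variable {ι : Type*} [Fintype ι] {V : Type*} [AddCommGroup V] [Module ℝ V]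

/-- The bilinear form with a given matrix. -/
def formOf (e : Module.Basis ι ℝ V) (m : ι → ι → ℝ) : V →ₗ[ℝ] V →ₗ[ℝ] ℝ :=
  ∑ i, ∑ j, m i j • (e.coord i).smulRight (e.coord j)

theorem formOf_apply (e : Module.Basis ι ℝ V) (m : ι → ι → ℝ) (x y : V) :
    formOf e m x y = ∑ i, ∑ j, m i j * (e.repr x i * e.repr y j) := by
  simp [formOf]

theorem form_eq_sum (e : Module.Basis ι ℝ V) (m : V →ₗ[ℝ] V →ₗ[ℝ] ℝ) (x y : V) :
    m x y = ∑ i, ∑ j, m (e i) (e j) * (e.repr x i * e.repr y j) := by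
  conv_lhs => rw [← e.sum_repr x, ← e.sum_repr y]
  simp only [map_sum, LinearMap.sum_apply, map_smul, LinearMap.smul_apply, smul_eq_mul,
    Finset.mul_sum]
  rw [Finset.sum_comm]
  exact Finset.sum_congr rfl fun a _ => Finset.sum_congr rfl fun b _ => by ring

theorem formOf_form (e : Module.Basis ι ℝ V) (m : V →ₗ[ℝ] V →ₗ[ℝ] ℝ) :
    formOf e (fun i j => m (e i) (e j)) = m := by
  ext x y
  rw [formOf_apply, ← form_eq_sum]

theorem formOf_basis [DecidableEq ι] (e : Module.Basis ι ℝ V) (m : ι → ι → ℝ) (i j : ι) :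
    formOf e m (e i) (e j) = m i j := by
  simp [formOf_apply, Finsupp.single_apply]

/-- The symmetric part of a bilinear form. -/
def symPart (m : V →ₗ[ℝ] V →ₗ[ℝ] ℝ) : V →ₗ[ℝ] V →ₗ[ℝ] ℝ := (1 / 2 : ℝ) • (m + m.flip)

/-- The skew-symmetric part of a bilinear form. -/
def skewPart (m : V →ₗ[ℝ] V →ₗ[ℝ] ℝ) : V →ₗ[ℝ] V →ₗ[ℝ] ℝ := (1 / 2 : ℝ) • (m - m.flip)

theorem symPart_apply (m : V →ₗ[ℝ] V →ₗ[ℝ] ℝ) (x y : V) :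
    symPart m x y = (m x y + m y x) / 2 := by
  simp [symPart]; ring

theorem skewPart_apply (m : V →ₗ[ℝ] V →ₗ[ℝ] ℝ) (x y : V) :
    skewPart m x y = (m x y - m y x) / 2 := by
  simp [skewPart]; ring

theorem isInner_symPart {m : V →ₗ[ℝ] V →ₗ[ℝ] ℝ} :
    IsInner (symPart m) ↔ ∀ x, x ≠ 0 → 0 < m x x := by
  constructor
  · intro h x hx
    have := h.pos x hx
    rw [symPart_apply] at this; linarith
  · intro h
    refine ⟨fun x y => by rw [symPart_apply, symPart_apply, add_comm], fun x hx => ?_⟩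
    rw [symPart_apply]; linarith [h x hx]

/-- Positivity on the compact unit sphere of coordinates is an open condition, and homogeneity
extends it to all nonzero vectors. -/
theorem eventually_isInner_formOf (e : Module.Basis ι ℝ V) {m : ι → ι → ℝ}
    (hm : IsInner (symPart (formOf e m))) : ∀ᶠ w in 𝓝 m, IsInner (symPart (formOf e w)) := by
  have hc : Continuous fun p : (ι → ι → ℝ) × (ι → ℝ) => ∑ i, ∑ j, p.1 i j * (p.2 i * p.2 j) := by
    fun_prop
  have h1 : ∀ᶠ w in 𝓝 m, ∀ x ∈ Metric.sphere (0 : ι → ℝ) 1,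
      0 < ∑ i, ∑ j, w i j * (x i * x j) := by
    refine (isCompact_sphere 0 1).eventually_forall_of_forall_eventually fun x hx => ?_
    refine hc.continuousAt.eventually (lt_mem_nhds (a := 0) ?_)
    have hne : e.equivFun.symm x ≠ 0 := by
      intro h
      have : x = 0 := (LinearEquiv.map_eq_zero_iff _).1 h
      simp [this] at hx
    have := isInner_symPart.1 hm _ hne
    have hr : ∀ i, e.repr (e.equivFun.symm x) i = x i := fun i => by
      rw [← Module.Basis.equivFun_apply, LinearEquiv.apply_symm_apply]
    simp only [formOf_apply, hr] at this
    exact this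
  filter_upwards [h1] with w hw
  rw [isInner_symPart]
  intro x hx
  set y := e.equivFun x with hy
  have hy0 : y ≠ 0 := by simpa [hy] using hx
  have hn : 0 < ‖y‖ := norm_pos_iff.2 hy0
  have := hw (‖y‖⁻¹ • y) (by simp [norm_smul, hn.ne'])
  have e1 : formOf e w x x = ‖y‖ ^ 2 * ∑ i, ∑ j, w i j * ((‖y‖⁻¹ • y) i * (‖y‖⁻¹ • y) j) := by
    rw [formOf_apply, Finset.mul_sum]
    refine Finset.sum_congr rfl fun i _ => ?_
    rw [Finset.mul_sum]
    refine Finset.sum_congr rfl fun j _ => ?_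
    have h2 : e.repr x = y := by rw [hy]; rfl
    simp only [Pi.smul_apply, smul_eq_mul, h2]
    field_simp
  rw [e1]
  positivity

/-- A family of bilinear forms with positive definite symmetric parts whose relative rate of change
is dominated by the derivative of a function bounded above converges. -/
theorem exists_tendsto_form (e : Module.Basis ι ℝ V) {m D : ℝ → V →ₗ[ℝ] V →ₗ[ℝ] ℝ}
    {φ φ' : ℝ → ℝ} {a T M : ℝ} (haT : a < T) (hpos : ∀ t ∈ Ioo a T, IsInner (symPart (m t)))
    (hm : ∀ t ∈ Ioo a T, ∀ x y, HasDerivAt (fun s => m s x y) (D t x y) t)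
    (hφ : ∀ t ∈ Ioo a T, HasDerivAt φ (φ' t) t) (hM : ∀ t ∈ Ioo a T, φ t ≤ M)
    (hsym : ∀ t ∈ Ioo a T, ∀ x, |D t x x| ≤ φ' t * m t x x)
    (hskew : ∀ t ∈ Ioo a T, ∀ x y, |skewPart (D t) x y| ≤ φ' t * (m t x x + m t y y)) :
    ∃ m₀ : V →ₗ[ℝ] V →ₗ[ℝ] ℝ, IsInner (symPart m₀) ∧
      ∀ x y, Tendsto (fun s => m s x y) (𝓝[<] T) (𝓝 (m₀ x y)) := by
  have hpos' : ∀ t ∈ Ioo a T, ∀ x, 0 ≤ m t x x := fun t ht x => by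
    by_cases hx : x = 0
    · simp [hx]
    · exact (isInner_symPart.1 (hpos t ht) x hx).le
  -- The sign of `φ'` is read off from the bound on a nonzero vector, so the zero space is treated
  -- apart.
  rcases isEmpty_or_nonempty ι with hι | hι
  · have hs : Subsingleton V := e.repr.toEquiv.subsingleton
    refine ⟨0, isInner_symPart.2 fun x hx => (hx (Subsingleton.elim _ _)).elim, fun x y => ?_⟩
    simp [Subsingleton.elim x 0]
  have hφ0 : ∀ t ∈ Ioo a T, 0 ≤ φ' t := by
    intro t ht
    have hx := e.ne_zero (Classical.arbitrary ι)
    have h1 := isInner_symPart.1 (hpos t ht) _ hx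
    have h2 := (abs_nonneg _).trans (hsym t ht (e (Classical.arbitrary ι)))
    by_contra h
    nlinarith
  obtain ⟨t₀, ht₀⟩ := exists_between haT
  have hsub : Ioo t₀ T ⊆ Ioo a T := Ioo_subset_Ioo_left ht₀.1.le
  have hmon : MonotoneOn φ (Ioo a T) := monotoneOn_Ioo_of_hasDerivAt_nonneg hφ hφ0
  -- Grönwall in both directions: `m(x, x) e^{-φ}` cannot increase and `m(x, x) e^{φ}` cannot
  -- decrease. The first bounds the form from above; the second keeps it away from zero.
  have hup : ∀ x, MonotoneOn (fun t => - (m t x x * Real.exp (-φ t))) (Ioo a T) := by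
    intro x
    refine monotoneOn_Ioo_of_hasDerivAt_nonneg
      (fun t ht => ((hm t ht x x).mul (hφ t ht).neg.exp).neg) fun t ht => ?_
    have := (abs_le.1 (hsym t ht x)).2
    have h2 := Real.exp_pos (-φ t)
    have e1 : -(D t x x * Real.exp (-φ t) + m t x x * (Real.exp (-φ t) * -φ' t))
      = Real.exp (-φ t) * (φ' t * m t x x - D t x x) := by ring
    show 0 ≤ -(D t x x * Real.exp (-φ t) + m t x x * (Real.exp (-φ t) * -φ' t))
    rw [e1]
    exact mul_nonneg h2.le (by linarith)
  have hlo : ∀ x, MonotoneOn (fun t => m t x x * Real.exp (φ t)) (Ioo a T) := by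
    intro x
    refine monotoneOn_Ioo_of_hasDerivAt_nonneg
      (fun t ht => (hm t ht x x).mul (hφ t ht).exp) fun t ht => ?_
    have := (abs_le.1 (hsym t ht x)).1
    have h2 := Real.exp_pos (φ t)
    have e1 : D t x x * Real.exp (φ t) + m t x x * (Real.exp (φ t) * φ' t)
      = Real.exp (φ t) * (φ' t * m t x x + D t x x) := by ring
    rw [e1]
    exact mul_nonneg h2.le (by linarith)
  set C : V → ℝ := fun x => m t₀ x x * Real.exp (-φ t₀) * Real.exp M with hC
  have hCle : ∀ x, ∀ t ∈ Ioo t₀ T, m t x x ≤ C x := by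
    intro x t ht
    have h1 := hup x ht₀ (hsub ht) ht.1.le
    simp only [neg_le_neg_iff] at h1
    have h2 : m t x x = m t x x * Real.exp (-φ t) * Real.exp (φ t) := by
      rw [mul_assoc, ← Real.exp_add]; simp
    rw [h2]
    refine mul_le_mul h1 (Real.exp_le_exp.2 (hM t (hsub ht))) (Real.exp_pos _).le ?_
    exact mul_nonneg (hpos' t₀ ht₀ x) (Real.exp_pos _).le
  have hdiag : ∀ x, ∃ l, Tendsto (fun s => m s x x) (𝓝[<] T) (𝓝 l) := by
    intro x
    have hCx : 0 ≤ C x := mul_nonneg (mul_nonneg (hpos' t₀ ht₀ x) (Real.exp_pos _).le)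
      (Real.exp_pos _).le
    refine exists_tendsto_of_abs_deriv_le (φ := fun t => C x * φ t) (φ' := fun t => C x * φ' t)
      (M := C x * M) ht₀.2 (fun t ht => hm t (hsub ht) x x)
      (fun t ht => (hφ t (hsub ht)).const_mul _) (fun t ht => ?_)
      (fun t ht => mul_le_mul_of_nonneg_left (hM t (hsub ht)) hCx)
    refine (hsym t (hsub ht) x).trans ?_
    rw [mul_comm]
    exact mul_le_mul_of_nonneg_right (hCle x t ht) (hφ0 t (hsub ht))
  have hsk : ∀ x y, ∃ l, Tendsto (fun s => skewPart (m s) x y) (𝓝[<] T) (𝓝 l) := by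
    intro x y
    have hCx : ∀ x, 0 ≤ C x := fun x => mul_nonneg (mul_nonneg (hpos' t₀ ht₀ x)
      (Real.exp_pos _).le) (Real.exp_pos _).le
    refine exists_tendsto_of_abs_deriv_le (φ := fun t => (C x + C y) * φ t)
      (f' := fun t => skewPart (D t) x y) (φ' := fun t => (C x + C y) * φ' t)
      (M := (C x + C y) * M) ht₀.2 (fun t ht => ?_)
      (fun t ht => (hφ t (hsub ht)).const_mul _) (fun t ht => ?_)
      (fun t ht => mul_le_mul_of_nonneg_left (hM t (hsub ht)) (add_nonneg (hCx x) (hCx y)))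
    · simp only [skewPart_apply]
      exact ((hm t (hsub ht) x y).sub (hm t (hsub ht) y x)).div_const 2
    · refine (hskew t (hsub ht) x y).trans ?_
      rw [mul_comm]
      exact mul_le_mul_of_nonneg_right (add_le_add (hCle x t ht) (hCle y t ht))
        (hφ0 t (hsub ht))
  -- Polarization recovers the symmetric part from the diagonal; the skew part has been handled
  -- separately.
  have hall : ∀ x y, ∃ l, Tendsto (fun s => m s x y) (𝓝[<] T) (𝓝 l) := by
    intro x y
    obtain ⟨l1, h1⟩ := hdiag (x + y)
    obtain ⟨l2, h2⟩ := hdiag x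
    obtain ⟨l3, h3⟩ := hdiag y
    obtain ⟨l4, h4⟩ := hsk x y
    refine ⟨_, ((((h1.sub h2).sub h3).div_const 2).add h4).congr fun s => ?_⟩
    simp only [skewPart_apply, map_add, LinearMap.add_apply]
    ring
  choose l hl using fun i j => hall (e i) (e j)
  have hlim : ∀ x y, Tendsto (fun s => m s x y) (𝓝[<] T) (𝓝 (formOf e l x y)) := by
    intro x y
    rw [formOf_apply]
    have : (fun s => m s x y) = fun s => ∑ i, ∑ j, m s (e i) (e j) * (e.repr x i * e.repr y j) := by
      ext s; exact form_eq_sum e (m s) x y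
    rw [this]
    exact tendsto_finsetSum _ fun i _ => tendsto_finsetSum _ fun j _ => (hl i j).mul_const _
  refine ⟨formOf e l, isInner_symPart.2 fun x hx => ?_, hlim⟩
  -- A lower bound for `m t x x` that is uniform in `t` after `t₀`; it keeps the limit positive.
  have hpx : 0 < m t₀ x x * Real.exp (φ t₀) * Real.exp (-M) :=
    mul_pos (mul_pos (isInner_symPart.1 (hpos t₀ ht₀) x hx) (Real.exp_pos _)) (Real.exp_pos _)
  refine hpx.trans_le (ge_of_tendsto (hlim x x) ?_)
  filter_upwards [Ioo_mem_nhdsLT ht₀.2] with t ht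
  have h1 := hlo x ht₀ (hsub ht) ht.1.le
  simp only at h1
  have h2 : m t x x = m t x x * Real.exp (φ t) * Real.exp (-φ t) := by
    rw [mul_assoc, ← Real.exp_add]; simp
  rw [h2]
  exact mul_le_mul h1 (Real.exp_le_exp.2 (neg_le_neg (hM t (hsub ht)))) (Real.exp_pos _).le
    (mul_nonneg (hpos' t (hsub ht) x) (Real.exp_pos _).le)

end Forms

/-! ### The flow as an ODE on bilinear forms. -/

section Flow

variable {ι : Type*} [Fintype ι] [DecidableEq ι] {V : Type*} [AddCommGroup V] [Module ℝ V]
  {e : Module.Basis ι ℝ V} {br : V →ₗ[ℝ] V →ₗ[ℝ] V}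

/-- The exterior derivative of a bilinear form, as a trilinear form. -/
def extL (br : V →ₗ[ℝ] V →ₗ[ℝ] V) (β : V →ₗ[ℝ] V →ₗ[ℝ] ℝ) : V →ₗ[ℝ] V →ₗ[ℝ] V →ₗ[ℝ] ℝ where
  toFun x := LinearMap.mk₂ ℝ (fun y z => lieExt br (fun u v => β u v) x y z)
    (fun _ _ _ => by simp [lieExt]; ring) (fun _ _ _ => by simp [lieExt]; ring)
    (fun _ _ _ => by simp [lieExt]; ring) (fun _ _ _ => by simp [lieExt]; ring)
  map_add' x x' := by ext y z; simp [lieExt]; ring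
  map_smul' a x := by ext y z; simp [lieExt]; ring

theorem extL_apply (br : V →ₗ[ℝ] V →ₗ[ℝ] V) (β : V →ₗ[ℝ] V →ₗ[ℝ] ℝ) (x y z : V) :
    extL br β x y z = lieExt br (fun u v => β u v) x y z := rfl

/-- Exact forms are closed: once Jacobi expands the nested brackets, the terms of `ddβ` cancel by
skew-symmetry of `β`. -/
theorem IsClosed3.add_extL (hbr : IsLieBracket br) {H : V →ₗ[ℝ] V →ₗ[ℝ] V →ₗ[ℝ] ℝ}
    (hH : IsClosed3 br H) {β : V →ₗ[ℝ] V →ₗ[ℝ] ℝ} (hβ : ∀ x y, β x y = - β y x) :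
    IsClosed3 br (H + extL br β) where
  skew_left x y z := by
    simp only [LinearMap.add_apply, extL_apply, lieExt]
    rw [hH.skew_left x y, hbr.skew x y]; simp; ring
  skew_right x y z := by
    simp only [LinearMap.add_apply, extL_apply, lieExt]
    rw [hH.skew_right x y, hbr.skew y z]; simp; ring
  closed x i j k := by
    have h := hH.closed x i j k
    simp only [LinearMap.add_apply, extL_apply, lieExt, hbr.jacobi, map_sub]
    linarith [hβ (br i j) (br x k), hβ (br x i) (br j k), hβ (br x j) (br i k)]

/-- The `3`-form `H₀ + db` of `m = g + b`. -/
def flowH (br : V →ₗ[ℝ] V →ₗ[ℝ] V) (H₀ : V →ₗ[ℝ] V →ₗ[ℝ] V →ₗ[ℝ] ℝ) (m : V →ₗ[ℝ] V →ₗ[ℝ] ℝ) :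
    V →ₗ[ℝ] V →ₗ[ℝ] V →ₗ[ℝ] ℝ := H₀ + extL br (skewPart m)

/-- The vector field on bilinear forms `m = g + b` that generates the generalized Ricci flow. -/
def flowX (e : Module.Basis ι ℝ V) (br : V →ₗ[ℝ] V →ₗ[ℝ] V)
    (H₀ : V →ₗ[ℝ] V →ₗ[ℝ] V →ₗ[ℝ] ℝ) (m : V →ₗ[ℝ] V →ₗ[ℝ] ℝ) (x y : V) : ℝ :=
  -2 * lieRicB e br (symPart m) (flowH br H₀ m) x y - lieCodiff e br (symPart m) (flowH br H₀ m) x y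

/-- The generalized scalar curvature as a function of `m = g + b`. -/
def flowS (e : Module.Basis ι ℝ V) (br : V →ₗ[ℝ] V →ₗ[ℝ] V)
    (H₀ : V →ₗ[ℝ] V →ₗ[ℝ] V →ₗ[ℝ] ℝ) (m : V →ₗ[ℝ] V →ₗ[ℝ] ℝ) : ℝ :=
  lieGenScalar e br (symPart m) (flowH br H₀ m)

theorem isBilin_flowX (e : Module.Basis ι ℝ V) (br : V →ₗ[ℝ] V →ₗ[ℝ] V)
    (H₀ : V →ₗ[ℝ] V →ₗ[ℝ] V →ₗ[ℝ] ℝ) (m : V →ₗ[ℝ] V →ₗ[ℝ] ℝ) : IsBilin (flowX e br H₀ m) := by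
  obtain ⟨B, hB⟩ := isBilin_ricB e br (symPart m) (flowH br H₀ m)
  obtain ⟨C, hC⟩ := isBilin_codiff e br (symPart m) (flowH br H₀ m)
  exact ⟨(-2 : ℝ) • B - C, fun x y => by simp [flowX, hB, hC]⟩

theorem IsInner.ricB_symm {g : V →ₗ[ℝ] V →ₗ[ℝ] ℝ} (hg : IsInner g) (e : Module.Basis ι ℝ V)
    (hbr : IsLieBracket br) (H : V →ₗ[ℝ] V →ₗ[ℝ] V →ₗ[ℝ] ℝ) (x y : V) :
    lieRicB e br g H x y = lieRicB e br g H y x := by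
  obtain ⟨f, hf⟩ := hg.exists_orthoBasis e
  obtain ⟨B, hB⟩ := isBilin_ricB e br g H
  have h : ∀ i j, B (f i) (f j) = B (f j) (f i) := by
    intro i j
    rw [← hB, ← hB, lieRicB, lieRicB, hg.ric_basis e hf hbr, hg.ric_basis e hf hbr, arrRic_symm,
      hg.square_basis e hf, hg.square_basis e hf]
    simp only [mul_comm]
  rw [hB, hB, form_eq_sum f B x y, form_eq_sum f B y x, Finset.sum_comm]
  exact Finset.sum_congr rfl fun i _ => Finset.sum_congr rfl fun j _ => by rw [h]; ring

theorem IsInner.codiff_skew {g : V →ₗ[ℝ] V →ₗ[ℝ] ℝ} (hg : IsInner g) (e : Module.Basis ι ℝ V)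
    (hbr : IsLieBracket br) {H : V →ₗ[ℝ] V →ₗ[ℝ] V →ₗ[ℝ] ℝ} (hH : IsClosed3 br H) (x y : V) :
    lieCodiff e br g H x y = - lieCodiff e br g H y x := by
  obtain ⟨f, hf⟩ := hg.exists_orthoBasis e
  obtain ⟨B, hB⟩ := isBilin_codiff e br g H
  have h : ∀ i j, B (f i) (f j) = - B (f j) (f i) := by
    intro i j
    rw [← hB, ← hB, hg.codiff_basis e hf hbr hH, hg.codiff_basis e hf hbr hH,
      (hH.isClosedArray hf).skew_codiff]
  rw [hB, hB, form_eq_sum f B x y, form_eq_sum f B y x, Finset.sum_comm]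
  simp only [← Finset.sum_neg_distrib]
  exact Finset.sum_congr rfl fun i _ => Finset.sum_congr rfl fun j _ => by rw [h]; ring

/-- Cauchy–Schwarz, followed by `√Q ≤ (1 + Q) / 2`. The linear bound in `Q` matters, because the
derivative of the scalar curvature controls `Q` itself; the summand `1` is why time is added to the
scalar curvature later. -/
theorem abs_sum_mul_le (x y : ι → ℝ) (R : ι → ι → ℝ) :
    |∑ a, ∑ b, R a b * (x a * y b)|
      ≤ (∑ a, x a ^ 2 + ∑ a, y a ^ 2) / 2 * ((1 + ∑ a, ∑ b, R a b ^ 2) / 2) := by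
  set Q := ∑ a, ∑ b, R a b ^ 2 with hQ
  set X := ∑ a, x a ^ 2 with hX
  set Y := ∑ a, y a ^ 2 with hY
  have hQ0 : 0 ≤ Q := Finset.sum_nonneg fun a _ => Finset.sum_nonneg fun b _ => sq_nonneg _
  have hX0 : 0 ≤ X := Finset.sum_nonneg fun a _ => sq_nonneg _
  have hY0 : 0 ≤ Y := Finset.sum_nonneg fun a _ => sq_nonneg _
  refine abs_le_of_sq_le_sq ?_ (by positivity)
  have h1 : (∑ a, ∑ b, R a b * (x a * y b)) ^ 2 ≤ Q * (X * Y) := by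
    have := Finset.sum_mul_sq_le_sq_mul_sq (Finset.univ : Finset (ι × ι))
      (fun p => R p.1 p.2) (fun p => x p.1 * y p.2)
    simp only [Fintype.sum_prod_type] at this
    refine this.trans (le_of_eq ?_)
    rw [hQ, hX, hY, Finset.sum_mul_sum (f := fun a => x a ^ 2)]
    simp only [mul_pow]
  have h2 : X * Y ≤ ((X + Y) / 2) ^ 2 := by nlinarith [sq_nonneg (X - Y)]
  have h3 : Q ≤ ((1 + Q) / 2) ^ 2 := by nlinarith [sq_nonneg (1 - Q)]
  calc _ ≤ Q * (X * Y) := h1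
    _ ≤ ((1 + Q) / 2) ^ 2 * ((X + Y) / 2) ^ 2 := by gcongr
    _ = _ := by ring

theorem IsInner.abs_le {g : V →ₗ[ℝ] V →ₗ[ℝ] ℝ} {f : Module.Basis ι ℝ V} (hf : OrthoBasis g f)
    {T : V → V → ℝ} (hT : IsBilin T) (x y : V) :
    |T x y| ≤ (g x x + g y y) / 2 * ((1 + ∑ a, ∑ b, T (f a) (f b) ^ 2) / 2) := by
  obtain ⟨B, hB⟩ := hT
  have hg : ∀ x, g x x = ∑ a, f.repr x a ^ 2 := by
    intro x
    rw [hf.apply_eq]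
    exact Finset.sum_congr rfl fun a _ => by rw [hf.repr_apply, sq]
  rw [hB, form_eq_sum f B x y, hg, hg]
  simp only [hB]
  exact abs_sum_mul_le _ _ _

variable {H₀ : V →ₗ[ℝ] V →ₗ[ℝ] V →ₗ[ℝ] ℝ}

theorem IsClosed3.flowH (hbr : IsLieBracket br) (hH : IsClosed3 br H₀)
    (m : V →ₗ[ℝ] V →ₗ[ℝ] ℝ) : IsClosed3 br (flowH br H₀ m) :=
  hH.add_extL hbr fun x y => by rw [skewPart_apply, skewPart_apply]; ring

theorem flowX_symPart (hbr : IsLieBracket br) (hH : IsClosed3 br H₀) {m : V →ₗ[ℝ] V →ₗ[ℝ] ℝ}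
    (hm : IsInner (symPart m)) (x y : V) :
    (flowX e br H₀ m x y + flowX e br H₀ m y x) / 2
      = -2 * lieRicB e br (symPart m) (GenRicci.flowH br H₀ m) x y := by
  rw [flowX, flowX, hm.ricB_symm e hbr _ y x, hm.codiff_skew e hbr (hH.flowH hbr m) y x]; ring

theorem flowX_skewPart (hbr : IsLieBracket br) (hH : IsClosed3 br H₀) {m : V →ₗ[ℝ] V →ₗ[ℝ] ℝ}
    (hm : IsInner (symPart m)) (x y : V) :
    (flowX e br H₀ m x y - flowX e br H₀ m y x) / 2
      = - lieCodiff e br (symPart m) (GenRicci.flowH br H₀ m) x y := by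
  rw [flowX, flowX, hm.ricB_symm e hbr _ y x, hm.codiff_skew e hbr (hH.flowH hbr m) y x]; ring

/-- `Ric^B` is symmetric and `d^*H` skew, so the symmetric and skew parts of the ODE are the
equations for `g` and `b`, and `H' = db'`. -/
theorem hasDerivAt_flowS (hbr : IsLieBracket br) (hH : IsClosed3 br H₀)
    {m : ℝ → V →ₗ[ℝ] V →ₗ[ℝ] ℝ} {t : ℝ} (hpos : ∀ᶠ s in 𝓝 t, IsInner (symPart (m s)))
    (hm : ∀ x y, HasDerivAt (fun s => m s x y) (flowX e br H₀ (m t) x y) t)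
    {u : Module.Basis ι ℝ V} (hu : OrthoBasis (symPart (m t)) u) :
    HasDerivAt (fun s => flowS e br H₀ (m s))
      (2 * ∑ a, ∑ b, lieRicB e br (symPart (m t)) (flowH br H₀ (m t)) (u a) (u b) ^ 2
        + (∑ a, ∑ b, lieCodiff e br (symPart (m t)) (flowH br H₀ (m t)) (u a) (u b) ^ 2) / 2) t := by
  have hp := hpos.self_of_nhds
  refine hasDerivAt_lieGenScalar (g := fun s => symPart (m s)) (H := fun s => flowH br H₀ (m s))
    hbr hpos (hH.flowH hbr _) (fun x y => ?_) (fun x y z => ?_) hu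
  · simp only [symPart_apply]
    exact (((hm x y).add (hm y x)).div_const 2).congr_deriv (flowX_symPart hbr hH hp x y)
  · have hs : ∀ x y, HasDerivAt (fun s => skewPart (m s) x y)
        (-lieCodiff e br (symPart (m t)) (flowH br H₀ (m t)) x y) t := by
      intro x y
      simp only [skewPart_apply]
      exact (((hm x y).sub (hm y x)).div_const 2).congr_deriv (flowX_skewPart hbr hH hp x y)
    simp only [flowH, LinearMap.add_apply, extL_apply, lieExt]
    exact (((hs _ _).sub (hs _ _)).add (hs _ _)).const_add _

/-- Reversing time changes both the sign of the vector field and that of `S`, so `σ S` is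
non-decreasing in either direction. -/
theorem hasDerivAt_flowS_sign (hbr : IsLieBracket br) (hH : IsClosed3 br H₀) {σ : ℝ}
    (hσ : σ = 1 ∨ σ = -1)
    {m : ℝ → V →ₗ[ℝ] V →ₗ[ℝ] ℝ} {t : ℝ} (hpos : ∀ᶠ s in 𝓝 t, IsInner (symPart (m s)))
    (hm : ∀ x y, HasDerivAt (fun s => m s x y) (σ * flowX e br H₀ (m t) x y) t)
    {u : Module.Basis ι ℝ V} (hu : OrthoBasis (symPart (m t)) u) :
    HasDerivAt (fun s => σ * flowS e br H₀ (m s))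
      (2 * ∑ a, ∑ b, lieRicB e br (symPart (m t)) (flowH br H₀ (m t)) (u a) (u b) ^ 2
        + (∑ a, ∑ b, lieCodiff e br (symPart (m t)) (flowH br H₀ (m t)) (u a) (u b) ^ 2) / 2) t := by
  rcases hσ with rfl | rfl
  · simp only [one_mul] at hm ⊢
    exact hasDerivAt_flowS hbr hH hpos hm hu
  · have ht : 2 * t - t = t := by ring
    -- Time is reflected about `t` itself, so the form at the base point is unchanged.
    have h0 : Tendsto (fun s => 2 * t - s) (𝓝 t) (𝓝 t) := by
      have : Continuous fun s : ℝ => 2 * t - s := by fun_prop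
      simpa [ht] using this.tendsto t
    have h1 := hasDerivAt_flowS (m := fun s => m (2 * t - s)) (t := t) (e := e) hbr hH
      (h0.eventually hpos) (fun x y => by
        have h2 := hm x y
        rw [← ht] at h2
        have h3 := HasDerivAt.comp_const_sub (2 * t) t h2
        simp only [ht, neg_mul, one_mul, neg_neg] at h3 ⊢
        exact h3) (u := u) (by rwa [ht])
    rw [ht] at h1
    obtain ⟨d, hd⟩ : ∃ d, d = 2 * ∑ a, ∑ b, lieRicB e br (symPart (m t)) (flowH br H₀ (m t))
        (u a) (u b) ^ 2 + (∑ a, ∑ b, lieCodiff e br (symPart (m t)) (flowH br H₀ (m t))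
        (u a) (u b) ^ 2) / 2 := ⟨_, rfl⟩
    rw [← hd] at h1 ⊢
    have h4 : HasDerivAt (fun s => flowS e br H₀ (m (2 * t - s))) d (2 * t - t) := by
      rw [ht]; exact h1
    have h5 := (HasDerivAt.comp_const_sub (2 * t) t h4).neg
    simp only [sub_sub_cancel, neg_neg] at h5
    refine (h5.congr_of_eventuallyEq (Eventually.of_forall fun s => ?_))
    simp

/-- The flow converges at the end of a bounded interval on which the generalized scalar curvature
is bounded. -/
theorem exists_tendsto_flow (hbr : IsLieBracket br) (hH : IsClosed3 br H₀) {σ : ℝ}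
    (hσ : σ = 1 ∨ σ = -1) {m : ℝ → V →ₗ[ℝ] V →ₗ[ℝ] ℝ} {a T M : ℝ} (haT : a < T)
    (hpos : ∀ t ∈ Ioo a T, IsInner (symPart (m t)))
    (hm : ∀ t ∈ Ioo a T, ∀ x y, HasDerivAt (fun s => m s x y) (σ * flowX e br H₀ (m t) x y) t)
    (hM : ∀ t ∈ Ioo a T, σ * flowS e br H₀ (m t) ≤ M) :
    ∃ m₀ : V →ₗ[ℝ] V →ₗ[ℝ] ℝ, IsInner (symPart m₀) ∧
      ∀ x y, Tendsto (fun s => m s x y) (𝓝[<] T) (𝓝 (m₀ x y)) := by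
  have hσ' : |σ| = 1 := by rcases hσ with rfl | rfl <;> simp
  choose B hB using fun t => isBilin_flowX e br H₀ (m t)
  choose f hf using fun t (ht : t ∈ Ioo a T) => (hpos t ht).exists_orthoBasis e
  classical
  -- `N` is the derivative of `σ S`. The orthonormal bases are chosen at each time separately with
  -- no regularity in time, and the value `0` outside the interval plays no role.
  let N : ℝ → ℝ := fun t => if ht : t ∈ Ioo a T then
    2 * ∑ a, ∑ b, lieRicB e br (symPart (m t)) (flowH br H₀ (m t)) (f t ht a) (f t ht b) ^ 2
      + (∑ a, ∑ b, lieCodiff e br (symPart (m t)) (flowH br H₀ (m t)) (f t ht a) (f t ht b) ^ 2) / 2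
    else 0
  have hN : ∀ t (ht : t ∈ Ioo a T), N t =
    2 * ∑ a, ∑ b, lieRicB e br (symPart (m t)) (flowH br H₀ (m t)) (f t ht a) (f t ht b) ^ 2
      + (∑ a, ∑ b, lieCodiff e br (symPart (m t)) (flowH br H₀ (m t)) (f t ht a) (f t ht b) ^ 2)
        / 2 := fun t ht => dif_pos ht
  have hdiag : ∀ m : V →ₗ[ℝ] V →ₗ[ℝ] ℝ, ∀ x, symPart m x x = m x x := fun m x => by
    rw [symPart_apply]; ring
  have hev : ∀ t ∈ Ioo a T, ∀ᶠ s in 𝓝 t, IsInner (symPart (m s)) := fun t ht => by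
    filter_upwards [Ioo_mem_nhds ht.1 ht.2] with s hs using hpos s hs
  -- The comparison function `φ = t + σ S` has derivative `1 + N` and is bounded above by `T + M`,
  -- as the interval is bounded on the right.
  refine exists_tendsto_form e (D := fun t => σ • B t)
    (φ := fun t => t + σ * flowS e br H₀ (m t)) (φ' := fun t => 1 + N t) (M := T + M) haT hpos ?_ ?_
    ?_ ?_ ?_
  · intro t ht x y
    simpa [hB] using hm t ht x y
  · intro t ht
    have := hasDerivAt_flowS_sign hbr hH hσ (hev t ht) (hm t ht) (hf t ht)
    rw [← hN] at this
    exact (hasDerivAt_id t).add this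
  · intro t ht
    have := hM t ht
    have := ht.2
    linarith
  · intro t ht x
    have h1 := IsInner.abs_le (hf t ht) (isBilin_ricB e br (symPart (m t)) (flowH br H₀ (m t))) x x
    have h2 := flowX_symPart (e := e) hbr hH (hpos t ht) x x
    rw [hdiag] at h1
    simp only [LinearMap.smul_apply, smul_eq_mul, ← hB, abs_mul, hσ', one_mul, hN t ht]
    have h3 : flowX e br H₀ (m t) x x = -2 * lieRicB e br (symPart (m t)) (flowH br H₀ (m t)) x x := by
      rw [← h2]; ring
    rw [h3, abs_mul, abs_neg, abs_two]
    have h4 : 0 ≤ m t x x := by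
      rcases eq_or_ne x 0 with rfl | hx
      · simp
      · exact (isInner_symPart.1 (hpos t ht) x hx).le
    set Q1 := ∑ a, ∑ b, lieRicB e br (symPart (m t)) (flowH br H₀ (m t)) (f t ht a) (f t ht b) ^ 2
    have h5 : 0 ≤ (∑ a, ∑ b, lieCodiff e br (symPart (m t)) (flowH br H₀ (m t))
      (f t ht a) (f t ht b) ^ 2) :=
      Finset.sum_nonneg fun a _ => Finset.sum_nonneg fun b _ => sq_nonneg _
    have h6 : 0 ≤ Q1 := Finset.sum_nonneg fun a _ => Finset.sum_nonneg fun b _ => sq_nonneg _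
    nlinarith [mul_nonneg h4 h5, mul_nonneg h4 h6]
  · intro t ht x y
    have h1 := IsInner.abs_le (hf t ht) (isBilin_codiff e br (symPart (m t)) (flowH br H₀ (m t))) x y
    have h2 := flowX_skewPart (e := e) hbr hH (hpos t ht) x y
    rw [hdiag, hdiag] at h1
    have h3 : skewPart (σ • B t) x y
        = σ * - lieCodiff e br (symPart (m t)) (flowH br H₀ (m t)) x y := by
      rw [← h2, skewPart_apply]
      simp only [LinearMap.smul_apply, smul_eq_mul, ← hB]; ring
    rw [h3, abs_mul, hσ', one_mul, abs_neg, hN t ht]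
    have h4 : ∀ x, 0 ≤ m t x x := by
      intro x
      rcases eq_or_ne x 0 with rfl | hx
      · simp
      · exact (isInner_symPart.1 (hpos t ht) x hx).le
    have h7 := add_nonneg (h4 x) (h4 y)
    set Q2 := (∑ a, ∑ b, lieCodiff e br (symPart (m t)) (flowH br H₀ (m t))
      (f t ht a) (f t ht b) ^ 2)
    set Q1 := ∑ a, ∑ b, lieRicB e br (symPart (m t)) (flowH br H₀ (m t)) (f t ht a) (f t ht b) ^ 2
    have h5 : 0 ≤ Q2 := Finset.sum_nonneg fun a _ => Finset.sum_nonneg fun b _ => sq_nonneg _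
    have h6 : 0 ≤ Q1 := Finset.sum_nonneg fun a _ => Finset.sum_nonneg fun b _ => sq_nonneg _
    nlinarith [mul_nonneg h7 h5, mul_nonneg h7 h6]

end Flow

/-! ### Smoothness of the vector field and extension of the flow. -/

section Smooth

variable {ι : Type*} [Fintype ι] [DecidableEq ι] {V : Type*} [NormedAddCommGroup V]
  [NormedSpace ℝ V] [FiniteDimensional ℝ V] {W : Type*} [NormedAddCommGroup W] [NormedSpace ℝ W]
  {w₀ : W} {n : WithTop ℕ∞}

theorem contDiffAt_repr (e : Module.Basis ι ℝ V) {X : W → V} (hX : ContDiffAt ℝ n X w₀) (i : ι) :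
    ContDiffAt ℝ n (fun w => e.repr (X w) i) w₀ :=
  (LinearMap.toContinuousLinearMap (e.coord i)).contDiff.contDiffAt.comp w₀ hX

theorem contDiffAt_bilin (e : Module.Basis ι ℝ V) (br : V →ₗ[ℝ] V →ₗ[ℝ] V) {X Y : W → V}
    (hX : ContDiffAt ℝ n X w₀) (hY : ContDiffAt ℝ n Y w₀) :
    ContDiffAt ℝ n (fun w => br (X w) (Y w)) w₀ := by
  have : (fun w => br (X w) (Y w))
      = fun w => ∑ i, ∑ j, (e.repr (X w) i * e.repr (Y w) j) • br (e i) (e j) := by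
    ext w
    conv_lhs => rw [← e.sum_repr (X w), ← e.sum_repr (Y w)]
    simp only [map_sum, LinearMap.sum_apply, map_smul, LinearMap.smul_apply, Finset.smul_sum,
      smul_smul]
    rw [Finset.sum_comm]
    exact Finset.sum_congr rfl fun i _ => Finset.sum_congr rfl fun j _ => by rw [mul_comm]
  rw [this]
  exact ContDiffAt.sum fun i _ => ContDiffAt.sum fun j _ =>
    ((contDiffAt_repr e hX i).mul (contDiffAt_repr e hY j)).smul contDiffAt_const

/-- A family of bilinear forms depends smoothly on parameters. -/
def FormSmooth (n : WithTop ℕ∞) (g : W → V →ₗ[ℝ] V →ₗ[ℝ] ℝ) (w₀ : W) : Prop :=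
  ∀ x y, ContDiffAt ℝ n (fun w => g w x y) w₀

/-- A family of trilinear forms depends smoothly on parameters. -/
def TriSmooth (n : WithTop ℕ∞) (H : W → V →ₗ[ℝ] V →ₗ[ℝ] V →ₗ[ℝ] ℝ) (w₀ : W) : Prop :=
  ∀ x y z, ContDiffAt ℝ n (fun w => H w x y z) w₀

variable {g : W → V →ₗ[ℝ] V →ₗ[ℝ] ℝ} {H : W → V →ₗ[ℝ] V →ₗ[ℝ] V →ₗ[ℝ] ℝ}

theorem FormSmooth.apply (e : Module.Basis ι ℝ V) (hg : FormSmooth n g w₀) {X Y : W → V}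
    (hX : ContDiffAt ℝ n X w₀) (hY : ContDiffAt ℝ n Y w₀) :
    ContDiffAt ℝ n (fun w => g w (X w) (Y w)) w₀ := by
  simp only [form_eq_sum e (g _) (X _)]
  exact ContDiffAt.sum fun i _ => ContDiffAt.sum fun j _ =>
    (hg _ _).mul ((contDiffAt_repr e hX i).mul (contDiffAt_repr e hY j))

theorem TriSmooth.apply (e : Module.Basis ι ℝ V) (hH : TriSmooth n H w₀) {X Y Z : W → V}
    (hX : ContDiffAt ℝ n X w₀) (hY : ContDiffAt ℝ n Y w₀) (hZ : ContDiffAt ℝ n Z w₀) :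
    ContDiffAt ℝ n (fun w => H w (X w) (Y w) (Z w)) w₀ := by
  have : (fun w => H w (X w) (Y w) (Z w))
      = fun w => ∑ k, e.repr (X w) k * H w (e k) (Y w) (Z w) := by
    ext w
    conv_lhs => rw [← e.sum_repr (X w)]
    simp only [map_sum, LinearMap.sum_apply, map_smul, LinearMap.smul_apply, smul_eq_mul]
  rw [this]
  exact ContDiffAt.sum fun k _ => (contDiffAt_repr e hX k).mul
    (FormSmooth.apply (g := fun w => H w (e k)) e (fun x y => hH _ _ _) hY hZ)

theorem FormSmooth.gramInv (e : Module.Basis ι ℝ V) (hg : FormSmooth n g w₀)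
    (hpos : IsInner (g w₀)) (i j : ι) : ContDiffAt ℝ n (fun w => gramInv e (g w) i j) w₀ :=
  contDiffAt_matrix_inv (N := fun w => Matrix.of fun i j => g w (e i) (e j))
    (fun _ _ => hg _ _) (hpos.det_ne_zero e) i j

theorem FormSmooth.contr (e : Module.Basis ι ℝ V) (hg : FormSmooth n g w₀)
    (hpos : IsInner (g w₀)) {T : W → V → V → ℝ}
    (hT : ∀ i j, ContDiffAt ℝ n (fun w => T w (e i) (e j)) w₀) :
    ContDiffAt ℝ n (fun w => contr e (g w) (T w)) w₀ :=
  ContDiffAt.sum fun i _ => ContDiffAt.sum fun j _ => (hg.gramInv e hpos i j).mul (hT i j)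

theorem FormSmooth.nabla (e : Module.Basis ι ℝ V) (br : V →ₗ[ℝ] V →ₗ[ℝ] V)
    (hg : FormSmooth n g w₀) (hpos : IsInner (g w₀)) {X Y : W → V} (hX : ContDiffAt ℝ n X w₀)
    (hY : ContDiffAt ℝ n Y w₀) : ContDiffAt ℝ n (fun w => lieNabla e br (g w) (X w) (Y w)) w₀ := by
  refine ContDiffAt.sum fun i _ => ContDiffAt.sum fun j _ =>
    ((hg.gramInv e hpos i j).mul (ContDiffAt.div_const ?_ 2)).smul contDiffAt_const
  have hc : ContDiffAt ℝ n (fun _ : W => e i) w₀ := contDiffAt_const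
  exact ((hg.apply e (contDiffAt_bilin e br hX hY) hc).sub (hg.apply e (contDiffAt_bilin e br hX hc) hY)).sub
    (hg.apply e (contDiffAt_bilin e br hY hc) hX)

theorem FormSmooth.ricB (e : Module.Basis ι ℝ V) (br : V →ₗ[ℝ] V →ₗ[ℝ] V)
    (hg : FormSmooth n g w₀) (hpos : IsInner (g w₀)) (hH : TriSmooth n H w₀) (x y : V) :
    ContDiffAt ℝ n (fun w => lieRicB e br (g w) (H w) x y) w₀ := by
  have hc : ∀ v : V, ContDiffAt ℝ n (fun _ : W => v) w₀ := fun v => contDiffAt_const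
  refine ContDiffAt.sub (hg.contr e hpos fun i j => hg.apply e ?_ (hc _)) (ContDiffAt.div_const ?_ 4)
  · exact ((hg.nabla e br hpos (hc _) (hg.nabla e br hpos (hc _) (hc _))).sub
      (hg.nabla e br hpos (hc _) (hg.nabla e br hpos (hc _) (hc _)))).sub
      (hg.nabla e br hpos (hc _) (hc _))
  · exact hg.contr e hpos fun i j => hg.contr e hpos fun k l => (hH _ _ _).mul (hH _ _ _)

theorem FormSmooth.codiff (e : Module.Basis ι ℝ V) (br : V →ₗ[ℝ] V →ₗ[ℝ] V)
    (hg : FormSmooth n g w₀) (hpos : IsInner (g w₀)) (hH : TriSmooth n H w₀) (x y : V) :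
    ContDiffAt ℝ n (fun w => lieCodiff e br (g w) (H w) x y) w₀ := by
  have hc : ∀ v : V, ContDiffAt ℝ n (fun _ : W => v) w₀ := fun v => contDiffAt_const
  refine (hg.contr e hpos fun i j => ?_).neg
  exact ((hH.apply e (hg.nabla e br hpos (hc _) (hc _)) (hc _) (hc _)).neg.sub
    (hH.apply e (hc _) (hg.nabla e br hpos (hc _) (hc _)) (hc _))).sub
    (hH.apply e (hc _) (hc _) (hg.nabla e br hpos (hc _) (hc _)))

/-- Everything is polynomial in `m` apart from the inverse Gram matrix of its symmetric part, which
is smooth where that part is positive definite. -/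
theorem contDiffAt_flowX (e : Module.Basis ι ℝ V) (br : V →ₗ[ℝ] V →ₗ[ℝ] V)
    (H₀ : V →ₗ[ℝ] V →ₗ[ℝ] V →ₗ[ℝ] ℝ) {m : ι → ι → ℝ} (hm : IsInner (symPart (formOf e m)))
    (x y : V) : ContDiffAt ℝ n (fun w => flowX e br H₀ (formOf e w) x y) m := by
  have h0 : ∀ x y, ContDiffAt ℝ n (fun w : ι → ι → ℝ => formOf e w x y) m := by
    intro x y
    simp only [formOf_apply]
    fun_prop
  have hg : FormSmooth n (fun w : ι → ι → ℝ => symPart (formOf e w)) m := by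
    intro x y
    simp only [symPart_apply]
    exact ((h0 _ _).add (h0 _ _)).div_const 2
  have hs : ∀ x y, ContDiffAt ℝ n (fun w : ι → ι → ℝ => skewPart (formOf e w) x y) m := by
    intro x y
    simp only [skewPart_apply]
    exact ((h0 _ _).sub (h0 _ _)).div_const 2
  have hH : TriSmooth n (fun w : ι → ι → ℝ => flowH br H₀ (formOf e w)) m := by
    intro x y z
    simp only [flowH, LinearMap.add_apply, extL_apply, lieExt]
    exact contDiffAt_const.add (((hs _ _).sub (hs _ _)).add (hs _ _))
  exact (contDiffAt_const.mul (hg.ricB e br hm hH x y)).sub (hg.codiff e br hm hH x y)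

/-- A flow with bounded generalized scalar curvature extends. -/
theorem exists_flow_extension {e : Module.Basis ι ℝ V} {br : V →ₗ[ℝ] V →ₗ[ℝ] V}
    {H₀ : V →ₗ[ℝ] V →ₗ[ℝ] V →ₗ[ℝ] ℝ} (hbr : IsLieBracket br) (hH : IsClosed3 br H₀) {σ : ℝ}
    (hσ : σ = 1 ∨ σ = -1) {m : ℝ → V →ₗ[ℝ] V →ₗ[ℝ] ℝ} {a T M : ℝ} (haT : a < T)
    (hpos : ∀ t ∈ Ioo a T, IsInner (symPart (m t)))
    (hm : ∀ t ∈ Ioo a T, ∀ x y, HasDerivAt (fun s => m s x y) (σ * flowX e br H₀ (m t) x y) t)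
    (hM : ∀ t ∈ Ioo a T, σ * flowS e br H₀ (m t) ≤ M) :
    ∃ δ > 0, ∃ k : ℝ → V →ₗ[ℝ] V →ₗ[ℝ] ℝ, (∀ t < T, k t = m t) ∧
      ∀ t ∈ Ioo a (T + δ), IsInner (symPart (k t)) ∧
        ∀ x y, HasDerivAt (fun s => k s x y) (σ * flowX e br H₀ (k t) x y) t := by
  obtain ⟨m₀, hm₀, hlim⟩ := exists_tendsto_flow hbr hH hσ haT hpos hm hM
  set w₀ : ι → ι → ℝ := fun i j => m₀ (e i) (e j) with hw₀
  set X : (ι → ι → ℝ) → ι → ι → ℝ := fun w i j => σ * flowX e br H₀ (formOf e w) (e i) (e j)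
    with hXdef
  have hw₀' : IsInner (symPart (formOf e w₀)) := by rwa [formOf_form]
  have hX : ContDiffAt ℝ 1 X w₀ := by
    rw [contDiffAt_pi]; intro i
    rw [contDiffAt_pi]; intro j
    exact contDiffAt_const.mul (contDiffAt_flowX e br H₀ hw₀' _ _)
  obtain ⟨δ, hδ, v, hv1, hvT, hv⟩ := exists_extension_of_tendsto (X := X)
    (w := fun t i j => m t (e i) (e j)) (w₀ := w₀) haT hX (fun t ht => by
      rw [hasDerivAt_pi]; intro i
      rw [hasDerivAt_pi]; intro j
      simp only [hXdef, formOf_form]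
      exact hm t ht _ _) (by
      rw [tendsto_pi_nhds]; intro i
      rw [tendsto_pi_nhds]; intro j
      exact hlim _ _)
  have hcont : ContinuousAt v T := (hv T ⟨haT, by linarith⟩).continuousAt
  have hev : ∀ᶠ t in 𝓝 T, IsInner (symPart (formOf e (v t))) := by
    have := eventually_isInner_formOf e hw₀'
    rw [← hvT] at this
    exact hcont.eventually this
  obtain ⟨η, hη, hball⟩ := Metric.eventually_nhds_iff.1 hev
  -- The radius `η` keeps the symmetric part positive definite beyond `T`; the ODE solution alone
  -- exists up to `T + δ`.
  refine ⟨min δ η, lt_min hδ hη, fun t => formOf e (v t), fun t ht => ?_, fun t ht => ⟨?_, ?_⟩⟩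
  · simp only [hv1 t ht, formOf_form]
  · rcases lt_or_ge t T with h | h
    · simp only [hv1 t h, formOf_form]
      exact hpos t ⟨ht.1, h⟩
    · refine hball ?_
      rw [Real.dist_eq, abs_of_nonneg (by linarith)]
      have := ht.2
      have := min_le_right δ η
      linarith
  · intro x y
    have h1 := hv t ⟨ht.1, ht.2.trans_le (by linarith [min_le_left δ η])⟩
    rw [hasDerivAt_pi] at h1
    have h2 : ∀ i j, HasDerivAt (fun s => v s i j)
        (σ * flowX e br H₀ (formOf e (v t)) (e i) (e j)) t := fun i j =>
      (hasDerivAt_pi.1 (h1 i)) j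
    obtain ⟨B, hB⟩ := isBilin_flowX e br H₀ (formOf e (v t))
    simp only [formOf_apply e (v _) x y]
    refine (HasDerivAt.fun_sum fun i _ => HasDerivAt.fun_sum fun j _ =>
      (h2 i j).mul_const (e.repr x i * e.repr y j)).congr_deriv ?_
    simp only [hB]
    rw [form_eq_sum e B x y, Finset.mul_sum]
    refine Finset.sum_congr rfl fun i _ => ?_
    rw [Finset.mul_sum]
    exact Finset.sum_congr rfl fun j _ => by ring

end Smooth

/-! ### Linear algebra of generalized metrics on one fibre. -/

section Fiber

variable {ι : Type*} [Fintype ι] [DecidableEq ι] {V : Type*} [AddCommGroup V] [Module ℝ V]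
  {K : Type*} [AddCommGroup K] [Module ℝ K]

/-- The linear algebra of a fibre of an exact Courant algebroid with an isotropic splitting `sec`:
the pairing `pr`, the anchor `an` and the coanchor `C = an^*`. -/
structure FiberModel (pr : K →ₗ[ℝ] K →ₗ[ℝ] ℝ) (an : K →ₗ[ℝ] V) (sec : V →ₗ[ℝ] K)
    (C : (V →ₗ[ℝ] ℝ) →ₗ[ℝ] K) : Prop where
  symm : ∀ a b, pr a b = pr b a
  nondeg : ∀ a, (∀ b, pr a b = 0) → a = 0
  coanchor : ∀ ξ a, pr (C ξ) a = ξ (an a)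
  anchor_sec : ∀ x, an (sec x) = x
  anchor_coanchor : ∀ ξ, an (C ξ) = 0
  isotropic : ∀ x y, pr (sec x) (sec y) = 0
  exact : ∀ a, an a = 0 → ∃ ξ, a = C ξ

variable {pr : K →ₗ[ℝ] K →ₗ[ℝ] ℝ} {an : K →ₗ[ℝ] V} {sec : V →ₗ[ℝ] K}
  {C : (V →ₗ[ℝ] ℝ) →ₗ[ℝ] K}

/-- The splitting twisted by a bilinear form. -/
def twistSec (sec : V →ₗ[ℝ] K) (C : (V →ₗ[ℝ] ℝ) →ₗ[ℝ] K) (m : V →ₗ[ℝ] V →ₗ[ℝ] ℝ) : V →ₗ[ℝ] K :=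
  sec + (1 / 2 : ℝ) • C.comp m

theorem twistSec_apply (m : V →ₗ[ℝ] V →ₗ[ℝ] ℝ) (x : V) :
    twistSec sec C m x = sec x + (1 / 2 : ℝ) • C (m x) := rfl

/-- The covector component with respect to the splitting `sec`. -/
def covec (pr : K →ₗ[ℝ] K →ₗ[ℝ] ℝ) (sec : V →ₗ[ℝ] K) (a : K) : V →ₗ[ℝ] ℝ :=
  (2 : ℝ) • (pr a).comp sec

theorem covec_apply (a : K) (y : V) : covec pr sec a y = 2 * pr a (sec y) := rfl

/-- Raising indices, as a linear map. -/
def raiseL (e : Module.Basis ι ℝ V) (g : V →ₗ[ℝ] V →ₗ[ℝ] ℝ) : (V →ₗ[ℝ] ℝ) →ₗ[ℝ] V where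
  toFun ξ := raise e g ξ
  map_add' ξ η := raise_add e g ξ η
  map_smul' a ξ := raise_smul e g a ξ

theorem raiseL_apply (e : Module.Basis ι ℝ V) (g : V →ₗ[ℝ] V →ₗ[ℝ] ℝ) (ξ : V →ₗ[ℝ] ℝ) :
    raiseL e g ξ = raise e g ξ := rfl

namespace FiberModel

variable (h : FiberModel pr an sec C)
include h

theorem sec_coanchor (x : V) (ξ : V →ₗ[ℝ] ℝ) : pr (sec x) (C ξ) = ξ x := by
  rw [h.symm, h.coanchor, h.anchor_sec]

theorem decomp (a : K) : a = sec (an a) + (1 / 2 : ℝ) • C (covec pr sec a) := by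
  obtain ⟨ξ, hξ⟩ := h.exact (a - sec (an a)) (by rw [map_sub, h.anchor_sec, sub_self])
  have : (1 / 2 : ℝ) • covec pr sec a = ξ := by
    ext y
    have h1 : pr (a - sec (an a)) (sec y) = ξ y := by rw [hξ, h.coanchor, h.anchor_sec]
    rw [map_sub, LinearMap.sub_apply, h.isotropic, sub_zero] at h1
    rw [LinearMap.smul_apply, covec_apply, h1]; simp
  rw [← map_smul, this, ← hξ]; abel

/-- The B-field transform: a change of splitting by a skew form stays isotropic. -/
theorem twist (b : V →ₗ[ℝ] V →ₗ[ℝ] ℝ) (hb : ∀ x y, b x y = - b y x) :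
    FiberModel pr an (twistSec sec C b) C where
  symm := h.symm
  nondeg := h.nondeg
  coanchor := h.coanchor
  anchor_sec x := by simp [twistSec_apply, h.anchor_sec, h.anchor_coanchor]
  anchor_coanchor := h.anchor_coanchor
  isotropic x y := by
    simp only [twistSec_apply, map_add, map_smul, LinearMap.add_apply, LinearMap.smul_apply,
      h.isotropic, h.sec_coanchor, h.coanchor, h.anchor_sec, h.anchor_coanchor, smul_eq_mul,
      map_zero]
    rw [hb x y]; ring
  exact := h.exact

theorem coanchor_injective {ξ η : V →ₗ[ℝ] ℝ} (hξ : C ξ = C η) : ξ = η := by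
  ext x
  rw [← h.sec_coanchor, hξ, h.sec_coanchor]

end FiberModel

/-- The generalized metric of `m = g + b`. -/
def kEnd (e : Module.Basis ι ℝ V) (pr : K →ₗ[ℝ] K →ₗ[ℝ] ℝ) (an : K →ₗ[ℝ] V) (sec : V →ₗ[ℝ] K)
    (C : (V →ₗ[ℝ] ℝ) →ₗ[ℝ] K) (m : V →ₗ[ℝ] V →ₗ[ℝ] ℝ) : K →ₗ[ℝ] K where
  toFun a :=
    twistSec sec C (skewPart m) (raiseL e (symPart m) (covec pr sec a - skewPart m (an a)))
      + (1 / 2 : ℝ) • C (symPart m (an a))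
  map_add' a b := by
    have : covec pr sec (a + b) = covec pr sec a + covec pr sec b := by
      ext; simp [covec_apply]; ring
    simp only [this, map_add, map_sub, smul_add]; abel
  map_smul' c a := by
    have : covec pr sec (c • a) = c • covec pr sec a := by
      ext; simp [covec_apply]; ring
    simp only [this, map_smul, map_sub, smul_sub, smul_add, RingHom.id_apply]
    rw [smul_comm]

theorem kEnd_apply (e : Module.Basis ι ℝ V) (m : V →ₗ[ℝ] V →ₗ[ℝ] ℝ) (a : K) :
    kEnd e pr an sec C m a
      = twistSec sec C (skewPart m) (raiseL e (symPart m) (covec pr sec a - skewPart m (an a)))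
        + (1 / 2 : ℝ) • C (symPart m (an a)) := rfl

theorem skewPart_skew (m : V →ₗ[ℝ] V →ₗ[ℝ] ℝ) (x y : V) : skewPart m x y = - skewPart m y x := by
  rw [skewPart_apply, skewPart_apply]; ring

theorem symPart_add_skewPart (m : V →ₗ[ℝ] V →ₗ[ℝ] ℝ) : symPart m + skewPart m = m := by
  ext x y; rw [LinearMap.add_apply, LinearMap.add_apply, symPart_apply, skewPart_apply]; ring

theorem IsInner.raiseL_lower {g : V →ₗ[ℝ] V →ₗ[ℝ] ℝ} (hg : IsInner g) (e : Module.Basis ι ℝ V)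
    (x : V) : raiseL e g (g x) = x :=
  hg.eq_of_forall fun z => hg.raise_apply e (g x) z

theorem IsInner.lower_raiseL {g : V →ₗ[ℝ] V →ₗ[ℝ] ℝ} (hg : IsInner g) (e : Module.Basis ι ℝ V)
    (ξ : V →ₗ[ℝ] ℝ) : g (raiseL e g ξ) = ξ := by
  ext z; exact hg.raise_apply e ξ z

namespace FiberModel

variable (h : FiberModel pr an sec C) (e : Module.Basis ι ℝ V) {m : V →ₗ[ℝ] V →ₗ[ℝ] ℝ}
include h

theorem covec_coanchor (ξ : V →ₗ[ℝ] ℝ) : covec pr sec (C ξ) = (2 : ℝ) • ξ := by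
  ext y; simp [covec_apply, h.coanchor, h.anchor_sec]

theorem covec_twistSec (b : V →ₗ[ℝ] V →ₗ[ℝ] ℝ) (x : V) :
    covec pr sec (twistSec sec C b x) = b x := by
  ext y
  simp [covec_apply, twistSec_apply, h.isotropic, h.coanchor, h.anchor_sec]

theorem anchor_twistSec (b : V →ₗ[ℝ] V →ₗ[ℝ] ℝ) (x : V) : an (twistSec sec C b x) = x := by
  simp [twistSec_apply, h.anchor_sec, h.anchor_coanchor]

theorem kEnd_twistSec_skew (x : V) :
    kEnd e pr an sec C m (twistSec sec C (skewPart m) x) = (1 / 2 : ℝ) • C (symPart m x) := by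
  rw [kEnd_apply, h.covec_twistSec, h.anchor_twistSec, sub_self, map_zero, map_zero, zero_add]

theorem kEnd_coanchor (ξ : V →ₗ[ℝ] ℝ) : kEnd e pr an sec C m ((1 / 2 : ℝ) • C ξ)
    = twistSec sec C (skewPart m) (raiseL e (symPart m) ξ) := by
  rw [map_smul, kEnd_apply, h.covec_coanchor, h.anchor_coanchor]
  simp only [map_zero, sub_zero, smul_zero, add_zero, map_smul, smul_smul]
  norm_num

theorem decomp_twist (e : Module.Basis ι ℝ V) (hm : IsInner (symPart m)) (a : K) : ∃ v w,
    a = twistSec sec C (skewPart m) v + (1 / 2 : ℝ) • C (symPart m w) := by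
  refine ⟨an a, raiseL e (symPart m) (covec pr (twistSec sec C (skewPart m)) a), ?_⟩
  rw [hm.lower_raiseL]
  exact (h.twist _ (skewPart_skew m)).decomp a

theorem kEnd_twistSec (hm : IsInner (symPart m)) (x : V) :
    kEnd e pr an sec C m (twistSec sec C m x) = twistSec sec C m x := by
  have h1 : twistSec sec C m x
      = twistSec sec C (skewPart m) x + (1 / 2 : ℝ) • C (symPart m x) := by
    conv_lhs => rw [← symPart_add_skewPart m]
    simp only [twistSec_apply, LinearMap.add_apply, map_add, smul_add]; abel
  rw [h1, map_add, h.kEnd_twistSec_skew, h.kEnd_coanchor, hm.raiseL_lower, add_comm]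

theorem pr_twist (v w v' w' : V) :
    pr (twistSec sec C (skewPart m) v + (1 / 2 : ℝ) • C (symPart m w))
      (twistSec sec C (skewPart m) v' + (1 / 2 : ℝ) • C (symPart m w'))
      = (symPart m w v' + symPart m w' v) / 2 := by
  have ht := h.twist _ (skewPart_skew m)
  simp only [map_add, map_smul, LinearMap.add_apply, LinearMap.smul_apply, ht.isotropic,
    ht.sec_coanchor, ht.coanchor, ht.anchor_sec, ht.anchor_coanchor, smul_eq_mul, map_zero]
  ring

/-- In the splitting twisted by `b`, write an element as a vector `v` plus a covector `g w`; the
generalized metric exchanges `v` and `w`. Orthogonality, symmetry and positivity are immediate in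
these coordinates. -/
theorem kEnd_twist (hm : IsInner (symPart m)) (v w : V) :
    kEnd e pr an sec C m (twistSec sec C (skewPart m) v + (1 / 2 : ℝ) • C (symPart m w))
      = twistSec sec C (skewPart m) w + (1 / 2 : ℝ) • C (symPart m v) := by
  rw [map_add, h.kEnd_twistSec_skew, h.kEnd_coanchor, hm.raiseL_lower, add_comm]

theorem kEnd_orthogonal (hm : IsInner (symPart m)) (a b : K) :
    pr (kEnd e pr an sec C m a) (kEnd e pr an sec C m b) = pr a b := by
  obtain ⟨v, w, rfl⟩ := h.decomp_twist e hm a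
  obtain ⟨v', w', rfl⟩ := h.decomp_twist e hm b
  rw [h.kEnd_twist e hm, h.kEnd_twist e hm, h.pr_twist, h.pr_twist, hm.symm v, hm.symm v']; ring

theorem kEnd_symmetric (hm : IsInner (symPart m)) (a b : K) :
    pr (kEnd e pr an sec C m a) b = pr (kEnd e pr an sec C m b) a := by
  obtain ⟨v, w, rfl⟩ := h.decomp_twist e hm a
  obtain ⟨v', w', rfl⟩ := h.decomp_twist e hm b
  rw [h.kEnd_twist e hm, h.kEnd_twist e hm, h.pr_twist, h.pr_twist, hm.symm v, hm.symm w']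

theorem kEnd_pos (hm : IsInner (symPart m)) (a : K) (ha : a ≠ 0) :
    0 < pr (kEnd e pr an sec C m a) a := by
  obtain ⟨v, w, rfl⟩ := h.decomp_twist e hm a
  rw [h.kEnd_twist e hm, h.pr_twist]
  have hnn : ∀ x, 0 ≤ symPart m x x := fun x => by
    rcases eq_or_ne x 0 with rfl | hx
    · simp
    · exact (hm.pos x hx).le
  rcases eq_or_ne v 0 with rfl | hv
  · have hw : w ≠ 0 := by rintro rfl; simp at ha
    have := hm.pos w hw
    simp; linarith
  · have := hm.pos v hv
    have := hnn w
    linarith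

/-- A generalized metric is determined by its eigenbundle for the eigenvalue `1`. -/
theorem eq_kEnd (hm : IsInner (symPart m)) {S : K →ₗ[ℝ] K} (ho : ∀ a b, pr (S a) (S b) = pr a b)
    (hp : ∀ a, a ≠ 0 → 0 < pr (S a) a) (hs : ∀ a b, pr (S a) b = pr (S b) a)
    (hS : ∀ x, S (twistSec sec C m x) = twistSec sec C m x) : S = kEnd e pr an sec C m := by
  have hSS : ∀ a, S (S a) = a := fun a => by
    rw [← sub_eq_zero]
    refine h.nondeg _ fun b => ?_
    rw [map_sub, LinearMap.sub_apply, hs, ho, h.symm, sub_self]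
  have h1 : ∀ x, twistSec sec C m x
      = twistSec sec C (skewPart m) x + (1 / 2 : ℝ) • C (symPart m x) := fun x => by
    conv_lhs => rw [← symPart_add_skewPart m]
    simp only [twistSec_apply, LinearMap.add_apply, map_add, smul_add]; abel
  -- The `-1`-eigenspace must be the orthogonal complement of the graph of `m`. Indeed `v = S a + a`
  -- is fixed by `S` but still orthogonal to the graph, where the pairing is negative definite;
  -- positivity of `⟨S v, v⟩ = ⟨v, v⟩` forces `v = 0`.
  have hminus : ∀ x, S (twistSec sec C (skewPart m) x - (1 / 2 : ℝ) • C (symPart m x))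
      = - (twistSec sec C (skewPart m) x - (1 / 2 : ℝ) • C (symPart m x)) := by
    intro x
    set a := twistSec sec C (skewPart m) x - (1 / 2 : ℝ) • C (symPart m x) with ha
    set v := S a + a with hv
    have hSv : S v = v := by rw [hv, map_add, hSS, add_comm]
    have hperp : ∀ y, pr a (twistSec sec C m y) = 0 := by
      intro y
      have : a = twistSec sec C (skewPart m) x + (1 / 2 : ℝ) • C (symPart m (-x)) := by
        rw [ha, map_neg, map_neg, smul_neg, sub_eq_add_neg]
      rw [this, h1, h.pr_twist, hm.symm y, map_neg, LinearMap.neg_apply]; ring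
    have hv0 : v = 0 := by
      by_contra hne
      have hpos := hp v hne
      rw [hSv] at hpos
      have hperpv : ∀ y, pr v (twistSec sec C m y) = 0 := by
        intro y
        rw [hv, map_add, LinearMap.add_apply, hperp]
        conv_lhs => rw [← hS y]
        rw [ho, hperp, add_zero]
      obtain ⟨p, q, hpq⟩ := h.decomp_twist e hm v
      have hq : symPart m (q + p) = 0 := by
        ext y
        have := hperpv y
        rw [hpq, h1, h.pr_twist] at this
        rw [map_add, LinearMap.add_apply, hm.symm p]; simp; linarith
      have hqp : q = - p := by
        have : q + p = 0 := hm.eq_of_forall fun z => by rw [hq]; simp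
        exact eq_neg_of_add_eq_zero_left this
      have : pr v v = - symPart m p p := by
        rw [hpq, h.pr_twist, hqp, map_neg, LinearMap.neg_apply]; ring
      rw [this] at hpos
      rcases eq_or_ne p 0 with rfl | hp0
      · simp at hpos
      · linarith [hm.pos p hp0]
    exact eq_neg_of_add_eq_zero_left hv0
  ext a
  obtain ⟨v, w, rfl⟩ := h.decomp_twist e hm a
  rw [h.kEnd_twist e hm]
  have h2 : twistSec sec C (skewPart m) v + (1 / 2 : ℝ) • C (symPart m w)
      = (1 / 2 : ℝ) • twistSec sec C m (v + w)
        + (1 / 2 : ℝ) • (twistSec sec C (skewPart m) (v - w)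
          - (1 / 2 : ℝ) • C (symPart m (v - w))) := by
    rw [h1]; simp only [map_add, map_sub]; module
  rw [h2, map_add, map_smul, map_smul, hS, hminus, h1]
  simp only [map_add, map_sub]; module

end FiberModel

/-- The generalized Ricci curvature of `m = g + b`, with symmetric part `R` and skew part `D`. -/
def rcEnd (e : Module.Basis ι ℝ V) (pr : K →ₗ[ℝ] K →ₗ[ℝ] ℝ) (an : K →ₗ[ℝ] V) (sec : V →ₗ[ℝ] K)
    (C : (V →ₗ[ℝ] ℝ) →ₗ[ℝ] K) (m R D : V →ₗ[ℝ] V →ₗ[ℝ] ℝ) (a : K) : K :=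
  let u := raiseL e (symPart m) (covec pr (twistSec sec C (skewPart m)) a)
  twistSec sec C (skewPart m)
      (raiseL e (symPart m) (R (an a)) + (1 / 2 : ℝ) • raiseL e (symPart m) (D u))
    + (1 / 2 : ℝ) • C (-(1 / 2 : ℝ) • D (an a) - R u)

/-- The derivative of `kEnd` in the direction of `m' = h + β`. -/
def dkEnd (e : Module.Basis ι ℝ V) (sec : V →ₗ[ℝ] K) (C : (V →ₗ[ℝ] ℝ) →ₗ[ℝ] K)
    (m h β : V →ₗ[ℝ] V →ₗ[ℝ] ℝ) (v w : V) : K :=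
  (1 / 2 : ℝ) • C (h v + β w)
    - twistSec sec C (skewPart m) (raiseL e (symPart m) (β v + h w))

namespace FiberModel

variable (h : FiberModel pr an sec C) (e : Module.Basis ι ℝ V) {m : V →ₗ[ℝ] V →ₗ[ℝ] ℝ}
include h

/-- The right-hand side of the generalized flow is tangent to the family `kEnd`, in the direction
with symmetric part `-2R` and skew part `-D`. This is where the flow splits into `g' = -2 Ric^B` and
`b' = -d^*H`. -/
theorem kEnd_rcEnd (hm : IsInner (symPart m)) (R D : V →ₗ[ℝ] V →ₗ[ℝ] ℝ) (v w : V) :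
    (-2 : ℝ) • kEnd e pr an sec C m (rcEnd e pr an sec C m R D
      (twistSec sec C (skewPart m) v + (1 / 2 : ℝ) • C (symPart m w)))
      = dkEnd e sec C m ((-2 : ℝ) • R) (-D) v w := by
  have ht := h.twist _ (skewPart_skew m)
  have h1 : an (twistSec sec C (skewPart m) v + (1 / 2 : ℝ) • C (symPart m w)) = v := by
    simp [ht.anchor_sec, ht.anchor_coanchor]
  have h2 : raiseL e (symPart m) (covec pr (twistSec sec C (skewPart m))
      (twistSec sec C (skewPart m) v + (1 / 2 : ℝ) • C (symPart m w))) = w := by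
    have : covec pr (twistSec sec C (skewPart m))
      (twistSec sec C (skewPart m) v + (1 / 2 : ℝ) • C (symPart m w)) = symPart m w := by
      ext y
      simp [covec_apply, ht.isotropic, ht.coanchor, ht.anchor_sec]
    rw [this, hm.raiseL_lower]
  simp only [rcEnd, h1, h2]
  rw [map_add, h.kEnd_twistSec_skew, h.kEnd_coanchor, dkEnd]
  simp only [map_add, map_smul, map_neg, map_sub, hm.lower_raiseL, LinearMap.smul_apply,
    LinearMap.neg_apply]
  module

end FiberModel

end Fiber

/-! ### Equivalence of the flow of endomorphisms with the flow of forms. -/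

section FiberDeriv

variable {ι : Type*} [Fintype ι] [DecidableEq ι] {V : Type*} [AddCommGroup V] [Module ℝ V]
  {K : Type*} [AddCommGroup K] [Module ℝ K]
  {pr : K →ₗ[ℝ] K →ₗ[ℝ] ℝ} {an : K →ₗ[ℝ] V} {sec : V →ₗ[ℝ] K}
  {C : (V →ₗ[ℝ] ℝ) →ₗ[ℝ] K}

theorem hasDerivAt_form_of_basis (e : Module.Basis ι ℝ V) {m : ℝ → V →ₗ[ℝ] V →ₗ[ℝ] ℝ}
    {D : V →ₗ[ℝ] V →ₗ[ℝ] ℝ} {t : ℝ}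
    (h : ∀ i j, HasDerivAt (fun s => m s (e i) (e j)) (D (e i) (e j)) t) (x y : V) :
    HasDerivAt (fun s => m s x y) (D x y) t := by
  simp only [form_eq_sum e _ x y]
  exact HasDerivAt.fun_sum fun i _ => HasDerivAt.fun_sum fun j _ => (h i j).mul_const _

theorem coord_raise (e : Module.Basis ι ℝ V) (g : V →ₗ[ℝ] V →ₗ[ℝ] ℝ) (ξ : V → ℝ) (j : ι) :
    e.repr (raise e g ξ) j = ∑ i, gramInv e g i j * ξ (e i) := by
  simp [raise, map_sum, Finsupp.single_apply]

theorem map_eq_sum_coord (e : Module.Basis ι ℝ V) (ℓ : (V →ₗ[ℝ] ℝ) →ₗ[ℝ] ℝ) (ξ : V →ₗ[ℝ] ℝ) :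
    ℓ ξ = ∑ k, ξ (e k) * ℓ (e.coord k) := by
  have : ξ = ∑ k, ξ (e k) • e.coord k := by
    refine e.ext fun i => ?_
    simp
  conv_lhs => rw [this]
  simp only [map_sum, map_smul, smul_eq_mul]

theorem map_eq_sum_repr (e : Module.Basis ι ℝ V) (ℓ : V →ₗ[ℝ] ℝ) (x : V) :
    ℓ x = ∑ k, e.repr x k * ℓ (e k) := by
  conv_lhs => rw [← e.sum_repr x]
  simp only [map_sum, map_smul, smul_eq_mul]

theorem hasDerivAt_symPart {m : ℝ → V →ₗ[ℝ] V →ₗ[ℝ] ℝ} {D : V →ₗ[ℝ] V →ₗ[ℝ] ℝ} {t : ℝ}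
    (h : ∀ x y, HasDerivAt (fun s => m s x y) (D x y) t) (x y : V) :
    HasDerivAt (fun s => symPart (m s) x y) (symPart D x y) t := by
  simp only [symPart_apply]
  exact ((h x y).add (h y x)).div_const 2

theorem hasDerivAt_skewPart {m : ℝ → V →ₗ[ℝ] V →ₗ[ℝ] ℝ} {D : V →ₗ[ℝ] V →ₗ[ℝ] ℝ} {t : ℝ}
    (h : ∀ x y, HasDerivAt (fun s => m s x y) (D x y) t) (x y : V) :
    HasDerivAt (fun s => skewPart (m s) x y) (skewPart D x y) t := by
  simp only [skewPart_apply]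
  exact ((h x y).sub (h y x)).div_const 2

namespace FiberModel

variable (h : FiberModel pr an sec C) (e : Module.Basis ι ℝ V) {m : ℝ → V →ₗ[ℝ] V →ₗ[ℝ] ℝ} {t : ℝ}
include h

/-- The argument is a fixed vector, expressed in the splitting belonging to time `t`. Its image
moves through the raised covector `y s` and through the twist. -/
theorem hasDerivAt_kEnd (hm : ∀ᶠ s in 𝓝 t, IsInner (symPart (m s))) {D : V →ₗ[ℝ] V →ₗ[ℝ] ℝ}
    (hD : ∀ x y, HasDerivAt (fun s => m s x y) (D x y) t) (v w : V) (ℓ : K →ₗ[ℝ] ℝ) :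
    HasDerivAt (fun s => ℓ (kEnd e pr an sec C (m s)
        (twistSec sec C (skewPart (m t)) v + (1 / 2 : ℝ) • C (symPart (m t) w))))
      (ℓ (dkEnd e sec C (m t) (symPart D) (skewPart D) v w)) t := by
  have hmt := hm.self_of_nhds
  have ht := h.twist _ (skewPart_skew (m t))
  have hg := hasDerivAt_symPart hD
  have hb := hasDerivAt_skewPart hD
  set f := twistSec sec C (skewPart (m t)) v + (1 / 2 : ℝ) • C (symPart (m t) w) with hf
  have hfv : an f = v := by simp [hf, ht.anchor_sec, ht.anchor_coanchor]
  have hfc : covec pr sec f - skewPart (m t) v = symPart (m t) w := by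
    have : covec pr sec f = covec pr sec (twistSec sec C (skewPart (m t)) v)
        + (1 / 2 : ℝ) • covec pr sec (C (symPart (m t) w)) := by
      ext; simp [covec_apply, hf]; ring
    rw [this, h.covec_twistSec, h.covec_coanchor, smul_smul]; norm_num
  let ξ : ℝ → V →ₗ[ℝ] ℝ := fun s => covec pr sec f - skewPart (m s) v
  have hξ : ∀ z, HasDerivAt (fun s => ξ s z) (- skewPart D v z) t := fun z => by
    simpa [ξ] using (hb v z).const_sub (covec pr sec f z)
  let y : ℝ → V := fun s => raiseL e (symPart (m s)) (ξ s)
  have hyt : y t = w := by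
    simp only [y, ξ, hfc, hmt.raiseL_lower]
  have hP : ∀ i j, ∃ p', HasDerivAt (fun s => gramInv e (symPart (m s)) i j) p' t := fun i j =>
    ⟨_, hasDerivAt_matrix_inv (N := fun s => Matrix.of fun i j => symPart (m s) (e i) (e j))
      (N' := Matrix.of fun i j => symPart D (e i) (e j))
      (fun i j => hg (e i) (e j)) (hmt.det_ne_zero e) i j⟩
  choose P' hP' using hP
  have hy : ∀ j, ∃ y', HasDerivAt (fun s => e.repr (y s) j) y' t := fun j => by
    refine ⟨_, HasDerivAt.congr_of_eventuallyEq
      (HasDerivAt.fun_sum (u := Finset.univ) fun i _ => (hP' i j).mul (hξ (e i))) ?_⟩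
    exact Eventually.of_forall fun s => by simp [y, raiseL_apply, coord_raise]
  choose y' hy' using hy
  let Y' : V := ∑ j, y' j • e j
  have hY'r : ∀ j, e.repr Y' j = y' j := fun j => by simp [Y', Finsupp.single_apply]
  have hlin : ∀ (L : ℝ → V →ₗ[ℝ] ℝ) (L' : V →ₗ[ℝ] ℝ),
      (∀ x, HasDerivAt (fun s => L s x) (L' x) t) →
      HasDerivAt (fun s => L s (y s)) (L t Y' + L' (y t)) t := by
    intro L L' hL
    have h1 := HasDerivAt.fun_sum (u := Finset.univ) fun j _ => (hy' j).mul (hL (e j))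
    convert! h1 using 1
    · ext s; exact map_eq_sum_repr e (L s) (y s)
    · rw [Finset.sum_add_distrib, map_eq_sum_repr e (L t) Y', map_eq_sum_repr e L' (y t)]
      simp only [hY'r]
  -- Implicit differentiation of `g_s (y s) = ξ s`: at time `t` one has `y = w`, so `g Y' + h w = -β
  -- v`.
  have hYeq : Y' = - raiseL e (symPart (m t)) (skewPart D v + symPart D w) := by
    refine hmt.eq_of_forall fun z => ?_
    have h1 := hlin (fun s => (symPart (m s)).flip z) ((symPart D).flip z) fun x => hg x z
    have h2 : (fun s => ξ s z) =ᶠ[𝓝 t] fun s => (symPart (m s)).flip z (y s) := by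
      filter_upwards [hm] with s hs
      simp only [LinearMap.flip_apply, y]
      rw [hs.lower_raiseL]
    have h3 := (h1.congr_of_eventuallyEq h2).unique (hξ z)
    rw [hyt] at h3
    simp only [LinearMap.flip_apply] at h3
    rw [map_neg, LinearMap.neg_apply, hmt.lower_raiseL, LinearMap.add_apply]
    linarith
  obtain ⟨c, hc⟩ : ∃ c : ι → ℝ, ∀ η : V →ₗ[ℝ] ℝ, ℓ (C η) = ∑ k, η (e k) * c k :=
    ⟨_, map_eq_sum_coord e (ℓ.comp C)⟩
  have h1 := hlin (fun s => ℓ.comp (twistSec sec C (skewPart (m s))))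
    ((1 / 2 : ℝ) • (ℓ.comp C).comp (skewPart D)) (fun x => by
      simp only [LinearMap.comp_apply, twistSec_apply, map_add, map_smul, LinearMap.smul_apply,
        hc, smul_eq_mul]
      exact ((HasDerivAt.fun_sum fun k _ => (hb x (e k)).mul_const _).const_mul _).const_add _)
  have h2 : HasDerivAt (fun s => ℓ ((1 / 2 : ℝ) • C (symPart (m s) v)))
      (ℓ ((1 / 2 : ℝ) • C (symPart D v))) t := by
    simp only [map_smul, hc, smul_eq_mul]
    exact (HasDerivAt.fun_sum fun k _ => (hg v (e k)).mul_const _).const_mul _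
  have h3 := h1.add h2
  convert! h3 using 1
  · ext s
    simp only [kEnd_apply, hfv, map_add, LinearMap.comp_apply, Pi.add_apply]
    rfl
  · rw [hyt, hYeq, dkEnd]
    simp only [LinearMap.comp_apply, LinearMap.smul_apply, map_neg, map_sub, map_smul, map_add,
      smul_eq_mul]
    ring

theorem hasDerivAt_kEnd_flow (hm : ∀ᶠ s in 𝓝 t, IsInner (symPart (m s)))
    {R D : V →ₗ[ℝ] V →ₗ[ℝ] ℝ} (hR : ∀ x y, R x y = R y x) (hD : ∀ x y, D x y = - D y x)
    (hd : ∀ x y, HasDerivAt (fun s => m s x y) (-2 * R x y - D x y) t) (a : K) (ℓ : K →ₗ[ℝ] ℝ) :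
    HasDerivAt (fun s => ℓ (kEnd e pr an sec C (m s) a))
      (ℓ ((-2 : ℝ) • kEnd e pr an sec C (m t) (rcEnd e pr an sec C (m t) R D a))) t := by
  obtain ⟨v, w, rfl⟩ := h.decomp_twist e hm.self_of_nhds a
  rw [h.kEnd_rcEnd e hm.self_of_nhds]
  have h1 := h.hasDerivAt_kEnd e hm (D := (-2 : ℝ) • R - D) (fun x y => by simpa using hd x y) v w ℓ
  have h2 : symPart ((-2 : ℝ) • R - D) = (-2 : ℝ) • R := by
    ext x y; simp [symPart_apply]; rw [hR y x, hD y x]; ring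
  have h3 : skewPart ((-2 : ℝ) • R - D) = - D := by
    ext x y; simp [skewPart_apply]; rw [hR y x, hD y x]; ring
  rwa [h2, h3] at h1

/-- Differentiability of `m` is not given and is recovered first: `g⁻¹`, and then `g` and `b`, are
read off from matrix entries of the endomorphism. The derivative then follows from uniqueness. -/
theorem hasDerivAt_of_kEnd (hm : ∀ᶠ s in 𝓝 t, IsInner (symPart (m s)))
    {R D : V →ₗ[ℝ] V →ₗ[ℝ] ℝ}
    (hd : ∀ a (ℓ : K →ₗ[ℝ] ℝ), HasDerivAt (fun s => ℓ (kEnd e pr an sec C (m s) a))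
      (ℓ ((-2 : ℝ) • kEnd e pr an sec C (m t) (rcEnd e pr an sec C (m t) R D a))) t) (x y : V) :
    HasDerivAt (fun s => m s x y) (-2 * R x y - D x y) t := by
  have hmt := hm.self_of_nhds
  -- The anchor of the image of a covector is that covector raised by `g`.
  have hP : ∀ i j, ∃ p', HasDerivAt (fun s => gramInv e (symPart (m s)) i j) p' t := fun i j => by
    have h1 := hd ((1 / 2 : ℝ) • C (e.coord i)) ((e.coord j).comp an)
    refine ⟨_, h1.congr_of_eventuallyEq (Eventually.of_forall fun s => ?_)⟩
    simp only [h.kEnd_coanchor, LinearMap.comp_apply, h.anchor_twistSec]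
    simp [raiseL_apply, coord_raise, Finsupp.single_apply]
  choose P' hP' using hP
  have hg : ∀ i j, ∃ p', HasDerivAt (fun s => symPart (m s) (e i) (e j)) p' t := fun i j => by
    have hdet : IsUnit (Matrix.of fun i j => symPart (m t) (e i) (e j)).det :=
      isUnit_iff_ne_zero.2 (hmt.det_ne_zero e)
    refine ⟨_, (hasDerivAt_matrix_inv (N := fun s => gramInv e (symPart (m s)))
      (N' := Matrix.of P') hP' ?_ i j).congr_of_eventuallyEq ?_⟩
    · rw [gramInv]
      exact (isUnit_iff_ne_zero.1 ((Matrix.isUnit_nonsing_inv_det_iff).2 hdet))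
    · filter_upwards [hm] with s hs
      rw [gramInv, Matrix.nonsing_inv_nonsing_inv _ (isUnit_iff_ne_zero.2 (hs.det_ne_zero e))]
      rfl
  choose g' hg' using hg
  -- Covector components of the same images give `b ∘ g⁻¹`; composing with `g` recovers `b`.
  have hb : ∀ i j, ∃ p', HasDerivAt (fun s => skewPart (m s) (e i) (e j)) p' t := fun i j => by
    have h1 : ∀ k, ∃ p', HasDerivAt
        (fun s => skewPart (m s) (raiseL e (symPart (m s)) (e.coord k)) (e j)) p' t := fun k => by
      have h1 := hd ((1 / 2 : ℝ) • C (e.coord k)) ((2 : ℝ) • pr.flip (sec (e j)))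
      refine ⟨_, h1.congr_of_eventuallyEq (Eventually.of_forall fun s => ?_)⟩
      simp only [h.kEnd_coanchor, LinearMap.smul_apply, LinearMap.flip_apply, smul_eq_mul]
      rw [← covec_apply, h.covec_twistSec]
    choose q hq using h1
    refine ⟨_, (HasDerivAt.fun_sum (u := Finset.univ) fun k _ =>
      (hg' i k).mul (hq k)).congr_of_eventuallyEq ?_⟩
    filter_upwards [hm] with s hs
    have := map_eq_sum_coord e (((skewPart (m s)).flip (e j)).comp (raiseL e (symPart (m s))))
      (symPart (m s) (e i))
    simp only [LinearMap.comp_apply, LinearMap.flip_apply, hs.raiseL_lower] at this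
    exact this
  choose b' hb' using hb
  let M := formOf e fun i j => g' i j + b' i j
  have hM : ∀ x y, HasDerivAt (fun s => m s x y) (M x y) t := hasDerivAt_form_of_basis e
    fun i j => by
      rw [formOf_basis]
      refine ((hg' i j).add (hb' i j)).congr_of_eventuallyEq (Eventually.of_forall fun s => ?_)
      exact (DFunLike.congr_fun (DFunLike.congr_fun (symPart_add_skewPart (m s)) (e i)) (e j)).symm
  -- Images of covectors (`v = 0`) suffice: the anchor component determines the symmetric part of
  -- the derivative, and the remaining coanchor component the skew part.
  have key : ∀ w, symPart M w = (-2 : ℝ) • R w ∧ skewPart M w = - D w := by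
    intro w
    have h1 : dkEnd e sec C (m t) (symPart M) (skewPart M) 0 w
        = dkEnd e sec C (m t) ((-2 : ℝ) • R) (-D) 0 w := by
      rw [← h.kEnd_rcEnd e hmt, ← sub_eq_zero]
      refine h.nondeg _ fun b => ?_
      have := (h.hasDerivAt_kEnd e hm hM 0 w (pr.flip b)).unique (hd _ (pr.flip b))
      rw [map_sub, LinearMap.sub_apply, sub_eq_zero]
      exact this
    simp only [dkEnd, map_zero, zero_add, LinearMap.neg_apply, LinearMap.smul_apply] at h1
    have h2 : raiseL e (symPart (m t)) (symPart M w) = raiseL e (symPart (m t)) ((-2 : ℝ) • R w) := by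
      have := congrArg an h1
      simpa only [map_sub, map_smul, h.anchor_coanchor, h.anchor_twistSec, smul_zero, zero_sub,
        neg_inj] using this
    have h3 : symPart M w = (-2 : ℝ) • R w := by
      rw [← hmt.lower_raiseL e (symPart M w), h2, hmt.lower_raiseL]
    rw [h2, sub_left_inj] at h1
    refine ⟨h3, h.coanchor_injective ?_⟩
    have := congrArg (fun a => (2 : ℝ) • a) h1
    simpa only [smul_smul, show (2 : ℝ) * (1 / 2) = 1 by norm_num, one_smul] using this
  convert! hM x y using 1
  conv_rhs => rw [← symPart_add_skewPart M]
  rw [LinearMap.add_apply, LinearMap.add_apply, (key x).1, (key x).2]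
  simp; ring

end FiberModel

end FiberDeriv

/-! ### The quadratic Lie algebra on the fibre and its 3-form. -/

section FiberBracket

variable {V : Type*} [AddCommGroup V] [Module ℝ V] {K : Type*} [AddCommGroup K] [Module ℝ K]
  {pr : K →ₗ[ℝ] K →ₗ[ℝ] ℝ} {an : K →ₗ[ℝ] V} {sec : V →ₗ[ℝ] K}
  {C : (V →ₗ[ℝ] ℝ) →ₗ[ℝ] K} {br : V →ₗ[ℝ] V →ₗ[ℝ] V} {B : K →ₗ[ℝ] K →ₗ[ℝ] K}

/-- `B` makes `K` a quadratic Lie algebra with a homomorphism `an` to the Lie algebra `V`. -/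
structure IsFiberBracket (pr : K →ₗ[ℝ] K →ₗ[ℝ] ℝ) (an : K →ₗ[ℝ] V) (br : V →ₗ[ℝ] V →ₗ[ℝ] V)
    (B : K →ₗ[ℝ] K →ₗ[ℝ] K) : Prop where
  anchor : ∀ a b, an (B a b) = br (an a) (an b)
  skew : ∀ a b, B a b = - B b a
  invariant : ∀ a b c, pr (B a b) c = - pr b (B a c)
  jacobi : ∀ a b c, B a (B b c) = B (B a b) c + B b (B a c)

/-- The `3`-form of an isotropic splitting. -/
def torsionForm (pr : K →ₗ[ℝ] K →ₗ[ℝ] ℝ) (sec : V →ₗ[ℝ] K) (B : K →ₗ[ℝ] K →ₗ[ℝ] K) :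
    V →ₗ[ℝ] V →ₗ[ℝ] V →ₗ[ℝ] ℝ where
  toFun x := LinearMap.mk₂ ℝ (fun y z => 2 * pr (B (sec x) (sec y)) (sec z))
    (fun _ _ _ => by simp; ring) (fun _ _ _ => by simp; ring)
    (fun _ _ _ => by simp; ring) (fun _ _ _ => by simp; ring)
  map_add' x x' := by ext y z; simp; ring
  map_smul' a x := by ext y z; simp; ring

theorem torsionForm_apply (x y z : V) :
    torsionForm pr sec B x y z = 2 * pr (B (sec x) (sec y)) (sec z) := rfl

theorem IsFiberBracket.coanchor_right (hB : IsFiberBracket pr an br B)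
    (h : FiberModel pr an sec C) (a c : K) (η : V →ₗ[ℝ] ℝ) :
    pr (B a (C η)) c = - η (br (an a) (an c)) := by
  rw [hB.invariant, h.coanchor, hB.anchor]

theorem IsFiberBracket.coanchor_left (hB : IsFiberBracket pr an br B)
    (h : FiberModel pr an sec C) (a c : K) (η : V →ₗ[ℝ] ℝ) :
    pr (B (C η) a) c = η (br (an a) (an c)) := by
  rw [hB.skew, map_neg, LinearMap.neg_apply, hB.coanchor_right h, neg_neg]

theorem IsFiberBracket.isClosed3 (hB : IsFiberBracket pr an br B) (h : FiberModel pr an sec C) :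
    IsClosed3 br (torsionForm pr sec B) where
  skew_left x y z := by
    simp only [torsionForm_apply]
    rw [hB.skew (sec x)]; simp
  skew_right x y z := by
    simp only [torsionForm_apply]
    rw [hB.invariant, h.symm (sec y)]; ring
  closed x i j b := by
    -- The bracket of two sections is the section of the bracket plus half the coanchor of `H(u, v,
    -- ·)`; with this, the Jacobi identity paired with `sec b` becomes closedness of `H`.
    have hdec : ∀ u v, B (sec u) (sec v)
        = sec (br u v) + (1 / 2 : ℝ) • C (torsionForm pr sec B u v) := fun u v => by
      conv_lhs => rw [h.decomp (B (sec u) (sec v))]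
      rw [hB.anchor, h.anchor_sec, h.anchor_sec]
      congr 3
    have key : ∀ u v w, pr (B (sec u) (B (sec v) (sec w))) (sec b)
        = (torsionForm pr sec B u (br v w) b - torsionForm pr sec B v w (br u b)) / 2 := by
      intro u v w
      rw [hdec v w, map_add, map_smul, map_add, LinearMap.add_apply, map_smul,
        LinearMap.smul_apply, hB.coanchor_right h, h.anchor_sec, h.anchor_sec]
      simp only [torsionForm_apply, smul_eq_mul]; ring
    have hj := congrArg (fun a => pr a (sec b)) (hB.jacobi (sec x) (sec i) (sec j))
    simp only [map_add, LinearMap.add_apply] at hj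
    rw [hB.skew (B (sec x) (sec i)) (sec j), map_neg, LinearMap.neg_apply, key, key, key] at hj
    have h1 : torsionForm pr sec B (br x i) j b = - torsionForm pr sec B j (br x i) b := by
      simp only [torsionForm_apply]
      rw [hB.skew (sec j)]; simp
    linarith

/-- Twisting by `b` adds one coanchor term for each slot, and these assemble to `db`. Terms with two
coanchors vanish because the image of the coanchor is isotropic and killed by the anchor. -/
theorem IsFiberBracket.torsionForm_twistSec (hB : IsFiberBracket pr an br B)
    (h : FiberModel pr an sec C) (m : V →ₗ[ℝ] V →ₗ[ℝ] ℝ) (x y z : V) :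
    torsionForm pr (twistSec sec C (skewPart m)) B x y z
      = flowH br (torsionForm pr sec B) m x y z := by
  simp only [torsionForm_apply, twistSec_apply, flowH, LinearMap.add_apply, extL_apply, lieExt,
    map_add, map_smul, LinearMap.smul_apply, smul_eq_mul, hB.coanchor_left h, hB.coanchor_right h,
    h.anchor_sec, h.anchor_coanchor, map_zero, LinearMap.zero_apply]
  have : ∀ (a : K) (η : V →ₗ[ℝ] ℝ), pr a (C η) = η (an a) := fun a η => by rw [h.symm, h.coanchor]
  simp only [this, hB.anchor, h.anchor_sec]
  ring

end FiberBracket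

/-! ### Left-invariant tensors on the group reduce to the Lie algebra. -/

section LieGeometry

variable {V : Type*} [NormedAddCommGroup V] [NormedSpace ℝ V]
  {G : Type*} [TopologicalSpace G] [ChartedSpace V G] [Group G]

instance instLieGroupMinSmoothness [LieGroup 𝓘(ℝ, V) ∞ G] :
    LieGroup 𝓘(ℝ, V) (minSmoothness ℝ 3) G :=
  LieGroup.of_le (n := ∞) (by rw [minSmoothness_of_isRCLikeNormedField]; exact WithTop.coe_le_coe.2 (le_top : (3 : ℕ∞) ≤ ⊤))

variable [LieGroup 𝓘(ℝ, V) ∞ G]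

/-- Left translation of tangent vectors at the identity. -/
def transT (p : G) : V ≃ₗ[ℝ] TangentSpace 𝓘(ℝ, V) p where
  toFun v := mulInvariantVectorField (I := 𝓘(ℝ, V)) (G := G) (v : V) p
  invFun x := (mfderiv 𝓘(ℝ, V) 𝓘(ℝ, V) (fun q : G => p⁻¹ * q) p x : V)
  map_add' v w := congrFun (mulInvariantVectorField_add (I := 𝓘(ℝ, V)) (G := G) v w) p
  map_smul' c v := congrFun (mulInvariantVectorField_smul (I := 𝓘(ℝ, V)) (G := G) c v) p
  left_inv v := by
    have A : mfderiv 𝓘(ℝ, V) 𝓘(ℝ, V) ((fun x : G => p⁻¹ * x) ∘ (fun x => p * x)) 1 =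
      ContinuousLinearMap.id _ _ := by
      have : (fun x : G ↦ p⁻¹ * x) ∘ (fun x ↦ p * x) = id := by ext x; simp
      rw [this, id_eq, mfderiv_id]
    rw [mfderiv_comp (I' := 𝓘(ℝ, V)) _
      ((contMDiff_mul_left (I := 𝓘(ℝ, V)) (n := ∞)).contMDiffAt.mdifferentiableAt (by simp))
      ((contMDiff_mul_left (I := 𝓘(ℝ, V)) (n := ∞)).contMDiffAt.mdifferentiableAt (by simp))] at A
    have := DFunLike.congr_fun A v
    rw [mul_one] at this
    exact this
  right_inv x := by
    have A : mfderiv 𝓘(ℝ, V) 𝓘(ℝ, V) ((fun x : G => p * x) ∘ (fun x => p⁻¹ * x)) p =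
      ContinuousLinearMap.id _ _ := by
      have : (fun x : G ↦ p * x) ∘ (fun x ↦ p⁻¹ * x) = id := by ext x; simp
      rw [this, id_eq, mfderiv_id]
    rw [mfderiv_comp (I' := 𝓘(ℝ, V)) _
      ((contMDiff_mul_left (I := 𝓘(ℝ, V)) (n := ∞)).contMDiffAt.mdifferentiableAt (by simp))
      ((contMDiff_mul_left (I := 𝓘(ℝ, V)) (n := ∞)).contMDiffAt.mdifferentiableAt (by simp))] at A
    have := DFunLike.congr_fun A x
    rw [inv_mul_cancel] at this
    exact this


theorem transT_one (v : V) : transT (1 : G) v = v := by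
  change mfderiv 𝓘(ℝ, V) 𝓘(ℝ, V) (fun q : G => 1 * q) 1 v = v
  have : (fun q : G => 1 * q) = id := by ext; simp
  rw [this, mfderiv_id]; rfl

/-- The left-invariant vector field with value `v` at the identity. -/
def leftField (v : V) : VField V G := fun p => transT p v

theorem leftExt_transT (p : G) (v : V) : leftExt p (transT p v) = (leftField v : VField V G) := by
  funext q
  change transT q ((transT p).symm (transT p v)) = transT q v
  rw [LinearEquiv.symm_apply_apply]

variable [FiniteDimensional ℝ V]

instance instCompleteOfFiniteDimensional : CompleteSpace V := FiniteDimensional.complete ℝ V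

variable (V G) in
/-- The Lie bracket of left-invariant vector fields. -/
def lieBr : V →ₗ[ℝ] V →ₗ[ℝ] V :=
  LinearMap.mk₂ ℝ (fun v w => Bracket.bracket (L := GroupLieAlgebra 𝓘(ℝ, V) G)
      (M := GroupLieAlgebra 𝓘(ℝ, V) G) v w)
    (fun x y z => add_lie (L := GroupLieAlgebra 𝓘(ℝ, V) G) (M := GroupLieAlgebra 𝓘(ℝ, V) G) x y z)
    (fun c x y => smul_lie (L := GroupLieAlgebra 𝓘(ℝ, V) G) (M := GroupLieAlgebra 𝓘(ℝ, V) G) c x y)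
    (fun x y z => lie_add (L := GroupLieAlgebra 𝓘(ℝ, V) G) (M := GroupLieAlgebra 𝓘(ℝ, V) G) x y z)
    (fun c x y => lie_smul (L := GroupLieAlgebra 𝓘(ℝ, V) G) (M := GroupLieAlgebra 𝓘(ℝ, V) G) c x y)

theorem lieBr_isLieBracket : IsLieBracket (lieBr V G) where
  skew x y := (lie_skew (L := GroupLieAlgebra 𝓘(ℝ, V) G) x y).symm
  jacobi x y z := lie_lie (L := GroupLieAlgebra 𝓘(ℝ, V) G) (M := GroupLieAlgebra 𝓘(ℝ, V) G) x y z

theorem mlieBracket_leftField (v w : V) :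
    VectorField.mlieBracket 𝓘(ℝ, V) (leftField v : VField V G) (leftField w)
      = leftField (lieBr V G v w) :=
  (mulInvariantVector_mlieBracket (I := 𝓘(ℝ, V)) (G := G) (v : V) (w : V)).symm

theorem dirDeriv_const (X : VField V G) (c : ℝ) (p : G) : dirDeriv X (fun _ => c) p = 0 := by
  rw [dirDeriv, mfderiv_const]; rfl

/-- The field `g` of bilinear forms is left-invariant with value `m` at the identity. -/
def IsLeft2 (g : Field2 V G) (m : V →ₗ[ℝ] V →ₗ[ℝ] ℝ) : Prop :=
  ∀ p v w, g p (transT p v) (transT p w) = m v w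

/-- The field `H` of trilinear forms is left-invariant with value `T` at the identity. -/
def IsLeft3 (H : Field3 V G) (T : V →ₗ[ℝ] V →ₗ[ℝ] V →ₗ[ℝ] ℝ) : Prop :=
  ∀ p u v w, H p (transT p u) (transT p v) (transT p w) = T u v w

variable {g : Field2 V G} {H : Field3 V G} {m : V →ₗ[ℝ] V →ₗ[ℝ] ℝ}
  {T : V →ₗ[ℝ] V →ₗ[ℝ] V →ₗ[ℝ] ℝ}

local notation "bas" => Module.finBasis ℝ V

theorem IsLeft2.ginv (hg : IsLeft2 g m) (p : G) : ginv g p = gramInv bas m := by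
  unfold GenRicci.ginv gramInv
  congr 1
  ext i j
  exact hg p _ _

theorem IsLeft2.sharp (hg : IsLeft2 g m) (p : G) (ξ : TangentSpace 𝓘(ℝ, V) p → ℝ) :
    sharp g p ξ = transT p (raise bas m fun v => ξ (transT p v)) := by
  unfold GenRicci.sharp raise
  rw [hg.ginv]
  simp only [map_sum, map_smul]
  rfl

/-- Left-invariant tensors have constant components on left-invariant fields, so every directional
derivative in the Koszul formula vanishes and only brackets remain. -/
theorem IsLeft2.nabla (hg : IsLeft2 g m) (x y : V) :
    nabla g (leftField x) (leftField y) = leftField (lieNabla bas (lieBr V G) m x y) := by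
  funext p
  unfold GenRicci.nabla
  have hk : ∀ i, koszul g (leftField x) (leftField y) (frame i) p
      = lieKoszul (lieBr V G) m x y (bas i) := by
    intro i
    have hf : frame i = (leftField (bas i) : VField V G) := rfl
    unfold koszul
    rw [hf, mlieBracket_leftField, mlieBracket_leftField, mlieBracket_leftField]
    simp only [leftField, hg _ _ _]
    rw [dirDeriv_const, dirDeriv_const, dirDeriv_const, lieKoszul]
    ring
  simp only [hk, hg.ginv]
  change _ = transT p (raise _ _ _)
  unfold raise
  simp only [map_sum, map_smul]
  rfl

theorem IsLeft2.curvature (hg : IsLeft2 g m) (x y z : V) :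
    curvature g (leftField x) (leftField y) (leftField z)
      = leftField (lieCurv bas (lieBr V G) m x y z) := by
  unfold GenRicci.curvature
  rw [mlieBracket_leftField]
  simp only [hg.nabla]
  funext p
  change transT p _ - transT p _ - transT p _ = transT p _
  rw [← map_sub, ← map_sub]
  rfl

theorem IsLeft2.ricci (hg : IsLeft2 g m) (p : G) (y z : V) :
    ricci g p (transT p y) (transT p z) = lieRic bas (lieBr V G) m y z := by
  unfold GenRicci.ricci lieRic contr
  rw [leftExt_transT, leftExt_transT, hg.ginv]
  refine Finset.sum_congr rfl fun i _ => Finset.sum_congr rfl fun j _ => ?_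
  have hf : frame i = (leftField (bas i) : VField V G) := rfl
  rw [hf, hg.curvature]
  congr 1
  exact hg p _ _

theorem IsLeft2.scal (hg : IsLeft2 g m) (p : G) : scal g p = lieScal bas (lieBr V G) m := by
  unfold GenRicci.scal lieScal contr
  rw [hg.ginv]
  refine Finset.sum_congr rfl fun i _ => Finset.sum_congr rfl fun j _ => ?_
  congr 1
  exact hg.ricci p _ _

theorem IsLeft2.square3 (hg : IsLeft2 g m) (hH : IsLeft3 H T) (p : G) (y z : V) :
    square3 g H p (transT p y) (transT p z) = triSquare bas m T y z := by
  unfold GenRicci.square3 triSquare contr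
  rw [hg.ginv]
  refine Finset.sum_congr rfl fun i _ => ?_
  rw [Finset.sum_comm]
  refine Finset.sum_congr rfl fun i' _ => ?_
  simp only [Finset.mul_sum]
  refine Finset.sum_congr rfl fun j _ => Finset.sum_congr rfl fun j' _ => ?_
  have h1 : ∀ x i j, H p (transT p x) (frame i p) (frame j p) = T x (bas i) (bas j) :=
    fun x i j => hH p _ _ _
  rw [h1, h1]; ring

theorem IsLeft2.normSq3 (hg : IsLeft2 g m) (hH : IsLeft3 H T) (p : G) :
    normSq3 g H p = triNormSq bas m T := by
  unfold GenRicci.normSq3 triNormSq contr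
  rw [hg.ginv]
  have h1 : ∀ i j k, H p (frame i p) (frame j p) (frame k p) = T (bas i) (bas j) (bas k) :=
    fun i j k => hH p _ _ _
  simp only [h1, Finset.mul_sum]
  refine Finset.sum_congr rfl fun i _ => ?_
  rw [Finset.sum_congr rfl fun j _ => Finset.sum_comm, Finset.sum_comm]
  refine Finset.sum_congr rfl fun i' _ => Finset.sum_congr rfl fun j _ => ?_
  rw [Finset.sum_comm]
  refine Finset.sum_congr rfl fun j' _ => Finset.sum_congr rfl fun k _ =>
    Finset.sum_congr rfl fun k' _ => ?_
  ring

theorem IsLeft2.codiff (hg : IsLeft2 g m) (hH : IsLeft3 H T) (p : G) (y z : V) :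
    codiff g H p (transT p y) (transT p z) = lieCodiff bas (lieBr V G) m T y z := by
  unfold GenRicci.codiff lieCodiff contr
  rw [leftExt_transT, leftExt_transT, hg.ginv]
  congr 1
  refine Finset.sum_congr rfl fun i _ => Finset.sum_congr rfl fun j _ => ?_
  have hf : ∀ i, frame i = (leftField (bas i) : VField V G) := fun i => rfl
  unfold nabla3 lieNabla3
  rw [hf, hf, hg.nabla, hg.nabla, hg.nabla]
  simp only [leftField, hH _ _ _ _]
  rw [dirDeriv_const, zero_sub]

theorem IsLeft2.ricciB (hg : IsLeft2 g m) (hH : IsLeft3 H T) (p : G) (y z : V) :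
    ricciB g H p (transT p y) (transT p z) = lieRicB bas (lieBr V G) m T y z := by
  unfold GenRicci.ricciB lieRicB
  rw [hg.ricci, hg.square3 hH]

theorem IsLeft2.genScalar (hg : IsLeft2 g m) (hH : IsLeft3 H T) (p : G) :
    genScalar g H p = lieGenScalar bas (lieBr V G) m T := by
  unfold GenRicci.genScalar lieGenScalar
  rw [hg.scal, hg.normSq3 hH]

end LieGeometry

/-! ### Trivializing the algebroid by the lifted action. -/

section Transport

variable {V : Type*} [NormedAddCommGroup V] [NormedSpace ℝ V]
  {G : Type*} [TopologicalSpace G] [ChartedSpace V G] [Group G] [LieGroup 𝓘(ℝ, V) ∞ G]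
  {F : Type*} [NormedAddCommGroup F] [NormedSpace ℝ F]
  {E : G → Type*} [TopologicalSpace (TotalSpace F E)] [∀ p, AddCommGroup (E p)]
  [∀ p, Module ℝ (E p)] [∀ p, TopologicalSpace (E p)] [FiberBundle F E] [VectorBundle ℝ F E]
  {A : ExactCourantAlgebroid V G F E}

/-- A linear functional separating the images in a chart, cut off by a bump function. It is used to
recognize a tangent vector by its action on functions. -/
theorem exists_contMDiff_mfderiv_ne [FiniteDimensional ℝ V] [T2Space G]
    {c : G} {x y : TangentSpace 𝓘(ℝ, V) c} (hxy : x ≠ y) :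
    ∃ f : G → ℝ, ContMDiff 𝓘(ℝ, V) 𝓘(ℝ, ℝ) ∞ f ∧
      (mfderiv 𝓘(ℝ, V) 𝓘(ℝ, ℝ) f c x : ℝ) ≠ mfderiv 𝓘(ℝ, V) 𝓘(ℝ, ℝ) f c y := by
  obtain ⟨M, hM⟩ := isInvertible_mfderiv_extChartAt (I := 𝓘(ℝ, V))
    (mem_extChartAt_source (I := 𝓘(ℝ, V)) c)
  have hne : (mfderiv 𝓘(ℝ, V) 𝓘(ℝ, V) (extChartAt 𝓘(ℝ, V) c) c x : V)
      ≠ mfderiv 𝓘(ℝ, V) 𝓘(ℝ, V) (extChartAt 𝓘(ℝ, V) c) c y := by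
    rw [← hM]
    exact fun h => hxy (M.injective h)
  obtain ⟨ℓ, hℓ⟩ := SeparatingDual.exists_separating_of_ne (R := ℝ) (V := V) hne
  obtain ⟨b⟩ : Nonempty (SmoothBumpFunction 𝓘(ℝ, V) c) := inferInstance
  refine ⟨fun q => b q • ℓ (extChartAt 𝓘(ℝ, V) c q), b.contMDiff_smul ?_, ?_⟩
  · exact ℓ.contDiff.contMDiff.comp_contMDiffOn (contMDiffOn_extChartAt (n := ∞))
  · have h1 : (fun q => b q • ℓ (extChartAt 𝓘(ℝ, V) c q))
        =ᶠ[𝓝 c] ℓ ∘ extChartAt 𝓘(ℝ, V) c := by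
      filter_upwards [b.eventuallyEq_one] with q hq
      simp [hq]
    rw [h1.mfderiv_eq, mfderiv_comp c ℓ.differentiableAt.mdifferentiableAt
      (mdifferentiableAt_extChartAt (mem_chart_source V c)), ℓ.mfderiv_eq]
    exact hℓ

/-- Passing to the total space absorbs the transport along `p * 1 = p`. -/
theorem mk_cast {p q r : G} (h : q = p) (φ : E r →ₗ[ℝ] E q) (e : E r) :
    TotalSpace.mk' F p ((h ▸ φ : E r →ₗ[ℝ] E p) e) = TotalSpace.mk' F q (φ e) := by
  subst h; rfl

/-- The anchor at the identity. -/
def ExactCourantAlgebroid.anchorOne (A : ExactCourantAlgebroid V G F E) : E 1 →ₗ[ℝ] V := A.anchor 1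

namespace LiftedAction

variable (L : LiftedAction A)

/-- The lifted action on the total space. -/
def act (a : G) (z : TotalSpace F E) : TotalSpace F E :=
  TotalSpace.mk' F (a * z.proj) (L.lift a z.proj z.snd)

theorem act_one (z : TotalSpace F E) : L.act 1 z = z := L.lift_one z.proj z.snd

theorem act_mul (a b : G) (z : TotalSpace F E) : L.act (a * b) z = L.act a (L.act b z) :=
  L.lift_mul a b z.proj z.snd

theorem act_mk (a p : G) (e : E p) :
    L.act a (TotalSpace.mk' F p e) = TotalSpace.mk' F (a * p) (L.lift a p e) := rfl

/-- The lifted action as a map from the fibre at the identity. -/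
def transLin (p : G) : E 1 →ₗ[ℝ] E p := (mul_one p) ▸ L.lift p 1

theorem mk_transLin (p : G) (e : E 1) :
    TotalSpace.mk' F p (L.transLin p e) = L.act p (TotalSpace.mk' F 1 e) := by
  rw [transLin, mk_cast]; rfl

theorem lift_transLin (a p : G) (e : E 1) :
    L.lift a p (L.transLin p e) = L.transLin (a * p) e := by
  have : TotalSpace.mk' F (a * p) (L.lift a p (L.transLin p e))
      = TotalSpace.mk' F (a * p) (L.transLin (a * p) e) := by
    rw [← act_mk, mk_transLin, mk_transLin, act_mul]
  exact TotalSpace.mk_inj.1 this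

theorem transLin_one (e : E 1) : L.transLin 1 e = e := by
  have : TotalSpace.mk' F 1 (L.transLin 1 e) = TotalSpace.mk' F 1 e := by
    rw [mk_transLin, act_one]
  exact TotalSpace.mk_inj.1 this

theorem lift_one_fiber (p : G) (e : E 1) : L.lift p 1 e = L.transLin (p * 1) e := by
  conv_lhs => rw [← L.transLin_one e]
  exact L.lift_transLin p 1 e

theorem transLin_bijective (p : G) : Function.Bijective (L.transLin p) := by
  refine ⟨fun e f hef => ?_, fun f => ?_⟩
  · have h1 : L.act p (TotalSpace.mk' F 1 e) = L.act p (TotalSpace.mk' F 1 f) := by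
      rw [← mk_transLin, ← mk_transLin, hef]
    have h2 := congrArg (L.act p⁻¹) h1
    rw [← act_mul, ← act_mul, inv_mul_cancel, act_one, act_one] at h2
    exact TotalSpace.mk_inj.1 h2
  · obtain ⟨e, he⟩ : ∃ e : E 1, L.act p⁻¹ (TotalSpace.mk' F p f) = TotalSpace.mk' F 1 e := by
      have : ∀ z : TotalSpace F E, z.proj = 1 → ∃ e : E 1, z = TotalSpace.mk' F 1 e := by
        rintro ⟨q, e⟩ rfl
        exact ⟨e, rfl⟩
      exact this _ (inv_mul_cancel p)
    have h1 : TotalSpace.mk' F p (L.transLin p e) = TotalSpace.mk' F p f := by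
      rw [mk_transLin, ← he, ← act_mul, mul_inv_cancel, act_one]
    exact ⟨e, TotalSpace.mk_inj.1 h1⟩

/-- The identification of the fibres given by the lifted action. -/
def trans (p : G) : E 1 ≃ₗ[ℝ] E p := LinearEquiv.ofBijective (L.transLin p) (L.transLin_bijective p)

theorem lift_trans (a p : G) (e : E 1) : L.lift a p (L.trans p e) = L.trans (a * p) e :=
  L.lift_transLin a p e

theorem trans_one (e : E 1) : L.trans 1 e = e := L.transLin_one e

theorem lift_eq (p : G) (e : E 1) : L.lift p 1 e = L.trans (p * 1) e := L.lift_one_fiber p e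

theorem pairing_trans (p : G) (e f : E 1) :
    A.pairing p (L.trans p e) (L.trans p f) = A.pairing 1 e f := by
  have := L.lift_pairing p 1 e f
  rw [lift_eq, lift_eq, mul_one] at this
  exact this

theorem contMDiff_trans (e : E 1) : ContMDiff 𝓘(ℝ, V) (𝓘(ℝ, V).prod 𝓘(ℝ, F)) ∞
    fun p => TotalSpace.mk' F p (L.trans p e) := by
  have h : (fun p => TotalSpace.mk' F p (L.trans p e))
      = fun p => L.act p (TotalSpace.mk' F 1 e) := by
    funext p; exact L.mk_transLin p e
  rw [h]
  exact L.smooth.comp (contMDiff_id.prodMk contMDiff_const)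

/-- The left-invariant section with a given value at the identity. -/
def leftSec : E 1 →ₗ[ℝ] ContMDiffSection 𝓘(ℝ, V) F ∞ E where
  toFun e := ⟨fun p => L.trans p e, L.contMDiff_trans e⟩
  map_add' e f := by ext p; exact map_add (L.trans p) e f
  map_smul' c e := by ext p; exact map_smul (L.trans p) c e

theorem leftSec_apply (e : E 1) (p : G) : L.leftSec e p = L.trans p e := rfl

/-- The bracket of left-invariant sections. -/
def fiberBr : E 1 →ₗ[ℝ] E 1 →ₗ[ℝ] E 1 :=
  LinearMap.mk₂ ℝ (fun a b => A.bracket (L.leftSec a) (L.leftSec b) 1)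
    (fun _ _ _ => by simp) (fun _ _ _ => by simp) (fun _ _ _ => by simp) (fun _ _ _ => by simp)

theorem bracket_leftSec (a b : E 1) :
    A.bracket (L.leftSec a) (L.leftSec b) = L.leftSec (L.fiberBr a b) := by
  ext p
  have := L.lift_bracket p (L.leftSec a) (L.leftSec b) (L.leftSec a) (L.leftSec b)
    (fun q => (L.lift_trans p q a).symm) (fun q => (L.lift_trans p q b).symm) 1
  rw [lift_eq, mul_one] at this
  exact this


theorem dirDeriv_comp_mul {f : G → ℝ} (hf : ContMDiff 𝓘(ℝ, V) 𝓘(ℝ, ℝ) ∞ f) (q : G)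
    (x : TangentSpace 𝓘(ℝ, V) q) :
    (mfderiv 𝓘(ℝ, V) 𝓘(ℝ, ℝ) (fun p => f (q⁻¹ * p)) q x : ℝ)
      = mfderiv 𝓘(ℝ, V) 𝓘(ℝ, ℝ) f 1 ((transT q).symm x : V) := by
  have h1 : mfderiv 𝓘(ℝ, V) 𝓘(ℝ, ℝ) (f ∘ fun p => q⁻¹ * p) q
      = (mfderiv 𝓘(ℝ, V) 𝓘(ℝ, ℝ) f (q⁻¹ * q)).comp
        (mfderiv 𝓘(ℝ, V) 𝓘(ℝ, V) (fun p : G => q⁻¹ * p) q) :=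
    mfderiv_comp q (hf.contMDiffAt.mdifferentiableAt (by simp))
      ((contMDiff_mul_left (I := 𝓘(ℝ, V)) (n := ∞)).contMDiffAt.mdifferentiableAt (by simp))
  have h2 := DFunLike.congr_fun h1 x
  rw [inv_mul_cancel] at h2
  exact h2

variable [ContMDiffVectorBundle ∞ F E 𝓘(ℝ, V)]

/-- Equivariance of the anchor is not an axiom of a lifted action; it follows from preservation of
the bracket. Apply the Leibniz rule to `f • a` and to its left translate: comparing the coefficients
of `a` shows that both tangent vectors act alike on every smooth function, and smooth functions
separate them. -/
theorem anchor_trans [FiniteDimensional ℝ V] [T2Space G] (q : G) (e : E 1) :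
    A.anchor q (L.trans q e) = transT q (A.anchorOne e) := by
  -- Comparing coefficients requires a nonzero section.
  rcases subsingleton_or_nontrivial (E 1) with hE | hE
  · have : e = 0 := Subsingleton.elim _ _
    rw [this, map_zero, map_zero, map_zero, map_zero]
  obtain ⟨a, ha⟩ := exists_ne (0 : E 1)
  refine ((LinearEquiv.symm_apply_eq (transT q)).1 ?_)
  by_contra hne
  obtain ⟨f, hf, hd⟩ := exists_contMDiff_mfderiv_ne (G := G) (c := 1)
    (x := ((transT q).symm (A.anchor q (L.trans q e)) : V)) (y := A.anchorOne e) hne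
  apply hd
  have hf' : ContMDiff 𝓘(ℝ, V) 𝓘(ℝ, ℝ) ∞ fun p => f (q⁻¹ * p) :=
    hf.comp (contMDiff_mul_left (I := 𝓘(ℝ, V)) (n := ∞))
  let c : ContMDiffSection 𝓘(ℝ, V) F ∞ E := ⟨fun p => f p • L.leftSec a p,
    hf.smul_section (L.leftSec a).contMDiff⟩
  let c' : ContMDiffSection 𝓘(ℝ, V) F ∞ E := ⟨fun p => f (q⁻¹ * p) • L.leftSec a p,
    hf'.smul_section (L.leftSec a).contMDiff⟩
  have h1 := A.leibniz (L.leftSec e) (L.leftSec a) c f hf (fun p => rfl) 1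
  have h2 := A.leibniz (L.leftSec e) (L.leftSec a) c' _ hf' (fun p => rfl) q
  have h3 := L.lift_bracket q (L.leftSec e) c (L.leftSec e) c'
    (fun p => (L.lift_trans q p e).symm) (fun p => by
      change f (q⁻¹ * (q * p)) • L.trans (q * p) a = L.lift q p (f p • L.trans p a)
      rw [inv_mul_cancel_left, map_smul, lift_trans]) 1
  rw [lift_eq, mul_one, h2, h1, bracket_leftSec, inv_mul_cancel] at h3
  simp only [leftSec_apply, trans_one, map_add, map_smul] at h3
  have h4 := add_left_cancel h3
  have ha' : L.trans q a ≠ 0 := by simpa using ha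
  have h5 := smul_left_injective ℝ ha' h4
  rw [← dirDeriv_comp_mul hf]
  have h6 : A.anchor 1 (L.trans 1 e) = A.anchor 1 e := congrArg (A.anchor 1) (L.trans_one e)
  exact h5.trans (congrArg (mfderiv 𝓘(ℝ, V) 𝓘(ℝ, ℝ) f 1) h6)

end LiftedAction

end Transport

/-! ### The `+1`-eigenspace as a graph. -/

section EigenSplitting

variable {V : Type*} [AddCommGroup V] [Module ℝ V] {K : Type*} [AddCommGroup K] [Module ℝ K]
  {pr : K →ₗ[ℝ] K →ₗ[ℝ] ℝ} {an : K →ₗ[ℝ] V} {sec : V →ₗ[ℝ] K} {C : (V →ₗ[ℝ] ℝ) →ₗ[ℝ] K}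

theorem FiberModel.eq_twistSec (h : FiberModel pr an sec C) {ι : Type*} [Fintype ι]
    [DecidableEq ι] (e : Module.Basis ι ℝ V) {m : V →ₗ[ℝ] V →ₗ[ℝ] ℝ} (hm : IsInner (symPart m)) {a : K}
    (ha : kEnd e pr an sec C m a = a) : a = twistSec sec C m (an a) := by
  obtain ⟨v, w, rfl⟩ := h.decomp_twist e hm a
  rw [h.kEnd_twist e hm] at ha
  have h1 := congrArg an ha
  have ht := h.twist _ (skewPart_skew m)
  simp only [map_add, map_smul, ht.anchor_sec, ht.anchor_coanchor, smul_zero, add_zero] at h1 ⊢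
  subst h1
  conv_rhs => rw [← symPart_add_skewPart m]
  simp only [twistSec_apply, LinearMap.add_apply, map_add, smul_add]; abel

theorem FiberModel.pr_twistSec (h : FiberModel pr an sec C) (m : V →ₗ[ℝ] V →ₗ[ℝ] ℝ) (x y : V) :
    pr (twistSec sec C m x) (twistSec sec C m y) = symPart m x y := by
  simp only [twistSec_apply, map_add, map_smul, LinearMap.add_apply, LinearMap.smul_apply,
    h.isotropic, h.coanchor, h.sec_coanchor, h.anchor_sec, h.anchor_coanchor, map_zero, smul_eq_mul]
  rw [symPart_apply]; ring

theorem twistSec_sub (m : V →ₗ[ℝ] V →ₗ[ℝ] ℝ) (x : V) :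
    twistSec sec C m x - (1 / 2 : ℝ) • C (symPart m x) = twistSec sec C (skewPart m) x := by
  have : m x = symPart m x + skewPart m x :=
    (DFunLike.congr_fun (symPart_add_skewPart m) x).symm
  rw [twistSec_apply, twistSec_apply, this, map_add, smul_add]; abel

end EigenSplitting

/-! ### Existence of splittings and of the form `m`. -/

section ExistsModel

variable {V : Type*} [AddCommGroup V] [Module ℝ V] [FiniteDimensional ℝ V]
  {K : Type*} [AddCommGroup K] [Module ℝ K] [FiniteDimensional ℝ K]
  {pr : K →ₗ[ℝ] K →ₗ[ℝ] ℝ}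

theorem exists_repr_functional (hnd : ∀ a, (∀ b, pr a b = 0) → a = 0) (ℓ : K →ₗ[ℝ] ℝ) :
    ∃ a, ∀ b, pr a b = ℓ b := by
  have hinj : Function.Injective pr := (injective_iff_map_eq_zero pr).2 fun a ha =>
    hnd a fun b => by rw [ha]; rfl
  obtain ⟨a, ha⟩ := (LinearMap.injective_iff_surjective_of_finrank_eq_finrank
    (Subspace.dual_finrank_eq (K := ℝ) (V := K)).symm).1 hinj ℓ
  exact ⟨a, fun b => by rw [ha]⟩

theorem exists_fiberModel (hs : ∀ a b, pr a b = pr b a) (hnd : ∀ a, (∀ b, pr a b = 0) → a = 0)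
    {an : K →ₗ[ℝ] V} (hsurj : Function.Surjective an)
    (hex : ∀ a, an a = 0 ↔ ∃ ξ : V →ₗ[ℝ] ℝ, ∀ b, pr a b = ξ (an b)) :
    ∃ sec C, FiberModel pr an sec C := by
  have hC : ∀ ξ : V →ₗ[ℝ] ℝ, ∃ a, ∀ b, pr a b = ξ (an b) := fun ξ =>
    exists_repr_functional hnd (ξ.comp an)
  choose c hc using hC
  have huniq : ∀ {a a'}, (∀ b, pr a b = pr a' b) → a = a' := fun {a a'} h => by
    rw [← sub_eq_zero]
    exact hnd _ fun b => by rw [map_sub, LinearMap.sub_apply, h, sub_self]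
  let C : (V →ₗ[ℝ] ℝ) →ₗ[ℝ] K :=
    { toFun := c
      map_add' := fun ξ η => huniq fun b => by simp [hc]
      map_smul' := fun r ξ => huniq fun b => by simp [hc] }
  have hCa : ∀ ξ a, pr (C ξ) a = ξ (an a) := hc
  have hanC : ∀ ξ, an (C ξ) = 0 := fun ξ => (hex _).2 ⟨ξ, hCa ξ⟩
  obtain ⟨s, hs'⟩ := an.exists_rightInverse_of_surjective (LinearMap.range_eq_top.2 hsurj)
  have hss : ∀ x, an (s x) = x := fun x => DFunLike.congr_fun hs' x
  -- Any right inverse `s` of the anchor becomes isotropic after subtracting half the coanchor of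
  -- its own pairing.
  refine ⟨s - (1 / 2 : ℝ) • C.comp (pr.compl₁₂ s s), C, hs, hnd, hCa, fun x => ?_, hanC,
    fun x y => ?_, fun a ha => ?_⟩
  · simp [hss, hanC]
  · have hCr : ∀ a ξ, pr a (C ξ) = ξ (an a) := fun a ξ => by rw [hs, hCa]
    simp only [LinearMap.sub_apply, LinearMap.smul_apply, LinearMap.comp_apply, map_sub, map_smul,
      hCa, hCr, hss, hanC, LinearMap.compl₁₂_apply, map_zero, smul_eq_mul]
    rw [hs (s y)]; ring
  · obtain ⟨ξ, hξ⟩ := (hex a).1 ha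
    exact ⟨ξ, huniq fun b => by rw [hξ, hCa]⟩

variable {ι : Type*} [Fintype ι] [DecidableEq ι] {an : K →ₗ[ℝ] V} {sec : V →ₗ[ℝ] K}
  {C : (V →ₗ[ℝ] ℝ) →ₗ[ℝ] K}

/-- Every generalized metric on a fibre is given by a bilinear form `m = g + b`. -/
theorem FiberModel.exists_eq_kEnd (h : FiberModel pr an sec C) (e : Module.Basis ι ℝ V)
    {S : K →ₗ[ℝ] K} (ho : ∀ a b, pr (S a) (S b) = pr a b)
    (hp : ∀ a, a ≠ 0 → 0 < pr (S a) a) (hs : ∀ a b, pr (S a) b = pr (S b) a) :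
    ∃ m : V →ₗ[ℝ] V →ₗ[ℝ] ℝ, IsInner (symPart m) ∧ S = kEnd e pr an sec C m := by
  have hSS : ∀ a, S (S a) = a := fun a => by
    rw [← sub_eq_zero]
    refine h.nondeg _ fun b => ?_
    rw [map_sub, LinearMap.sub_apply, hs, ho, h.symm, sub_self]
  -- `P` is injective because the coanchor image is isotropic while `⟨S ·, ·⟩` is definite; by
  -- dimension it is invertible. Symmetrizing `C` under `S` then yields a section `τ` with values in
  -- the `+1`-eigenspace, whose covector part is `m`.
  let P : (V →ₗ[ℝ] ℝ) →ₗ[ℝ] V := an.comp (S.comp C)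
  have hP : Function.Injective P := (injective_iff_map_eq_zero P).2 fun ξ hξ => by
    obtain ⟨η, hη⟩ := h.exact (S (C ξ)) hξ
    have h0 : C ξ = 0 := by
      by_contra hne
      have := hp _ hne
      rw [hη, h.coanchor, h.anchor_coanchor, map_zero] at this
      exact lt_irrefl _ this
    exact h.coanchor_injective (by rw [h0, map_zero])
  let Pe : (V →ₗ[ℝ] ℝ) ≃ₗ[ℝ] V := LinearEquiv.ofBijective P
    ⟨hP, (LinearMap.injective_iff_surjective_of_finrank_eq_finrank
      (Subspace.dual_finrank_eq (K := ℝ) (V := V))).1 hP⟩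
  let τ : V →ₗ[ℝ] K := (S.comp C + C).comp Pe.symm.toLinearMap
  have hτS : ∀ x, S (τ x) = τ x := fun x => by
    simp only [τ, LinearMap.comp_apply, LinearMap.add_apply, map_add, hSS]
    abel
  have hτa : ∀ x, an (τ x) = x := fun x => by
    have : an (τ x) = Pe (Pe.symm x) := by
      simp only [τ, LinearMap.comp_apply, LinearMap.add_apply, map_add, h.anchor_coanchor, add_zero]
      rfl
    rw [this, LinearEquiv.apply_symm_apply]
  let m : V →ₗ[ℝ] V →ₗ[ℝ] ℝ := (2 : ℝ) • pr.compl₁₂ τ sec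
  have hmτ : ∀ x, m x = covec pr sec (τ x) := fun x => by
    ext y; simp [m, covec_apply]
  have htw : ∀ x, twistSec sec C m x = τ x := fun x => by
    conv_rhs => rw [h.decomp (τ x)]
    rw [twistSec_apply, hmτ, hτa]
  have hm : IsInner (symPart m) := isInner_symPart.2 fun x hx => by
    have h1 : pr (τ x) (τ x) = m x x := by
      rw [← htw, twistSec_apply]
      simp only [map_add, map_smul, LinearMap.add_apply, LinearMap.smul_apply, h.isotropic,
        h.coanchor, h.sec_coanchor, h.anchor_sec, h.anchor_coanchor, map_zero, smul_eq_mul]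
      ring
    rw [← h1]
    have hne : τ x ≠ 0 := fun h0 => hx (by rw [← hτa x, h0, map_zero])
    have := hp _ hne
    rwa [hτS] at this
  exact ⟨m, hm, h.eq_kEnd e hm ho hp hs fun x => by rw [htw, hτS]⟩

end ExistsModel

/-! ### Geometry of a left-invariant generalized metric in terms of `m`. -/

section LeftInvariant

variable {V : Type*} [NormedAddCommGroup V] [NormedSpace ℝ V] [FiniteDimensional ℝ V]
  {G : Type*} [TopologicalSpace G] [T2Space G] [ChartedSpace V G] [Group G] [LieGroup 𝓘(ℝ, V) ∞ G]
  {F : Type*} [NormedAddCommGroup F] [NormedSpace ℝ F]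
  {E : G → Type*} [TopologicalSpace (TotalSpace F E)] [∀ p, AddCommGroup (E p)]
  [∀ p, Module ℝ (E p)] [∀ p, TopologicalSpace (E p)] [FiberBundle F E] [VectorBundle ℝ F E]
  [ContMDiffVectorBundle ∞ F E 𝓘(ℝ, V)]
  {A : ExactCourantAlgebroid V G F E}

theorem finiteDimensional_fiber (F : Type*) [NormedAddCommGroup F] [NormedSpace ℝ F]
    [FiniteDimensional ℝ F] {E : G → Type*} [TopologicalSpace (TotalSpace F E)]
    [∀ p, AddCommGroup (E p)] [∀ p, Module ℝ (E p)] [∀ p, TopologicalSpace (E p)]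
    [FiberBundle F E] [VectorBundle ℝ F E] (p : G) : FiniteDimensional ℝ (E p) :=
  ((trivializationAt F E p).linearEquivAt ℝ p
    (FiberBundle.mem_baseSet_trivializationAt F E p)).symm.finiteDimensional

namespace LiftedAction

variable (L : LiftedAction A)

/-- The pairing of left-invariant sections is constant. Its differential vanishes, which makes the
bracket skew and the pairing invariant. -/
theorem isFiberBracket : IsFiberBracket (A.pairing 1) A.anchorOne (lieBr V G) L.fiberBr where
  anchor a b := by
    have h1 := A.anchor_bracket (L.leftSec a) (L.leftSec b) 1
    have h2 : ∀ a, (fun q => A.anchor q (L.leftSec a q)) = leftField (A.anchorOne a) := fun a => by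
      funext q; exact L.anchor_trans q a
    rw [h2, h2, mlieBracket_leftField] at h1
    exact h1.trans (transT_one _)
  skew a b := by
    rw [← sub_eq_zero, sub_neg_eq_add]
    refine A.pairing_nondegenerate 1 _ fun c => ?_
    have h1 := A.symmetric_part (L.leftSec a) (L.leftSec b) 1 c
    have h2 : (fun q => A.pairing q (L.leftSec a q) (L.leftSec b q)) = fun _ => A.pairing 1 a b := by
      funext q; exact L.pairing_trans q a b
    rw [h2, mfderiv_const] at h1
    exact h1
  invariant a b c := by
    have h1 := A.invariance (L.leftSec a) (L.leftSec b) (L.leftSec c) 1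
    have h2 : (fun q => A.pairing q (L.leftSec b q) (L.leftSec c q)) = fun _ => A.pairing 1 b c := by
      funext q; exact L.pairing_trans q b c
    rw [h2, dirDeriv_const, bracket_leftSec, bracket_leftSec] at h1
    simp only [leftSec_apply, trans_one] at h1
    linarith
  jacobi a b c := by
    have h1 := DFunLike.congr_fun (A.jacobi (L.leftSec a) (L.leftSec b) (L.leftSec c)) 1
    simpa only [bracket_leftSec, ContMDiffSection.coe_add, Pi.add_apply, leftSec_apply,
      trans_one] using h1

variable {sec : V →ₗ[ℝ] E 1} {C : (V →ₗ[ℝ] ℝ) →ₗ[ℝ] E 1}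
  (h : FiberModel (A.pairing 1) A.anchorOne sec C)
include h

/-- Nondegeneracy of the pairing makes the element chosen by `Classical.epsilon` unique. -/
theorem coanchor_eq {p : G} {ξ : TangentSpace 𝓘(ℝ, V) p → ℝ} {η : V →ₗ[ℝ] ℝ}
    (hξ : ∀ v, ξ (transT p v) = η v) : A.coanchor p ξ = L.trans p (C η) := by
  have h1 : ∀ f, A.pairing p (L.trans p (C η)) f = ξ (A.anchor p f) := fun f => by
    obtain ⟨e, rfl⟩ := (L.trans p).surjective f
    rw [pairing_trans, anchor_trans, hξ, h.coanchor]
  have h2 := Classical.epsilon_spec (p := fun e => ∀ f, A.pairing p e f = ξ (A.anchor p f)) ⟨_, h1⟩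
  rw [← sub_eq_zero]
  refine A.pairing_nondegenerate p _ fun f => ?_
  rw [map_sub, LinearMap.sub_apply, h1]
  exact sub_eq_zero.2 (h2 f)

local notation "bas" => Module.finBasis ℝ V

omit h in
/-- `𝒢` is the left-invariant generalized metric given by the bilinear form `m`. -/
def Represents (𝒢 : GeneralizedMetric A) (sec : V →ₗ[ℝ] E 1) (C : (V →ₗ[ℝ] ℝ) →ₗ[ℝ] E 1)
    (m : V →ₗ[ℝ] V →ₗ[ℝ] ℝ) : Prop :=
  IsInner (symPart m) ∧ ∀ p e, 𝒢.toEnd p (L.trans p e)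
    = L.trans p (kEnd bas (A.pairing 1) A.anchorOne sec C m e)

theorem exists_represents [FiniteDimensional ℝ F] {𝒢 : GeneralizedMetric A}
    (h𝒢 : IsLeftInvariant L 𝒢) : ∃ m, L.Represents 𝒢 sec C m := by
  have : FiniteDimensional ℝ (E 1) := finiteDimensional_fiber F 1
  obtain ⟨m, hm, hS⟩ := h.exists_eq_kEnd bas (𝒢.orthogonal 1) (𝒢.pos 1) (𝒢.symmetric 1)
  refine ⟨m, hm, fun p e => ?_⟩
  have h1 := h𝒢 p 1 e
  rw [lift_eq, lift_eq, mul_one, hS] at h1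
  exact h1.symm

variable {L} {𝒢 : GeneralizedMetric A} {m : V →ₗ[ℝ] V →ₗ[ℝ] ℝ} (hr : L.Represents 𝒢 sec C m)

omit h in
theorem Represents.isLeftInvariant (hr : L.Represents 𝒢 sec C m) : IsLeftInvariant L 𝒢 := by
  intro a p f
  obtain ⟨e, rfl⟩ := (L.trans p).surjective f
  rw [hr.2, lift_trans, lift_trans, hr.2]

include hr

/-- The twisted section satisfies the two defining conditions, and `eq_twistSec` shows that nothing
else does, so the `Classical.epsilon` choice is determined. -/
theorem Represents.sigmaPlus (p : G) (x : V) :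
    𝒢.sigmaPlus p (transT p x) = L.trans p (twistSec sec C m x) := by
  have h1 : 𝒢.toEnd p (L.trans p (twistSec sec C m x)) = L.trans p (twistSec sec C m x) ∧
      A.anchor p (L.trans p (twistSec sec C m x)) = transT p x := by
    rw [hr.2, h.kEnd_twistSec _ hr.1, anchor_trans, h.anchor_twistSec]
    exact ⟨rfl, rfl⟩
  have h2 := Classical.epsilon_spec
    (p := fun e => 𝒢.toEnd p e = e ∧ A.anchor p e = transT p x) ⟨_, h1⟩
  change Classical.epsilon _ = _
  generalize Classical.epsilon (fun e => 𝒢.toEnd p e = e ∧ A.anchor p e = transT p x) = f at h2 ⊢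
  obtain ⟨e, rfl⟩ := (L.trans p).surjective f
  rw [hr.2, anchor_trans] at h2
  have h3 := h.eq_twistSec _ hr.1 ((L.trans p).injective h2.1)
  rw [(transT p).injective h2.2] at h3
  rw [h3]

theorem Represents.metric : IsLeft2 𝒢.metric (symPart m) := fun p v w => by
  change A.pairing p (𝒢.sigmaPlus p _) (𝒢.sigmaPlus p _) = _
  rw [hr.sigmaPlus h, hr.sigmaPlus h, pairing_trans, h.pr_twistSec]

theorem Represents.splitting (p : G) (x : V) :
    𝒢.splitting p (transT p x) = L.trans p (twistSec sec C (skewPart m) x) := by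
  rw [GeneralizedMetric.splitting, hr.sigmaPlus h,
    L.coanchor_eq h (η := symPart m x) (fun v => hr.metric h p x v), ← map_smul, ← map_sub,
    twistSec_sub]

theorem Represents.torsion : IsLeft3 𝒢.torsion
    (flowH (lieBr V G) (torsionForm (A.pairing 1) sec L.fiberBr) m) := fun p u v w => by
  have h1 : ∀ x : V, (fun q => 𝒢.splitting q (leftExt p (transT p x) q))
      = L.leftSec (twistSec sec C (skewPart m) x) := fun x => by
    funext q
    rw [leftExt_transT]
    exact hr.splitting h q x
  rw [GeneralizedMetric.torsion, h1, h1, ExactCourantAlgebroid.bracketFun,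
    dif_pos ⟨L.contMDiff_trans _, L.contMDiff_trans _⟩, hr.splitting h]
  rw [← L.isFiberBracket.torsionForm_twistSec h, torsionForm_apply]
  congr 1
  have h2 := DFunLike.congr_fun (L.bracket_leftSec (twistSec sec C (skewPart m) u)
    (twistSec sec C (skewPart m) v)) p
  rw [← L.pairing_trans p]
  congr 2

theorem Represents.genScalarCurvature (p : G) : 𝒢.genScalarCurvature p
    = flowS bas (lieBr V G) (torsionForm (A.pairing 1) sec L.fiberBr) m :=
  (hr.metric h).genScalar (hr.torsion h) p

theorem Represents.genRicci {R D : V →ₗ[ℝ] V →ₗ[ℝ] ℝ}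
    (hR : ∀ x y, lieRicB bas (lieBr V G) (symPart m)
      (flowH (lieBr V G) (torsionForm (A.pairing 1) sec L.fiberBr) m) x y = R x y)
    (hD : ∀ x y, lieCodiff bas (lieBr V G) (symPart m)
      (flowH (lieBr V G) (torsionForm (A.pairing 1) sec L.fiberBr) m) x y = D x y) (p : G)
    (e : E 1) : 𝒢.genRicci p (L.trans p e)
      = L.trans p (rcEnd bas (A.pairing 1) A.anchorOne sec C m R D e) := by
  have hg := hr.metric h
  have hH := hr.torsion h
  have hu : GenRicci.sharp 𝒢.metric p (𝒢.covectorPart p (L.trans p e)) = transT p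
      (raiseL bas (symPart m) (covec (A.pairing 1) (twistSec sec C (skewPart m)) e)) := by
    rw [hg.sharp]
    congr 2
    funext v
    rw [GeneralizedMetric.covectorPart, hr.splitting h, pairing_trans]
    rfl
  simp only [GeneralizedMetric.genRicci]
  rw [hu, anchor_trans, rcEnd]
  set u := raiseL bas (symPart m) (covec (A.pairing 1) (twistSec sec C (skewPart m)) e)
  set x := A.anchorOne e
  have h1 : GenRicci.sharp 𝒢.metric p (ricciB 𝒢.metric 𝒢.torsion p (transT p x))
      = transT p (raiseL bas (symPart m) (R x)) := by
    rw [hg.sharp]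
    congr 2
    funext v
    rw [hg.ricciB hH, hR]
  have h2 : GenRicci.sharp 𝒢.metric p (codiff 𝒢.metric 𝒢.torsion p (transT p u))
      = transT p (raiseL bas (symPart m) (D u)) := by
    rw [hg.sharp]
    congr 2
    funext v
    rw [hg.codiff hH, hD]
  rw [h1, h2, ← map_smul, ← map_add, hr.splitting h,
    L.coanchor_eq h (η := -(1 / 2 : ℝ) • D x - R u)]
  · simp only [map_add, map_smul]
  intro v
  rw [hg.codiff hH, hg.ricciB hH, hD, hR]
  simp only [LinearMap.sub_apply, LinearMap.smul_apply, smul_eq_mul]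
  ring

end LiftedAction

end LeftInvariant

/-! ### The dichotomy at the end of the time interval. -/

section Extension

variable {ι : Type*} [Fintype ι] [DecidableEq ι] {V : Type*} [NormedAddCommGroup V]
  [NormedSpace ℝ V] [FiniteDimensional ℝ V]

/-- Either the scalar curvature tends to infinity at the end of the time interval or the solution
can be extended. -/
theorem tendsto_or_exists_extension {e : Module.Basis ι ℝ V} {br : V →ₗ[ℝ] V →ₗ[ℝ] V}
    {H₀ : V →ₗ[ℝ] V →ₗ[ℝ] V →ₗ[ℝ] ℝ} (hbr : IsLieBracket br) (hH : IsClosed3 br H₀) {σ : ℝ}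
    (hσ : σ = 1 ∨ σ = -1) {m : ℝ → V →ₗ[ℝ] V →ₗ[ℝ] ℝ} {a T : ℝ} (haT : a < T)
    (hpos : ∀ t ∈ Ioo a T, IsInner (symPart (m t)))
    (hm : ∀ t ∈ Ioo a T, ∀ x y,
      HasDerivAt (fun s => m s x y) (σ * flowX e br H₀ (m t) x y) t) :
    Tendsto (fun t => σ * flowS e br H₀ (m t)) (𝓝[<] T) atTop ∨
    ∃ δ > 0, ∃ k : ℝ → V →ₗ[ℝ] V →ₗ[ℝ] ℝ, (∀ t < T, k t = m t) ∧
      ∀ t ∈ Ioo a (T + δ), IsInner (symPart (k t)) ∧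
        ∀ x y, HasDerivAt (fun s => k s x y) (σ * flowX e br H₀ (k t) x y) t := by
  by_cases hb : ∃ M, ∀ t ∈ Ioo a T, σ * flowS e br H₀ (m t) ≤ M
  · obtain ⟨M, hM⟩ := hb
    exact Or.inr (exists_flow_extension hbr hH hσ haT hpos hm hM)
  · left
    push Not at hb
    -- Monotonicity upgrades unboundedness to divergence.
    have hmono : MonotoneOn (fun t => σ * flowS e br H₀ (m t)) (Ioo a T) := by
      have h1 : ∀ t ∈ Ioo a T, ∃ d, HasDerivAt (fun s => σ * flowS e br H₀ (m s)) d t ∧ 0 ≤ d := by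
        intro t ht
        obtain ⟨u, hu⟩ := (hpos t ht).exists_orthoBasis e
        exact ⟨_, hasDerivAt_flowS_sign hbr hH hσ
          (Filter.eventually_of_mem (isOpen_Ioo.mem_nhds ht) hpos) (hm t ht) hu, by positivity⟩
      choose! f' hf' using h1
      exact monotoneOn_Ioo_of_hasDerivAt_nonneg (fun t ht => (hf' t ht).1) fun t ht => (hf' t ht).2
    refine tendsto_atTop.2 fun M => ?_
    obtain ⟨t₀, ht₀, hlt⟩ := hb M
    filter_upwards [Ioo_mem_nhdsLT ht₀.2] with t ht
    exact hlt.le.trans (hmono ht₀ ⟨ht₀.1.trans ht.1, ht.2⟩ ht.1.le)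

theorem hasDerivAt_comp_neg {f : ℝ → ℝ} {f' t : ℝ} (h : HasDerivAt f f' (-t)) :
    HasDerivAt (fun s => f (-s)) (-f') t := by
  rw [← zero_sub] at h
  simpa only [zero_sub] using HasDerivAt.comp_const_sub 0 t h

end Extension

/-! ### Passing between generalized metrics and forms along the flow. -/

section FlowEquivalence

variable {V : Type*} [NormedAddCommGroup V] [NormedSpace ℝ V] [FiniteDimensional ℝ V]
  {G : Type*} [TopologicalSpace G] [T2Space G] [ChartedSpace V G] [Group G] [LieGroup 𝓘(ℝ, V) ∞ G]
  {F : Type*} [NormedAddCommGroup F] [NormedSpace ℝ F] [FiniteDimensional ℝ F]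
  {E : G → Type*} [TopologicalSpace (TotalSpace F E)] [∀ p, AddCommGroup (E p)]
  [∀ p, Module ℝ (E p)] [∀ p, TopologicalSpace (E p)] [FiberBundle F E] [VectorBundle ℝ F E]
  [ContMDiffVectorBundle ∞ F E 𝓘(ℝ, V)]
  {A : ExactCourantAlgebroid V G F E}

theorem ExactCourantAlgebroid.exists_fiberModel_one (A : ExactCourantAlgebroid V G F E) :
    ∃ sec C, FiberModel (A.pairing 1) A.anchorOne sec C := by
  have : FiniteDimensional ℝ (E 1) := finiteDimensional_fiber F 1
  exact exists_fiberModel (A.pairing_symm 1) (A.pairing_nondegenerate 1) (A.anchor_surjective 1)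
    (A.exact 1)

theorem isOpen_timeInterval (a b : EReal) : IsOpen (timeInterval a b) :=
  (isOpen_lt continuous_const continuous_coe_real_ereal).inter
    (isOpen_lt continuous_coe_real_ereal continuous_const)

namespace LiftedAction

variable (L : LiftedAction A) {sec : V →ₗ[ℝ] E 1} {C : (V →ₗ[ℝ] ℝ) →ₗ[ℝ] E 1}
  (h : FiberModel (A.pairing 1) A.anchorOne sec C)
include h

local notation "bas" => Module.finBasis ℝ V

/-- The endomorphism of `E 1` is spread over the group by left translation; its algebraic properties
transfer because the lift preserves the pairing. -/
theorem exists_generalizedMetric {m : V →ₗ[ℝ] V →ₗ[ℝ] ℝ} (hm : IsInner (symPart m)) :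
    ∃ 𝒢 : GeneralizedMetric A, L.Represents 𝒢 sec C m := by
  have : FiniteDimensional ℝ (E 1) := finiteDimensional_fiber F 1
  let S := kEnd bas (A.pairing 1) A.anchorOne sec C m
  let k := Module.finBasis ℝ (E 1)
  -- The `d i` are dual to the basis `k` under the pairing. They express the endomorphism through
  -- pairings with left-invariant sections, which makes its smoothness visible.
  choose d hd using fun i => exists_repr_functional (A.pairing_nondegenerate 1) (k.coord i)
  refine ⟨⟨fun p => (L.trans p).toLinearMap ∘ₗ S ∘ₗ (L.trans p).symm.toLinearMap, fun a => ?_,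
    fun p e f => ?_, fun p e f => ?_, fun p e he => ?_⟩, hm, fun p e => ?_⟩
  · have h1 : ∀ p, L.trans p (S ((L.trans p).symm (a p)))
        = ∑ i, A.pairing p (a p) (L.leftSec (d i) p) • L.leftSec (S (k i)) p := fun p => by
      obtain ⟨e, he⟩ := (L.trans p).surjective (a p)
      rw [← he, LinearEquiv.symm_apply_apply]
      simp only [leftSec_apply, pairing_trans]
      conv_lhs => rw [← k.sum_repr e]
      simp only [map_sum, map_smul]
      refine Finset.sum_congr rfl fun i _ => ?_
      rw [A.pairing_symm, hd]; rfl
    have h2 : (fun p => TotalSpace.mk' F p (L.trans p (S ((L.trans p).symm (a p)))))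
        = fun p => TotalSpace.mk' F p
          (∑ i, A.pairing p (a p) (L.leftSec (d i) p) • L.leftSec (S (k i)) p) := by
      funext p; rw [h1]
    refine Eq.mpr (congrArg _ h2) ?_
    exact ContMDiff.sum_section fun i _ =>
      (A.pairing_smooth a (L.leftSec (d i))).smul_section (L.leftSec (S (k i))).contMDiff
  · obtain ⟨e, rfl⟩ := (L.trans p).surjective e
    obtain ⟨f, rfl⟩ := (L.trans p).surjective f
    simp only [LinearMap.comp_apply, LinearEquiv.coe_coe, LinearEquiv.symm_apply_apply,
      pairing_trans]
    exact h.kEnd_orthogonal _ hm e f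
  · obtain ⟨e, rfl⟩ := (L.trans p).surjective e
    obtain ⟨f, rfl⟩ := (L.trans p).surjective f
    simp only [LinearMap.comp_apply, LinearEquiv.coe_coe, LinearEquiv.symm_apply_apply,
      pairing_trans]
    exact h.kEnd_symmetric _ hm e f
  · obtain ⟨e, rfl⟩ := (L.trans p).surjective e
    simp only [LinearMap.comp_apply, LinearEquiv.coe_coe, LinearEquiv.symm_apply_apply,
      pairing_trans]
    exact h.kEnd_pos _ hm e fun h0 => he (by rw [h0, map_zero])
  · simp only [LinearMap.comp_apply, LinearEquiv.coe_coe, LinearEquiv.symm_apply_apply]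
    rfl

variable {L} {𝒢 : ℝ → GeneralizedMetric A} {m : ℝ → V →ₗ[ℝ] V →ₗ[ℝ] ℝ}

theorem hasDerivAt_form_of_solution {t : ℝ} (hr : ∀ᶠ s in 𝓝 t, L.Represents (𝒢 s) sec C (m s))
    (hd : ∀ p (e : E p) (ℓ : E p →ₗ[ℝ] ℝ), HasDerivAt (fun s => ℓ ((𝒢 s).toEnd p e))
      (ℓ ((-2 : ℝ) • (𝒢 t).toEnd p ((𝒢 t).genRicci p e))) t) (x y : V) :
    HasDerivAt (fun s => m s x y) (flowX bas (lieBr V G)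
      (torsionForm (A.pairing 1) sec L.fiberBr) (m t) x y) t := by
  obtain ⟨R, hR⟩ := isBilin_ricB bas (lieBr V G) (symPart (m t))
    (flowH (lieBr V G) (torsionForm (A.pairing 1) sec L.fiberBr) (m t))
  obtain ⟨D, hD⟩ := isBilin_codiff bas (lieBr V G) (symPart (m t))
    (flowH (lieBr V G) (torsionForm (A.pairing 1) sec L.fiberBr) (m t))
  rw [flowX, hR, hD]
  refine h.hasDerivAt_of_kEnd bas (hr.mono fun s hs => hs.1) (fun a ℓ => ?_) x y
  have h1 := hd 1 a ℓ
  have h2 : ∀ s, L.Represents (𝒢 s) sec C (m s) → ∀ b, (𝒢 s).toEnd 1 b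
      = kEnd bas (A.pairing 1) A.anchorOne sec C (m s) b := fun s hs b => by
    have := hs.2 1 b
    rwa [trans_one, trans_one] at this
  have h3 := hr.self_of_nhds.genRicci h hR hD 1 a
  rw [trans_one, trans_one] at h3
  rw [h2 t hr.self_of_nhds, h3] at h1
  refine h1.congr_of_eventuallyEq ?_
  filter_upwards [hr] with s hs
  rw [h2 s hs]

theorem hasDerivAt_toEnd_of_form {t : ℝ} (hr : ∀ᶠ s in 𝓝 t, L.Represents (𝒢 s) sec C (m s))
    (hd : ∀ x y, HasDerivAt (fun s => m s x y) (flowX bas (lieBr V G)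
      (torsionForm (A.pairing 1) sec L.fiberBr) (m t) x y) t)
    (p : G) (f : E p) (ℓ : E p →ₗ[ℝ] ℝ) : HasDerivAt (fun s => ℓ ((𝒢 s).toEnd p f))
      (ℓ ((-2 : ℝ) • (𝒢 t).toEnd p ((𝒢 t).genRicci p f))) t := by
  have hrt := hr.self_of_nhds
  have hH := L.isFiberBracket.isClosed3 h
  have hHm := IsClosed3.flowH lieBr_isLieBracket hH (m := m t)
  obtain ⟨R, hR⟩ := isBilin_ricB bas (lieBr V G) (symPart (m t))
    (flowH (lieBr V G) (torsionForm (A.pairing 1) sec L.fiberBr) (m t))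
  obtain ⟨D, hD⟩ := isBilin_codiff bas (lieBr V G) (symPart (m t))
    (flowH (lieBr V G) (torsionForm (A.pairing 1) sec L.fiberBr) (m t))
  obtain ⟨e, rfl⟩ := (L.trans p).surjective f
  have h1 := h.hasDerivAt_kEnd_flow bas (hr.mono fun s hs => hs.1) (R := R) (D := D)
    (fun x y => by
      rw [← hR, ← hR]
      exact hrt.1.ricB_symm bas lieBr_isLieBracket _ x y)
    (fun x y => by
      rw [← hD, ← hD]
      exact hrt.1.codiff_skew bas lieBr_isLieBracket hHm x y)
    (fun x y => by
      have := hd x y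
      rwa [flowX, hR, hD] at this) e (ℓ ∘ₗ (L.trans p).toLinearMap)
  rw [hrt.genRicci h hR hD, hrt.2, ← map_smul]
  refine h1.congr_of_eventuallyEq ?_
  filter_upwards [hr] with s hs
  rw [hs.2]; rfl

/-- Maximality is stated for generalized metrics and is needed for forms: an extension of the ODE is
realized by generalized metrics, and these solve the flow. -/
theorem eq_of_isMaximal {a b a' b' : EReal} (hmax : IsMaximalLeftInvariantSolution L 𝒢 a b)
    (hr : ∀ t ∈ timeInterval a b, L.Represents (𝒢 t) sec C (m t)) (ha : a' ≤ a) (hb : b ≤ b')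
    (hm : ∀ t ∈ timeInterval a' b', IsInner (symPart (m t)) ∧ ∀ x y, HasDerivAt (fun s => m s x y)
      (flowX bas (lieBr V G) (torsionForm (A.pairing 1) sec L.fiberBr) (m t) x y) t) :
    a' = a ∧ b' = b := by
  classical
  have : Nonempty (GeneralizedMetric A) := ⟨𝒢 0⟩
  choose! 𝒦 h𝒦 using fun t (ht : t ∈ timeInterval a' b') =>
    L.exists_generalizedMetric h (hm t ht).1
  -- The original metrics are kept on the old interval, so that the new family literally extends the
  -- old one; elsewhere any representative will do.
  let 𝒢' : ℝ → GeneralizedMetric A := fun t => if t ∈ timeInterval a b then 𝒢 t else 𝒦 t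
  have hr' : ∀ t ∈ timeInterval a' b', L.Represents (𝒢' t) sec C (m t) := fun t ht => by
    by_cases hJ : t ∈ timeInterval a b
    · simpa only [𝒢', if_pos hJ] using hr t hJ
    · simpa only [𝒢', if_neg hJ] using h𝒦 t ht
  refine hmax.2.2 a' b' 𝒢' ha hb (fun t ht => ⟨(hr' t ht).isLeftInvariant, ?_⟩)
    fun t ht => if_pos ht
  exact hasDerivAt_toEnd_of_form h
    (Filter.eventually_of_mem ((isOpen_timeInterval a' b').mem_nhds ht) hr') (hm t ht).2

end LiftedAction

end FlowEquivalence

end GenRicci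

end

/-! ### Conclusion. -/

theorem mainTheorem5
    {V : Type*} [NormedAddCommGroup V] [NormedSpace ℝ V] [FiniteDimensional ℝ V]
    {G : Type*} [TopologicalSpace G] [T2Space G] [ChartedSpace V G] [Group G]
    [LieGroup 𝓘(ℝ, V) ∞ G] [SimplyConnectedSpace G]
    {F : Type*} [NormedAddCommGroup F] [NormedSpace ℝ F] [FiniteDimensional ℝ F]
    {E : G → Type*} [TopologicalSpace (TotalSpace F E)] [∀ p, AddCommGroup (E p)]
    [∀ p, Module ℝ (E p)] [∀ p, TopologicalSpace (E p)] [FiberBundle F E] [VectorBundle ℝ F E]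
    [ContMDiffVectorBundle ∞ F E 𝓘(ℝ, V)]
    (A : GenRicci.ExactCourantAlgebroid V G F E) (L : GenRicci.LiftedAction A)
    (𝒢 : ℝ → GenRicci.GeneralizedMetric A) (εm εp : EReal)
    (h : GenRicci.IsMaximalLeftInvariantSolution L 𝒢 εm εp) :
    (∀ T : ℝ, εp = (T : EReal) →
      ∀ p : G, Tendsto (fun t => (𝒢 t).genScalarCurvature p) (𝓝[<] T) atTop) ∧
    (∀ T : ℝ, εm = (T : EReal) →
      ∀ p : G, Tendsto (fun t => (𝒢 t).genScalarCurvature p) (𝓝[>] T) atBot) := by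
  obtain ⟨sec, C, hf⟩ := A.exists_fiberModel_one
  have hJ := GenRicci.isOpen_timeInterval εm εp
  have hrep : ∀ t ∈ GenRicci.timeInterval εm εp, ∃ m, L.Represents (𝒢 t) sec C m := fun t ht =>
    L.exists_represents hf (h.2.1 t ht).1
  choose! m hm using hrep
  have hbr := GenRicci.lieBr_isLieBracket (V := V) (G := G)
  have hH := L.isFiberBracket.isClosed3 hf
  have hflow := fun t (ht : t ∈ GenRicci.timeInterval εm εp) =>
    GenRicci.LiftedAction.hasDerivAt_form_of_solution hf
      (Filter.eventually_of_mem (hJ.mem_nhds ht) hm) (h.2.1 t ht).2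
  have hscal : ∀ (p : G), ∀ t ∈ GenRicci.timeInterval εm εp, (𝒢 t).genScalarCurvature p
      = GenRicci.flowS (Module.finBasis ℝ V) (GenRicci.lieBr V G)
        (GenRicci.torsionForm (A.pairing 1) sec L.fiberBr) (m t) := fun p t ht =>
    (hm t ht).genScalarCurvature hf p
  refine ⟨?_, ?_⟩
  · rintro T rfl p
    -- The left end may be `-∞`, so the ODE argument is run on a real subinterval ending at `T`.
    obtain ⟨a, ha, haT⟩ := EReal.lt_iff_exists_real_btwn.1 h.1
    rw [EReal.coe_lt_coe_iff] at haT
    have hsub : ∀ t ∈ Ioo a T, t ∈ GenRicci.timeInterval εm T := fun t ht =>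
      ⟨ha.trans (EReal.coe_lt_coe_iff.2 ht.1), EReal.coe_lt_coe_iff.2 ht.2⟩
    rcases GenRicci.tendsto_or_exists_extension hbr hH (Or.inl rfl) haT
      (fun t ht => (hm t (hsub t ht)).1)
      (fun t ht x y => by rw [one_mul]; exact hflow t (hsub t ht) x y) with hlim | hext
    · refine hlim.congr' ?_
      filter_upwards [Ioo_mem_nhdsLT haT] with t ht
      rw [one_mul, hscal p t (hsub t ht)]
    · exfalso
      obtain ⟨δ, hδ, k, hk, hkd⟩ := hext
      have hkJ : ∀ t ∈ GenRicci.timeInterval εm T, k t = m t := fun t ht =>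
        hk t (EReal.coe_lt_coe_iff.1 ht.2)
      -- The extended curve lives up to `T + δ` with the same left end, so maximality would give `T
      -- + δ = T`.
      have := GenRicci.LiftedAction.eq_of_isMaximal hf h (m := k) (b' := ((T + δ : ℝ) : EReal))
        (fun t ht => by rw [hkJ t ht]; exact hm t ht) le_rfl
        (EReal.coe_le_coe_iff.2 (by linarith)) (fun t ht => by
          rcases lt_or_ge t T with htT | htT
          · have htJ : t ∈ GenRicci.timeInterval εm T := ⟨ht.1, EReal.coe_lt_coe_iff.2 htT⟩
            rw [hk t htT]
            refine ⟨(hm t htJ).1, fun x y => (hflow t htJ x y).congr_of_eventuallyEq ?_⟩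
            filter_upwards [Iio_mem_nhds htT] with s hs
            rw [hk s hs]
          · simpa only [one_mul] using hkd t ⟨haT.trans_le htT, EReal.coe_lt_coe_iff.1 ht.2⟩)
      have := EReal.coe_eq_coe_iff.1 this.2
      linarith
  · rintro T rfl p
    obtain ⟨b, hTb, hb⟩ := EReal.lt_iff_exists_real_btwn.1 h.1
    rw [EReal.coe_lt_coe_iff] at hTb
    have hsub : ∀ t ∈ Ioo (-b) (-T), -t ∈ GenRicci.timeInterval T εp := fun t ht =>
      ⟨EReal.coe_lt_coe_iff.2 (by linarith [ht.2]),
        (EReal.coe_lt_coe_iff.2 (by linarith [ht.1])).trans hb⟩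
    -- Under `t ↦ -t` the left end `T` becomes the right end `-T`, and the reversed curve solves the
    -- ODE with `σ = -1`. Divergence of `-S` to `+∞` is then the claim.
    rcases GenRicci.tendsto_or_exists_extension (m := fun t => m (-t)) hbr hH (Or.inr rfl)
      (neg_lt_neg hTb) (fun t ht => (hm _ (hsub t ht)).1)
      (fun t ht x y => by
        have h1 := GenRicci.hasDerivAt_comp_neg (hflow _ (hsub t ht) x y)
        simpa only [neg_mul, one_mul] using h1) with hlim | hext
    · have h1 := tendsto_neg_atTop_atBot.comp (hlim.comp (tendsto_neg_nhdsGT (a := T)))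
      refine h1.congr' ?_
      filter_upwards [Ioo_mem_nhdsGT hTb] with t ht
      have h2 := hscal p t (by simpa using hsub (-t) ⟨by linarith [ht.2], by linarith [ht.1]⟩)
      simp [h2]
    · exfalso
      obtain ⟨δ, hδ, k, hk, hkd⟩ := hext
      have hkT : ∀ t, T < t → k (-t) = m t := fun t ht => by
        rw [hk (-t) (neg_lt_neg ht), neg_neg]
      have := GenRicci.LiftedAction.eq_of_isMaximal hf h (m := fun t => k (-t))
        (a' := ((T - δ : ℝ) : EReal))
        (fun t ht => by rw [hkT t (EReal.coe_lt_coe_iff.1 ht.1)]; exact hm t ht)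
        (EReal.coe_le_coe_iff.2 (by linarith)) le_rfl (fun t ht => by
          rcases lt_or_ge T t with htT | htT
          · have htJ : t ∈ GenRicci.timeInterval T εp := ⟨EReal.coe_lt_coe_iff.2 htT, ht.2⟩
            rw [hkT t htT]
            refine ⟨(hm t htJ).1, fun x y => (hflow t htJ x y).congr_of_eventuallyEq ?_⟩
            filter_upwards [Ioi_mem_nhds htT] with s hs
            rw [hkT s hs]
          · obtain ⟨h1, h2⟩ := hkd (-t)
              ⟨by linarith, by linarith [EReal.coe_lt_coe_iff.1 ht.1]⟩
            refine ⟨h1, fun x y => ?_⟩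
            have h3 := GenRicci.hasDerivAt_comp_neg (h2 x y)
            simpa only [neg_mul, one_mul, neg_neg] using h3)
      have := EReal.coe_eq_coe_iff.1 this.1
      linarith
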